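/- **Setting.** Fix $d\in\mathbb N$, a finite set $\mathfrak L$ of types and a colour $i>0$. A *typed rooted forest* $F$ is a finite (possibly empty) forest with node set $N_F$ and edge set $E_F\subset N_F^2$, with one root in each connected component, edges $(x,y)=(x\to y)$ oriented away from the root, and a type $\mathfrak t(e)\in\mathfrak L$ for each edge. A *subforest* $A\subset F$ is a pair $(N_A,E_A)$ with $N_A\subset N_F$, $E_A\subset E_F$, such that the endpoints of edges in $E_A$ are in $N_A$; $A\cap B=\emptyset$ means $N_A\cap N_B=\emptyset$. A *coloured forest* $(F,\hat F)$ carries a map $\hat F:E_F\sqcup N_F\to\mathbb N$ with $\hat F(x)=\hat F(y)=\hat F(e)$ whenever $e=(x,y)$ and $\hat F(e)\neq0$; for $j>0$, $\hat F_j=\hat F^{-1}(j)$ is a subforest, and $\hat E$ is the set of edges with $\hat F\ne 0$. A *decorated forest* is an isomorphism class of tuples $(F,\hat F,\mathfrak n,\mathfrak o,\mathfrak e)$ with $\mathfrak n:N_F\to\mathbb N^d$, $\mathfrak o:N_F\to\mathbb Z^d\oplus\mathbb Z(\mathfrak L)$ vanishing where $\hat F=0$, and $\mathfrak e:E_F\to\mathbb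 N^d$ vanishing on $\hat E$. The forest product is disjoint union. The bigrading is $|\tau|_{\rm bi}=(|\mathfrak e|,\ \#\{\text{edges and non-root nodes on which }\hat F=0\})$. A *bigraded space* is a family $(V_n)_{n\in\mathbb N^2}$ of real vector spaces, with associated space of formal sums $\sum_n v_n$, $v_n\in V_n$, such that for some $k$, $v_n=0$ whenever $n_2>k$; $(V\hat\otimes W)_n=\bigoplus_{m+\ell=n}V_m\otimes W_\ell$. With $m\ge n$ iff $m_1\ge n_1$ and $m_2\le n_2$, the morphisms are the *triangular* maps $(\sum_nv_n)\mapsto\sum_m(\sum_nA_{mn}v_n)$ with $A_{mn}:V_n\to W_m$ linear and $A_{mn}=0$ unless $m\ge n$. For a set $S$ of decorated forests, $\langle S\rangle$ is the bigraded space with $\langle S\rangle_n$ free on $\{\tau\in S:|\tau|_{\rm bi}=n\}$. **Assumptions.** For each coloured forest $(F,\hat F)$ let a collection $\mathfrak A_i(F,\hat F)$ of subforests of $F$ be given, invariant under isomorphisms of coloured forests, such that: 1. for every $A\in\mathfrak A_i(F,\hat F)$: $\hat F_i\subset A$; $\hat F_j\cap A=\emptyset$ for $j>i$; for $0<j<i$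 every connected component of $\hat F_j$ is either contained in $A$ or disjoint from $A$. (Then $(A,\hat F\restriction A)$ is a coloured forest, and so is $(F,\hat F\cup_iA)$, where $\hat F\cup_iA$ equals $i$ on $A$ and $\hat F$ elsewhere.) 2. $\mathfrak A_i(F\sqcup G,\hat F+\hat G)=\{C\sqcup D: C\in\mathfrak A_i(F,\hat F),\,D\in\mathfrak A_i(G,\hat G)\}$; and [$A\in\mathfrak A_i(F,\hat F)$ and $B\in\mathfrak A_i(F,\hat F\cup_iA)$] iff [$B\in\mathfrak A_i(F,\hat F)$ and $A\in\mathfrak A_i(B,\hat F\restriction B)$]. 3. If $\hat F_i\in\mathfrak A_i(F,\hat F)$ and $A\in\mathfrak A_i(F,\hat F)$, then $\{A,\hat F_i\}\subset\mathfrak A_i(A,\hat F\restriction A)$ and, if $\hat F\le i$, $\{F,A\}\subset\mathfrak A_i(F,\hat F\cup_iA)$. 4. Let $\mathcal K(F,\hat F)$ be the coloured forest obtained from $(N_F,E_F\setminus\hat E)$ by identifying nodes that are joined by edges in $\hat E$, and let $\pi$ be the projection of the nodes. Mapping a subforest $A$ of it to the subforest of $F$ with nodes $\pi^{-1}(N_A)$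 and edges those $(x,y)\in E_F$ with $\pi(x)=\pi(y)\in N_A$ or $(\pi(x),\pi(y))\in E_A$ is a bijection from $\mathfrak A_i(\mathcal K(F,\hat F))$ to $\mathfrak A_i(F,\hat F)$. Let $\mathfrak F_i$ be the set of decorated forests with $\hat F\le i$ and $\{F,\hat F_i\}\subset\mathfrak A_i(F,\hat F)$, and assume that the empty forest $\mathbf 1$ belongs to $\mathfrak F_i$. **Structure maps.** On representatives, $$\Delta_i(F,\hat F,\mathfrak n,\mathfrak o,\mathfrak e)=\sum_{A\in\mathfrak A_i(F,\hat F)}\ \sum_{\varepsilon,\mathfrak n_A}\frac1{\varepsilon!}\binom{\mathfrak n}{\mathfrak n_A}\,(A,\hat F\restriction A,\mathfrak n_A+\pi\varepsilon,\mathfrak o,\mathfrak e)\otimes\big(F,\hat F\cup_iA,\mathfrak n-\mathfrak n_A,\mathfrak o+\mathfrak n_A+\pi(\varepsilon-\mathfrak e\mathbf 1_{E_A}),\mathfrak e\mathbf 1_{E_F\setminus E_A}+\varepsilon\big),$$ where $\mathfrak n_A\le\mathfrak n$ is supported in $N_A$, $\varepsilon:E_F\to\mathbb N^d$ is supported on the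 edges $(x,y)\in E_F\setminus E_A$ with $x\in N_A$, and $\pi\varepsilon(x)=\sum_{(x,y)\in E_F}\varepsilon(x,y)$. The counit $\mathbf 1_i^\star$ is the indicator of $\{(F,\hat F,0,\mathfrak o,0)\in\mathfrak F_i:\hat F\equiv i\}$ (the empty forest included). The operator $\mathcal K_i$ is defined on $\tau\in\mathfrak F_i$ as follows: write $\tau=\mu\cdot\nu$, where $\nu$ consists of the connected components of $\tau$ on which $\hat F\equiv i$; then $\mathcal K_i\tau=\mathcal K(\mu)\cdot(\bullet,i,\sum_\nu\mathfrak n,0,0)$. Here $\mathcal K$ contracts the edges in $\hat E$ as above, sums $\mathfrak n$ and $\mathfrak o$ over each class of identified nodes, adds to $\mathfrak o$ the types of all edges inside the class, and restricts $\mathfrak e$. Then $\mathcal K_i$ is extended to $\langle\mathfrak F_i\rangle$; put $\mathcal H_i=\langle\mathfrak F_i\rangle/\ker\mathcal K_i$ (with components $\langle\mathfrak F_i\rangle_n/\ker\mathcal K_i$). **Proposition.** $\mathfrak F_i$ is closed under the forest product, all terms of $\Delta_i\tau$, $\tau\in\mathfrak F_i$, lie in $\mathfrak F_i\otimes\mathfrak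 F_i$, and the forest product $\cdot$, the class $\mathbf 1_i$ of $\mathbf 1$, $\Delta_i$ and $\mathbf 1_i^\star$ induce triangular maps on $\mathcal H_i$ for which $(\mathcal H_i,\cdot,\Delta_i,\mathbf 1_i,\mathbf 1_i^\star)$ is a Hopf algebra in the category of bigraded spaces and triangular maps. Let $|\tau|_i$ be the number of nodes and edges of $\tau$ whose colour is not $i$, and $|\mathfrak n|=\sum_{x}|\mathfrak n(x)|$. The antipode $\mathcal A_i$ satisfies $\mathcal A_i\tau=(-1)^{|\mathfrak n|}\tau$ if $|\tau|_i=0$ and, if $|\tau|_i>0$, the recursion $$\mathcal A_i\tau=-\sum c\;\mathcal A_i(\tau^{(1)})\cdot\tau^{(2)},$$ where the sum runs over all terms $c\,\tau^{(1)}\otimes\tau^{(2)}$ of $\Delta_i\tau$ except the one with $A=F$, $\mathfrak n_A=\mathfrak n$; in all these terms $\tau^{(1)}$ has smaller $|\cdot|_i$ than $\tau$, or the same $|\cdot|_i$ and smaller $|\mathfrak n|$. -/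

import Mathlib

open scoped TensorProduct

namespace HopfForest

/-! ## Typed rooted forests, colourings, decorations -/

/-- A finite typed rooted forest with types in `L`, as a finite directed graph in incidence form:
`a : E` is an edge `src a → tgt a` pointing away from the root of its component. Every node has at
most one incoming edge (`tgt_inj`; so edges may be identified with pairs of nodes) and there is a
level function increasing along the edges, i.e. there are no cycles. Roots are the nodes
without incoming edge, one in each connected component. The empty forest is allowed. -/
structure Forest (L : Type) where
  N : Type
  E : Type
  src : E → N
  tgt : E → N
  typ : E → L
  finN : Finite N
  tgt_inj : Function.Injective tgt
  acyclic : ∃ h : N → ℕ, ∀ a, h (src a) < h (tgt a)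

instance {L : Type} (F : Forest L) : Finite F.N := F.finN

instance {L : Type} (F : Forest L) : Finite F.E := Finite.of_injective F.tgt F.tgt_inj

noncomputable instance {L : Type} (F : Forest L) : Fintype F.N := Fintype.ofFinite _

noncomputable instance {L : Type} (F : Forest L) : Fintype F.E := Fintype.ofFinite _

/-- A coloured forest `(F, F̂)`: `F̂` is given by `cN` on nodes and by `cE` on edges; `0` means
"not coloured". -/
structure CForest (L : Type) extends Forest L where
  cN : N → ℕ
  cE : E → ℕ
  col : ∀ a, cE a ≠ 0 → cN (src a) = cE a ∧ cN (tgt a) = cE a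

/-- A representative `(F, F̂, 𝔫, 𝔬, 𝔢)` of a decorated forest. -/
structure DForest (d : ℕ) (L : Type) extends CForest L where
  nn : N → Fin d → ℕ
  oo : N → (Fin d → ℤ) × (L →₀ ℤ)
  ee : E → Fin d → ℕ
  oo_supp : ∀ v, cN v = 0 → oo v = 0
  ee_supp : ∀ a, cE a ≠ 0 → ee a = 0

/-- Isomorphisms of coloured forests. -/
structure CIso {L : Type} (F G : CForest L) where
  eN : F.N ≃ G.N
  eE : F.E ≃ G.E
  src : ∀ a, G.src (eE a) = eN (F.src a)
  tgt : ∀ a, G.tgt (eE a) = eN (F.tgt a)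
  typ : ∀ a, G.typ (eE a) = F.typ a
  cN : ∀ v, G.cN (eN v) = F.cN v
  cE : ∀ a, G.cE (eE a) = F.cE a

/-- Isomorphisms of decorated forests. -/
structure DIso {d : ℕ} {L : Type} (x y : DForest d L) extends CIso x.toCForest y.toCForest where
  nn : ∀ v, y.nn (eN v) = x.nn v
  oo : ∀ v, y.oo (eN v) = x.oo v
  ee : ∀ a, y.ee (eE a) = x.ee a

def CIso.symm {L : Type} {F G : CForest L} (φ : CIso F G) : CIso G F where
  eN := φ.eN.symm
  eE := φ.eE.symm
  src a := by rw [Equiv.eq_symm_apply, ← φ.src, Equiv.apply_symm_apply]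
  tgt a := by rw [Equiv.eq_symm_apply, ← φ.tgt, Equiv.apply_symm_apply]
  typ a := by rw [← φ.typ, Equiv.apply_symm_apply]
  cN v := by rw [← φ.cN, Equiv.apply_symm_apply]
  cE a := by rw [← φ.cE, Equiv.apply_symm_apply]

def DIso.refl {d : ℕ} {L : Type} (x : DForest d L) : DIso x x where
  eN := Equiv.refl _
  eE := Equiv.refl _
  src _ := rfl
  tgt _ := rfl
  typ _ := rfl
  cN _ := rfl
  cE _ := rfl
  nn _ := rfl
  oo _ := rfl
  ee _ := rfl

def DIso.symm {d : ℕ} {L : Type} {x y : DForest d L} (φ : DIso x y) : DIso y x where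
  toCIso := φ.toCIso.symm
  nn v := by
    change x.nn (φ.eN.symm v) = _
    rw [← φ.nn, Equiv.apply_symm_apply]
  oo v := by
    change x.oo (φ.eN.symm v) = _
    rw [← φ.oo, Equiv.apply_symm_apply]
  ee a := by
    change x.ee (φ.eE.symm a) = _
    rw [← φ.ee, Equiv.apply_symm_apply]

def DIso.trans {d : ℕ} {L : Type} {x y z : DForest d L} (φ : DIso x y) (ψ : DIso y z) :
    DIso x z where
  eN := φ.eN.trans ψ.eN
  eE := φ.eE.trans ψ.eE
  src a := by simp [ψ.src, φ.src]
  tgt a := by simp [ψ.tgt, φ.tgt]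
  typ a := by simp [ψ.typ, φ.typ]
  cN a := by simp [ψ.cN, φ.cN]
  cE a := by simp [ψ.cE, φ.cE]
  nn a := by simp [ψ.nn, φ.nn]
  oo a := by simp [ψ.oo, φ.oo]
  ee a := by simp [ψ.ee, φ.ee]

instance DForest.setoid (d : ℕ) (L : Type) : Setoid (DForest d L) where
  r x y := Nonempty (DIso x y)
  iseqv := ⟨fun x => ⟨DIso.refl x⟩, fun ⟨φ⟩ => ⟨φ.symm⟩, fun ⟨φ⟩ ⟨ψ⟩ => ⟨φ.trans ψ⟩⟩

/-- The set `𝔉` of decorated forests: isomorphism classes. -/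
abbrev DecForest (d : ℕ) (L : Type) : Type 1 := Quotient (DForest.setoid d L)

/-- The bigrading `(|𝔢|, |F ∖ (F̂ ∪ ρ_F)|)` of a representative. -/
noncomputable def DForest.deg {d : ℕ} {L : Type} (x : DForest d L) : ℕ × ℕ :=
  (∑ a, ∑ j, x.ee a j,
    Nat.card {a // x.cE a = 0} + Nat.card {v // x.cN v = 0 ∧ ∃ a, x.tgt a = v})

theorem DIso.deg_eq {d : ℕ} {L : Type} {x y : DForest d L} (φ : DIso x y) : x.deg = y.deg := by
  refine Prod.ext ?_ ?_
  · change ∑ a, ∑ j, x.ee a j = ∑ a, ∑ j, y.ee a j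
    rw [← Equiv.sum_comp φ.eE]
    simp [φ.ee]
  · change _ + _ = _ + _
    congr 1
    · exact Nat.card_congr (φ.eE.subtypeEquiv fun a => by rw [φ.cE])
    · refine Nat.card_congr (φ.eN.subtypeEquiv fun v => ?_)
      rw [φ.cN]
      refine and_congr_right fun _ => ⟨?_, ?_⟩
      · rintro ⟨a, rfl⟩
        exact ⟨φ.eE a, φ.tgt a⟩
      · rintro ⟨a, ha⟩
        refine ⟨φ.eE.symm a, φ.eN.injective ?_⟩
        rw [← φ.tgt, Equiv.apply_symm_apply, ha]

/-- The bigrading `|·|_bi` on `𝔉`. -/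
noncomputable def DecForest.deg {d : ℕ} {L : Type} (τ : DecForest d L) : ℕ × ℕ :=
  Quotient.lift (s := DForest.setoid d L) DForest.deg (fun _ _ h => Nonempty.elim h DIso.deg_eq) τ

/-! ## Subforests -/

/-- Subforests of `F`. -/
@[ext] structure Subforest {L : Type} (F : Forest L) where
  N : Set F.N
  E : Set F.E
  src_mem : ∀ a ∈ E, F.src a ∈ N
  tgt_mem : ∀ a ∈ E, F.tgt a ∈ N

namespace Subforest

variable {L : Type} {F : Forest L}

instance : LE (Subforest F) := ⟨fun A B => A.N ⊆ B.N ∧ A.E ⊆ B.E⟩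

/-- `F` as a subforest of itself. -/
instance : Top (Subforest F) := ⟨⟨Set.univ, Set.univ, fun _ _ => trivial, fun _ _ => trivial⟩⟩

/-- `v` and `w` are joined by a path of edges of `B`. -/
def Conn (B : Subforest F) : F.N → F.N → Prop :=
  Relation.EqvGen fun v w => ∃ a ∈ B.E, F.src a = v ∧ F.tgt a = w

/-- `T` is a (non-empty) connected component of `B`. -/
def IsComponent (T B : Subforest F) : Prop :=
  ∃ v ∈ B.N, T.N = {w | B.Conn v w} ∧ T.E = {a | a ∈ B.E ∧ B.Conn v (F.src a)}

end Subforest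

/-- A subforest as a forest in its own right. -/
def Forest.restr {L : Type} (F : Forest L) (A : Subforest F) : Forest L where
  N := {v // v ∈ A.N}
  E := {a // a ∈ A.E}
  src a := ⟨F.src a.1, A.src_mem _ a.2⟩
  tgt a := ⟨F.tgt a.1, A.tgt_mem _ a.2⟩
  typ a := F.typ a.1
  finN := inferInstance
  tgt_inj _ _ h := Subtype.ext (F.tgt_inj (congrArg Subtype.val h))
  acyclic := let ⟨h, hh⟩ := F.acyclic; ⟨fun v => h v.1, fun a => hh a.1⟩

/-- `(A, F̂ ↾ A)`. -/
def CForest.restr {L : Type} (F : CForest L) (A : Subforest F.toForest) : CForest L where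
  toForest := F.toForest.restr A
  cN v := F.cN v.1
  cE a := F.cE a.1
  col a h := F.col a.1 h

/-- `(A, F̂ ↾ A, 𝔪 ↾ N_A, 𝔬 ↾ N_A, 𝔢 ↾ E_A)`. -/
def DForest.restr {d : ℕ} {L : Type} (x : DForest d L) (A : Subforest x.toForest)
    (m : x.N → Fin d → ℕ) : DForest d L where
  toCForest := x.toCForest.restr A
  nn v := m v.1
  oo v := x.oo v.1
  ee a := x.ee a.1
  oo_supp v h := x.oo_supp v.1 h
  ee_supp a h := x.ee_supp a.1 h

/-- `A`, or rather `A ∩ B`, as a subforest of the forest `B`. -/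
def Subforest.within {L : Type} {F : Forest L} (A B : Subforest F) : Subforest (F.restr B) where
  N := {v | v.1 ∈ A.N}
  E := {a | a.1 ∈ A.E}
  src_mem _ h := A.src_mem _ h
  tgt_mem _ h := A.tgt_mem _ h

/-- The image of a subforest under an isomorphism. -/
def Subforest.map {L : Type} {F G : CForest L} (φ : CIso F G) (A : Subforest F.toForest) :
    Subforest G.toForest where
  N := φ.eN '' A.N
  E := φ.eE '' A.E
  src_mem := by
    rintro _ ⟨a, ha, rfl⟩
    exact ⟨_, A.src_mem a ha, (φ.src a).symm⟩
  tgt_mem := by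
    rintro _ ⟨a, ha, rfl⟩
    exact ⟨_, A.tgt_mem a ha, (φ.tgt a).symm⟩

/-- The subforest `F̂_j` of colour `j > 0` (the conjunct `j ≠ 0` makes it a subforest for the
irrelevant value `j = 0` too). -/
def CForest.hat {L : Type} (F : CForest L) (j : ℕ) : Subforest F.toForest where
  N := {v | F.cN v = j}
  E := {a | F.cE a = j ∧ j ≠ 0}
  src_mem := by
    rintro a ⟨rfl, h⟩
    exact (F.col a h).1
  tgt_mem := by
    rintro a ⟨rfl, h⟩
    exact (F.col a h).2

/-- The conditions on `A` relative to the colour `i`: `F̂_i ⊆ A`; `F̂_j ∩ A = ∅` for `j > i`; for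
`0 < j < i` each connected component of `F̂_j` is contained in `A` or disjoint from `A`. -/
structure Compat {L : Type} (i : ℕ) (F : CForest L) (A : Subforest F.toForest) : Prop where
  hat_le : F.hat i ≤ A
  disj : ∀ j, i < j → Disjoint (F.hat j).N A.N
  comp : ∀ j, 0 < j → j < i → ∀ T : Subforest F.toForest, T.IsComponent (F.hat j) →
    T ≤ A ∨ Disjoint T.N A.N

/-- An edge outside `A` which has an endpoint in `A` is not coloured. -/
theorem Compat.notMem {L : Type} {i : ℕ} {F : CForest L} {A : Subforest F.toForest}
    (h : Compat i F A) {a : F.E} (ha : a ∉ A.E) (hc : F.cE a ≠ 0) :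
    F.src a ∉ A.N ∧ F.tgt a ∉ A.N := by
  obtain ⟨h1, h2⟩ := F.col a hc
  rcases lt_trichotomy (F.cE a) i with hl | he | hg
  · let T : Subforest F.toForest :=
      { N := {w | (F.hat (F.cE a)).Conn (F.src a) w}
        E := {b | b ∈ (F.hat (F.cE a)).E ∧ (F.hat (F.cE a)).Conn (F.src a) (F.src b)}
        src_mem := fun b hb => hb.2
        tgt_mem := fun b hb => hb.2.trans _ _ _ (.rel _ _ ⟨b, hb.1, rfl, rfl⟩) }
    have hs : F.src a ∈ T.N := .refl _
    have hm : a ∈ T.E := ⟨⟨rfl, hc⟩, .refl _⟩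
    have ht : F.tgt a ∈ T.N := T.tgt_mem _ hm
    rcases h.comp (F.cE a) (Nat.pos_of_ne_zero hc) hl T ⟨F.src a, h1, rfl, rfl⟩ with hT | hT
    · exact absurd (hT.2 hm) ha
    · exact ⟨Set.disjoint_left.1 hT hs, Set.disjoint_left.1 hT ht⟩
  · exact absurd (h.hat_le.2 ⟨he, he ▸ hc⟩) ha
  · exact ⟨Set.disjoint_left.1 (h.disj _ hg) h1, Set.disjoint_left.1 (h.disj _ hg) h2⟩

open Classical in
/-- `(F, F̂ ∪_i A)`. -/
noncomputable def CForest.cup {L : Type} (F : CForest L) (i : ℕ) (A : Subforest F.toForest)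
    (h : Compat i F A) : CForest L where
  toForest := F.toForest
  cN v := if v ∈ A.N then i else F.cN v
  cE a := if a ∈ A.E then i else F.cE a
  col a hc := by
    by_cases ha : a ∈ A.E
    · simp [ha, A.src_mem a ha, A.tgt_mem a ha]
    · simp only [ha, if_false] at hc ⊢
      obtain ⟨h1, h2⟩ := h.notMem ha hc
      simpa [h1, h2] using F.col a hc

/-! ## Forest product -/

def Forest.empty (L : Type) : Forest L where
  N := Empty
  E := Empty
  src := Empty.elim
  tgt := Empty.elim
  typ := Empty.elim
  finN := inferInstance
  tgt_inj a := a.elim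
  acyclic := ⟨Empty.elim, fun a => a.elim⟩

def CForest.empty (L : Type) : CForest L where
  toForest := Forest.empty L
  cN := Empty.elim
  cE := Empty.elim
  col a := a.elim

/-- The empty decorated forest `𝟏`. -/
def DForest.empty (d : ℕ) (L : Type) : DForest d L where
  toCForest := CForest.empty L
  nn := Empty.elim
  oo := Empty.elim
  ee := Empty.elim
  oo_supp v := v.elim
  ee_supp a := a.elim

def Forest.mul {L : Type} (F G : Forest L) : Forest L where
  N := F.N ⊕ G.N
  E := F.E ⊕ G.E
  src := Sum.map F.src G.src
  tgt := Sum.map F.tgt G.tgt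
  typ := Sum.elim F.typ G.typ
  finN := inferInstance
  tgt_inj := F.tgt_inj.sumMap G.tgt_inj
  acyclic := by
    obtain ⟨h, hh⟩ := F.acyclic
    obtain ⟨k, hk⟩ := G.acyclic
    refine ⟨Sum.elim h k, ?_⟩
    rintro (a | a)
    · exact hh a
    · exact hk a

/-- `(F ⊔ G, F̂ + Ĝ)`. -/
def CForest.mul {L : Type} (F G : CForest L) : CForest L where
  toForest := F.toForest.mul G.toForest
  cN := Sum.elim F.cN G.cN
  cE := Sum.elim F.cE G.cE
  col := by
    rintro (a | a)
    · exact F.col a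
    · exact G.col a

/-- The forest product. -/
def DForest.mul {d : ℕ} {L : Type} (x y : DForest d L) : DForest d L where
  toCForest := x.toCForest.mul y.toCForest
  nn := Sum.elim x.nn y.nn
  oo := Sum.elim x.oo y.oo
  ee := Sum.elim x.ee y.ee
  oo_supp := by
    rintro (v | v)
    · exact x.oo_supp v
    · exact y.oo_supp v
  ee_supp := by
    rintro (a | a)
    · exact x.ee_supp a
    · exact y.ee_supp a

/-- `C ⊔ D` as a subforest of `F ⊔ G`. -/
def Subforest.sum {L : Type} {F G : Forest L} (C : Subforest F) (D : Subforest G) :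
    Subforest (F.mul G) where
  N := Sum.elim C.N D.N
  E := Sum.elim C.E D.E
  src_mem := by
    rintro (a | a) h
    · exact C.src_mem a h
    · exact D.src_mem a h
  tgt_mem := by
    rintro (a | a) h
    · exact C.tgt_mem a h
    · exact D.tgt_mem a h

def DIso.mul {d : ℕ} {L : Type} {x x' y y' : DForest d L} (φ : DIso x x') (ψ : DIso y y') :
    DIso (x.mul y) (x'.mul y') where
  eN := Equiv.sumCongr φ.eN ψ.eN
  eE := Equiv.sumCongr φ.eE ψ.eE
  src := by
    rintro (a | a)
    · exact congrArg Sum.inl (φ.src a)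
    · exact congrArg Sum.inr (ψ.src a)
  tgt := by
    rintro (a | a)
    · exact congrArg Sum.inl (φ.tgt a)
    · exact congrArg Sum.inr (ψ.tgt a)
  typ := by
    rintro (a | a)
    · exact φ.typ a
    · exact ψ.typ a
  cN := by
    rintro (a | a)
    · exact φ.cN a
    · exact ψ.cN a
  cE := by
    rintro (a | a)
    · exact φ.cE a
    · exact ψ.cE a
  nn := by
    rintro (a | a)
    · exact φ.nn a
    · exact ψ.nn a
  oo := by
    rintro (a | a)
    · exact φ.oo a
    · exact ψ.oo a
  ee := by
    rintro (a | a)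
    · exact φ.ee a
    · exact ψ.ee a

/-! ## Contraction of the coloured subforests -/

namespace CForest

variable {L : Type} (F : CForest L)

/-- `v → w` is a coloured edge. The contraction has as nodes the quotient by the
equivalence relation generated by `F.Step`. -/
def Step (v w : F.N) : Prop := ∃ a, F.cE a ≠ 0 ∧ F.src a = v ∧ F.tgt a = w

/-- Nodes of the contracted forest. -/
abbrev KN : Type := Quot F.Step

theorem Step.cN_eq {v w : F.N} (h : F.Step v w) : F.cN v = F.cN w := by
  obtain ⟨a, ha, rfl, rfl⟩ := h
  rw [(F.col a ha).1, (F.col a ha).2]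

/-- `r` is the root of the connected component of `v` in the union of the coloured subforests. -/
def IsTop (r v : F.N) : Prop := Relation.ReflTransGen F.Step r v ∧ ∀ w, ¬ F.Step w r

theorem exists_isTop (v : F.N) : ∃ r, F.IsTop r v := by
  obtain ⟨h, hh⟩ := F.acyclic
  induction hn : h v using Nat.strong_induction_on generalizing v with
  | _ n ih =>
    by_cases hv : ∃ w, F.Step w v
    · obtain ⟨w, hw⟩ := hv
      have hlt : h w < h v := by
        obtain ⟨a, -, rfl, rfl⟩ := hw
        exact hh a
      obtain ⟨r, hr⟩ := ih (h w) (hn ▸ hlt) w rfl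
      exact ⟨r, hr.1.tail hw, hr.2⟩
    · exact ⟨v, .refl, fun w hw => hv ⟨w, hw⟩⟩

theorem Step.unique {v v' w : F.N} (h : F.Step v w) (h' : F.Step v' w) : v = v' := by
  obtain ⟨a, -, rfl, ha⟩ := h
  obtain ⟨b, -, rfl, hb⟩ := h'
  rw [F.tgt_inj (ha.trans hb.symm)]

theorem IsTop.unique {r s v : F.N} (hr : F.IsTop r v) (hs : F.IsTop s v) : r = s := by
  obtain ⟨hr, hr'⟩ := hr
  induction hr with
  | refl =>
    rcases Relation.ReflTransGen.cases_tail hs.1 with h | ⟨w, -, hw⟩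
    · exact h
    · exact absurd hw (hr' w)
  | @tail u v _ huv ih =>
    rcases Relation.ReflTransGen.cases_tail hs.1 with rfl | ⟨w, hw, hwv⟩
    · exact absurd huv (hs.2 u)
    · obtain rfl := Step.unique F huv hwv
      exact ih ⟨hw, hs.2⟩

noncomputable def top (v : F.N) : F.N := (F.exists_isTop v).choose

theorem isTop_top (v : F.N) : F.IsTop (F.top v) v := (F.exists_isTop v).choose_spec

theorem top_eq_of_step {v w : F.N} (h : F.Step v w) : F.top v = F.top w :=
  IsTop.unique F ⟨(F.isTop_top v).1.tail h, (F.isTop_top v).2⟩ (F.isTop_top w)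

/-- The root of a class of nodes. -/
noncomputable def ktop : F.KN → F.N := Quot.lift F.top fun _ _ => F.top_eq_of_step

theorem top_le {h : F.N → ℕ} (hh : ∀ a, h (F.src a) < h (F.tgt a)) (v : F.N) :
    h (F.top v) ≤ h v := by
  have key : ∀ r w, Relation.ReflTransGen F.Step r w → h r ≤ h w := by
    intro r w hrw
    induction hrw with
    | refl => exact le_rfl
    | tail _ hs ih =>
      obtain ⟨a, -, rfl, rfl⟩ := hs
      exact ih.trans (hh a).le
  exact key _ _ (F.isTop_top v).1

theorem top_tgt {a : F.E} (ha : F.cE a = 0) : F.top (F.tgt a) = F.tgt a := by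
  refine IsTop.unique F (F.isTop_top _) ⟨.refl, ?_⟩
  rintro w ⟨b, hb, -, hbt⟩
  exact hb (F.tgt_inj hbt ▸ ha)

theorem mk_src_ne {a : F.E} (ha : F.cE a = 0) :
    Quot.mk F.Step (F.src a) ≠ Quot.mk F.Step (F.tgt a) := by
  intro he
  obtain ⟨h, hh⟩ := F.acyclic
  have h1 : F.top (F.src a) = F.top (F.tgt a) := congrArg F.ktop he
  have h2 := F.top_le hh (F.src a)
  rw [h1, F.top_tgt ha] at h2
  exact absurd (hh a) (not_lt.2 h2)

/-- The contraction `𝒦(F, F̂)`: the quotient graph of `(N_F, E_F ∖ Ê)` by `∼`, with the induced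
colouring. -/
def contract : CForest L where
  N := F.KN
  E := {a // F.cE a = 0}
  src a := Quot.mk _ (F.src a.1)
  tgt a := Quot.mk _ (F.tgt a.1)
  typ a := F.typ a.1
  finN := inferInstance
  tgt_inj a b hab := by
    have h : F.top (F.tgt a.1) = F.top (F.tgt b.1) := congrArg F.ktop hab
    rw [F.top_tgt a.2, F.top_tgt b.2] at h
    exact Subtype.ext (F.tgt_inj h)
  acyclic := by
    obtain ⟨h, hh⟩ := F.acyclic
    refine ⟨fun X => h (F.ktop X), fun a => ?_⟩
    change h (F.top (F.src a.1)) < h (F.top (F.tgt a.1))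
    rw [F.top_tgt a.2]
    exact (F.top_le hh _).trans_lt (hh a.1)
  cN := Quot.lift F.cN fun _ _ => Step.cN_eq F
  cE _ := 0
  col _ h := absurd rfl h

/-- The map `𝒦^♯` from subforests of the contracted forest to subforests of `F`. -/
def sharp (A : Subforest F.contract.toForest) : Subforest F.toForest where
  N := {v | Quot.mk F.Step v ∈ A.N}
  E := {a | (Quot.mk F.Step (F.src a) = Quot.mk F.Step (F.tgt a) ∧
      Quot.mk F.Step (F.src a) ∈ A.N) ∨ ∃ h : F.cE a = 0, (⟨a, h⟩ : {a // F.cE a = 0}) ∈ A.E}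
  src_mem := by
    rintro a (⟨-, h⟩ | ⟨h, ha⟩)
    · exact h
    · exact A.src_mem ⟨a, h⟩ ha
  tgt_mem := by
    rintro a (⟨he, h⟩ | ⟨h, ha⟩)
    · exact (he ▸ h : Quot.mk F.Step (F.tgt a) ∈ A.N)
    · exact A.tgt_mem ⟨a, h⟩ ha

end CForest

open Classical in
/-- The contraction `𝒦(F, F̂, 𝔫, 𝔬, 𝔢)`: `𝔫` and `𝔬` are summed over each class of nodes, the
types of the edges inside a class are added to `𝔬`, and `𝔢` is restricted. -/
noncomputable def DForest.contract {d : ℕ} {L : Type} (x : DForest d L) : DForest d L where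
  toCForest := x.toCForest.contract
  nn X := ∑ v : x.N, if Quot.mk x.Step v = X then x.nn v else 0
  oo X := (∑ v : x.N, if Quot.mk x.Step v = X then x.oo v else 0) +
    ∑ a : x.E, if Quot.mk x.Step (x.src a) = X ∧ Quot.mk x.Step (x.tgt a) = X then
      (0, Finsupp.single (x.typ a) 1) else 0
  ee a := x.ee a.1
  oo_supp X hX := by
    have h1 : ∀ v : x.N, Quot.mk x.Step v = X → x.cN v = 0 := by
      rintro v rfl
      exact hX
    rw [Finset.sum_eq_zero, Finset.sum_eq_zero, add_zero]
    · intro a _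
      refine if_neg ?_
      rintro ⟨hs, ht⟩
      have hc : x.cE a ≠ 0 := fun h0 => x.mk_src_ne h0 (hs.trans ht.symm)
      exact hc ((x.col a hc).1 ▸ h1 _ hs)
    · intro v _
      split_ifs with hv
      · exact x.oo_supp v (h1 v hv)
      · rfl
  ee_supp a h := absurd rfl h

/-! ## The operator `𝒦_i` -/

/-- The connected component of `v` in `F` is entirely coloured with `i`. -/
def CForest.Full {L : Type} (F : CForest L) (i : ℕ) (v : F.N) : Prop :=
  (∀ w, (⊤ : Subforest F.toForest).Conn v w → F.cN w = i) ∧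
    ∀ a, (⊤ : Subforest F.toForest).Conn v (F.src a) → F.cE a = i

theorem CForest.Full.of_conn {L : Type} {F : CForest L} {i : ℕ} {v w : F.N}
    (h : (⊤ : Subforest F.toForest).Conn v w) (hv : F.Full i v) : F.Full i w :=
  ⟨fun u hu => hv.1 u (h.trans _ _ _ hu), fun a ha => hv.2 a (h.trans _ _ _ ha)⟩

/-- The union of the connected components of `F` that are not entirely coloured with `i`. -/
def CForest.core {L : Type} (F : CForest L) (i : ℕ) : Subforest F.toForest where
  N := {v | ¬ F.Full i v}
  E := {a | ¬ F.Full i (F.src a)}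
  src_mem _ h := h
  tgt_mem a h h' := h (h'.of_conn (.symm _ _ (.rel _ _ ⟨a, trivial, rfl, rfl⟩)))

/-- The decorated forest `(•, i, k, 0, 0)` with a single node. -/
def DForest.dot {d : ℕ} (L : Type) (i : ℕ) (k : Fin d → ℕ) : DForest d L where
  N := Unit
  E := Empty
  src := Empty.elim
  tgt := Empty.elim
  typ := Empty.elim
  finN := inferInstance
  tgt_inj a := a.elim
  acyclic := ⟨fun _ => 0, fun a => a.elim⟩
  cN _ := i
  cE := Empty.elim
  col a := a.elim
  nn _ := k
  oo _ := 0
  ee := Empty.elim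
  oo_supp _ _ := rfl
  ee_supp a := a.elim

open Classical in
/-- `∑_ν 𝔫`, where `ν` is the union of the components that are entirely coloured with `i`. -/
noncomputable def DForest.fullSum {d : ℕ} {L : Type} (i : ℕ) (x : DForest d L) : Fin d → ℕ :=
  ∑ v : x.N, if x.Full i v then x.nn v else 0

/-- `𝒦_i(τ) = 𝒦(μ) · (•, i, ∑_ν 𝔫, 0, 0)` where `τ = μ · ν` and `ν` is the union of the
components of `τ` that are entirely coloured with `i`. -/
noncomputable def DForest.ki {d : ℕ} {L : Type} (i : ℕ) (x : DForest d L) : DForest d L :=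
  (x.restr (x.core i) x.nn).contract.mul (DForest.dot L i (x.fullSum i))

theorem CIso.conn {L : Type} {F G : CForest L} (φ : CIso F G) {v w : F.N}
    (h : (⊤ : Subforest F.toForest).Conn v w) :
    (⊤ : Subforest G.toForest).Conn (φ.eN v) (φ.eN w) := by
  induction h with
  | rel v w h =>
    obtain ⟨a, -, rfl, rfl⟩ := h
    exact .rel _ _ ⟨φ.eE a, trivial, φ.src a, φ.tgt a⟩
  | refl => exact .refl _
  | symm _ _ _ ih => exact .symm _ _ ih
  | trans _ _ _ _ _ ih ih' => exact .trans _ _ _ ih ih'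

theorem CIso.full_of {L : Type} {F G : CForest L} (φ : CIso F G) {i : ℕ} {v : F.N}
    (h : G.Full i (φ.eN v)) : F.Full i v := by
  refine ⟨fun w hw => ?_, fun a ha => ?_⟩
  · rw [← φ.cN]
    exact h.1 _ (φ.conn hw)
  · rw [← φ.cE]
    refine h.2 _ ?_
    rw [φ.src]
    exact φ.conn ha

theorem CIso.full_iff {L : Type} {F G : CForest L} (φ : CIso F G) {i : ℕ} {v : F.N} :
    G.Full i (φ.eN v) ↔ F.Full i v := by
  refine ⟨φ.full_of, fun h => φ.symm.full_of ?_⟩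
  have : φ.symm.eN (φ.eN v) = v := φ.eN.symm_apply_apply v
  rwa [this]

def DIso.core {d : ℕ} {L : Type} {x y : DForest d L} (φ : DIso x y) (i : ℕ) :
    DIso (x.restr (x.core i) x.nn) (y.restr (y.core i) y.nn) where
  eN := φ.eN.subtypeEquiv fun _ => not_congr φ.toCIso.full_iff.symm
  eE := φ.eE.subtypeEquiv fun a => not_congr (by rw [φ.src]; exact φ.toCIso.full_iff.symm)
  src a := Subtype.ext (φ.src a.1)
  tgt a := Subtype.ext (φ.tgt a.1)
  typ a := φ.typ a.1
  cN v := φ.cN v.1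
  cE a := φ.cE a.1
  nn v := φ.nn v.1
  oo v := φ.oo v.1
  ee a := φ.ee a.1

theorem CIso.step_iff {L : Type} {F G : CForest L} (φ : CIso F G) (v w : F.N) :
    F.Step v w ↔ G.Step (φ.eN v) (φ.eN w) := by
  constructor
  · rintro ⟨a, ha, rfl, rfl⟩
    exact ⟨φ.eE a, by rwa [φ.cE], φ.src a, φ.tgt a⟩
  · rintro ⟨b, hb, hs, ht⟩
    obtain ⟨a, rfl⟩ := φ.eE.surjective b
    rw [φ.cE] at hb
    rw [φ.src] at hs
    rw [φ.tgt] at ht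
    exact ⟨a, hb, φ.eN.injective hs, φ.eN.injective ht⟩

noncomputable def DIso.contract {d : ℕ} {L : Type} {x y : DForest d L} (φ : DIso x y) :
    DIso x.contract y.contract := by
  let q : x.KN ≃ y.KN := Quot.congr φ.eN φ.toCIso.step_iff
  have hq : ∀ (v : x.N) (X : x.KN),
      Quot.mk y.Step (φ.eN v) = q X ↔ Quot.mk x.Step v = X := fun v X =>
    ⟨fun h => q.injective h, fun h => congrArg q h⟩
  exact
    { eN := q
      eE := φ.eE.subtypeEquiv fun a => by rw [φ.cE]
      src := fun a => congrArg (Quot.mk y.Step) (φ.src a.1)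
      tgt := fun a => congrArg (Quot.mk y.Step) (φ.tgt a.1)
      typ := fun a => φ.typ a.1
      cN := by
        rintro ⟨v⟩
        exact φ.cN v
      cE := fun _ => rfl
      nn := fun X => by
        classical
        change (∑ v : y.N, if Quot.mk y.Step v = q X then y.nn v else 0) =
          ∑ v : x.N, if Quot.mk x.Step v = X then x.nn v else 0
        rw [← Equiv.sum_comp φ.eN]
        simp only [show ∀ v : x.N, _ from fun v => hq v X, φ.nn]
      oo := fun X => by
        classical
        change ((∑ v : y.N, if Quot.mk y.Step v = q X then y.oo v else 0) +
            ∑ a : y.E, if Quot.mk y.Step (y.src a) = q X ∧ Quot.mk y.Step (y.tgt a) = q X then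
              ((0, Finsupp.single (y.typ a) 1) : (Fin d → ℤ) × (L →₀ ℤ)) else 0) =
          (∑ v : x.N, if Quot.mk x.Step v = X then x.oo v else 0) +
            ∑ a : x.E, if Quot.mk x.Step (x.src a) = X ∧ Quot.mk x.Step (x.tgt a) = X then
              ((0, Finsupp.single (x.typ a) 1) : (Fin d → ℤ) × (L →₀ ℤ)) else 0
        rw [← Equiv.sum_comp φ.eN, ← Equiv.sum_comp φ.eE]
        simp only [show ∀ v : x.N, _ from fun v => hq v X, φ.oo, φ.src, φ.tgt, φ.typ]
      ee := fun a => φ.ee a.1 }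

theorem DIso.fullSum_eq {d : ℕ} {L : Type} {x y : DForest d L} (φ : DIso x y) (i : ℕ) :
    x.fullSum i = y.fullSum i := by
  classical
  change (∑ v : x.N, if x.Full i v then x.nn v else 0) =
    ∑ v : y.N, if y.Full i v then y.nn v else 0
  rw [← Equiv.sum_comp φ.eN]
  simp only [φ.toCIso.full_iff, φ.nn]

/-- The operator `𝒦_i` on decorated forests. -/
noncomputable def DecForest.ki {d : ℕ} {L : Type} (i : ℕ) : DecForest d L → DecForest d L :=
  Quotient.map (DForest.ki i) fun _ _ ⟨φ⟩ =>
    ⟨(φ.core i).contract.mul (φ.fullSum_eq i ▸ DIso.refl _)⟩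

/-! ## Families of admissible subforests -/

/-- A family `𝔄_i`, `i > 0`, of admissible subforests: for every coloured forest a collection of subforests
satisfying the compatibility conditions `Compat`, invariant under isomorphisms. -/
structure SubforestFamily (L : Type) (i : ℕ) where
  pos : 0 < i
  adm : (F : CForest L) → Set (Subforest F.toForest)
  compat : ∀ F, ∀ A ∈ adm F, Compat i F A
  iso : ∀ (F G : CForest L) (φ : CIso F G), ∀ A ∈ adm F, A.map φ ∈ adm G

/-- `F̂ ≤ i`. -/
def CForest.ColLE {L : Type} (F : CForest L) (i : ℕ) : Prop :=
  (∀ v, F.cN v ≤ i) ∧ ∀ a, F.cE a ≤ i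

namespace SubforestFamily

variable {L : Type} {i : ℕ} (𝔄 : SubforestFamily L i)

/-- Compatibility of `𝔄_i` with disjoint unions, and the exchange property: `A ∈ 𝔄_i(F, F̂)` and
`B ∈ 𝔄_i(F, F̂ ∪_i A)` if and only if `B ∈ 𝔄_i(F, F̂)` and `A ∈ 𝔄_i(B, F̂ ↾ B)`. -/
structure MulCoassoc : Prop where
  sum : ∀ F G : CForest L,
    𝔄.adm (F.mul G) = {B | ∃ C ∈ 𝔄.adm F, ∃ D ∈ 𝔄.adm G, B = Subforest.sum C D}
  exchange : ∀ (F : CForest L) (A B : Subforest F.toForest),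
    (∃ h : A ∈ 𝔄.adm F, B ∈ 𝔄.adm (F.cup i A (𝔄.compat F A h))) ↔
      (B ∈ 𝔄.adm F ∧ A ≤ B ∧ A.within B ∈ 𝔄.adm (F.restr B))

/-- For all `(F, F̂)` with `F̂_i ∈ 𝔄_i(F, F̂)` and all `A ∈ 𝔄_i(F, F̂)`:
`{A, F̂_i} ⊆ 𝔄_i(A, F̂ ↾ A)` and, if `F̂ ≤ i`, `{F, A} ⊆ 𝔄_i(F, F̂ ∪_i A)`. -/
structure Counital : Prop where
  restr : ∀ F : CForest L, F.hat i ∈ 𝔄.adm F → ∀ A ∈ 𝔄.adm F,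
    ⊤ ∈ 𝔄.adm (F.restr A) ∧ (F.hat i).within A ∈ 𝔄.adm (F.restr A)
  cup : ∀ F : CForest L, F.hat i ∈ 𝔄.adm F → F.ColLE i → ∀ (A) (h : A ∈ 𝔄.adm F),
    ⊤ ∈ 𝔄.adm (F.cup i A (𝔄.compat F A h)) ∧ A ∈ 𝔄.adm (F.cup i A (𝔄.compat F A h))

/-- `𝒦^♯` is a bijection between `𝔄_i(𝒦(F, F̂))` and `𝔄_i(F, F̂)`. -/
def ContractionInvariant : Prop :=
  ∀ F : CForest L, Set.BijOn F.sharp (𝔄.adm F.contract) (𝔄.adm F)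

/-- `(F, F̂) ∈ ℭ_i`: `F̂ ≤ i` and `{F, F̂_i} ⊆ 𝔄_i(F, F̂)`. A decorated forest belongs to `𝔉_i` iff
the underlying coloured forest belongs to `ℭ_i`. -/
def Good (F : CForest L) : Prop :=
  F.ColLE i ∧ ⊤ ∈ 𝔄.adm F ∧ F.hat i ∈ 𝔄.adm F

/-- The set `𝔉_i` of decorated forests. -/
def goodSet (d : ℕ) : Set (DecForest d L) := {τ | ∃ x, ⟦x⟧ = τ ∧ 𝔄.Good x.toCForest}

end SubforestFamily

/-! ## The terms of the coproduct -/

/-- An index `(A, 𝔫_A, ε_A^F)` of the sum defining `Δ_i x`: `A ∈ 𝔄_i(F, F̂)`, `𝔫_A ≤ 𝔫` is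
supported in `N_A` and `ε_A^F` is supported in the boundary
`∂(A, F) = {a ∈ E_F ∖ E_A : src a ∈ N_A}`. -/
structure Cut {d : ℕ} {L : Type} {i : ℕ} (𝔄 : SubforestFamily L i) (x : DForest d L) where
  A : Subforest x.toForest
  mem : A ∈ 𝔄.adm x.toCForest
  nA : x.N → Fin d → ℕ
  eps : x.E → Fin d → ℕ
  nA_supp : ∀ v, v ∉ A.N → nA v = 0
  nA_le : nA ≤ x.nn
  eps_supp : ∀ a, ¬ (a ∉ A.E ∧ x.src a ∈ A.N) → eps a = 0

namespace Cut

variable {d : ℕ} {L : Type} {i : ℕ} {𝔄 : SubforestFamily L i} {x : DForest d L}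

open scoped Nat in
/-- The coefficient `(1 / ε_A^F!) * binom(𝔫, 𝔫_A)`. -/
noncomputable def coef (p : Cut 𝔄 x) : ℝ :=
  (∏ a, ∏ j, (1 / ((p.eps a j)! : ℝ))) * ∏ v, ∏ j, ((x.nn v j).choose (p.nA v j) : ℝ)

open Classical in
/-- `(A, F̂ ↾ A, 𝔫_A + π ε_A^F, 𝔬, 𝔢)`. -/
noncomputable def left (p : Cut 𝔄 x) : DForest d L :=
  x.restr p.A fun v => p.nA v + ∑ a, if x.src a = v then p.eps a else 0

open Classical in
/-- `(F, F̂ ∪_i A, 𝔫 - 𝔫_A, 𝔬 + 𝔫_A + π (ε_A^F - 𝔢_∅^A), 𝔢_A^F + ε_A^F)`. -/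
noncomputable def right (p : Cut 𝔄 x) : DForest d L where
  toCForest := x.cup i p.A (𝔄.compat _ _ p.mem)
  nn v := x.nn v - p.nA v
  oo v := x.oo v + (fun j => (p.nA v j : ℤ) + ∑ a, if x.src a = v then
    (p.eps a j : ℤ) - (if a ∈ p.A.E then (x.ee a j : ℤ) else 0) else 0, 0)
  ee a := (if a ∈ p.A.E then 0 else x.ee a) + p.eps a
  oo_supp v hv := by
    change (if v ∈ p.A.N then i else x.cN v) = 0 at hv
    by_cases hvA : v ∈ p.A.N
    · rw [if_pos hvA] at hv
      exact absurd hv 𝔄.pos.ne'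
    · rw [if_neg hvA] at hv
      have h1 : ∀ a, x.src a = v → a ∉ p.A.E := by
        rintro a rfl ha
        exact hvA (p.A.src_mem a ha)
      have h2 : ∀ a, x.src a = v → p.eps a = 0 := by
        rintro a rfl
        exact p.eps_supp a fun h => hvA h.2
      rw [x.oo_supp v hv, p.nA_supp v hvA, zero_add]
      refine Prod.ext (funext fun j => ?_) rfl
      change ((0 : ℕ) : ℤ) + _ = 0
      rw [Finset.sum_eq_zero, Nat.cast_zero, add_zero]
      intro a _
      split_ifs with hs ha
      · exact absurd ha (h1 a hs)
      · simp [h2 a hs]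
      · rfl
  ee_supp a ha := by
    change (if a ∈ p.A.E then i else x.cE a) ≠ 0 at ha
    by_cases haA : a ∈ p.A.E
    · rw [if_pos haA, p.eps_supp a fun h => h.1 haA, add_zero]
    · rw [if_neg haA] at ha ⊢
      rw [x.ee_supp a ha, p.eps_supp a fun h =>
        ((𝔄.compat _ _ p.mem).notMem haA ha).1 h.2, add_zero]

/-- The index `A = F`, `𝔫_A = 𝔫` (hence `ε_A^F = 0`). -/
def IsTop (p : Cut 𝔄 x) : Prop := p.A = ⊤ ∧ p.nA = x.nn

end Cut
namespace DForest

variable {d : ℕ} {L : Type}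

/-- `|τ|_i = |F ∖ F̂_i|`, the number of nodes and edges whose colour is not `i`. -/
noncomputable def size (i : ℕ) (x : DForest d L) : ℕ :=
  Nat.card {v // x.cN v ≠ i} + Nat.card {a // x.cE a ≠ i}

/-- `|𝔫|`. -/
noncomputable def nSum (x : DForest d L) : ℕ := ∑ v, ∑ j, x.nn v j

/-- `x = (F, i, 0, 𝔬, 0)`. For `x ∈ 𝔉_i` this says `x ∈ 𝔘_i`. -/
def IsUnit (i : ℕ) (x : DForest d L) : Prop :=
  (∀ v, x.cN v = i ∧ x.nn v = 0) ∧ ∀ a, x.cE a = i ∧ x.ee a = 0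

end DForest

/-! ## Bigraded spaces and triangular maps -/

/-- A bigraded space, presented as a family of real vector spaces `V a` placed in bidegrees
`deg a ∈ ℕ²`, with finitely many `a` in each bidegree; the component of bidegree `n` is
`⨁_{deg a = n} V a`. (The case `ι = ℕ²`, `deg = id` is a collection `V n`, `n ∈ ℕ²`; more general
`ι` allow one to write tensor products without regrouping by total degree.) -/
structure BiSpace where
  ι : Type
  deg : ι → ℕ × ℕ
  fin : ∀ n, (deg ⁻¹' {n}).Finite
  V : ι → Type*
  [acg : ∀ a, AddCommGroup (V a)]
  [mod : ∀ a, Module ℝ (V a)]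

attribute [instance] BiSpace.acg BiSpace.mod

namespace BiSpace

universe u v w u' v'

/-- The space of formal sums `∑_a v_a`, `v_a ∈ V a`, with `v_a = 0` once the second
component of the degree of `a` exceeds some `k`. -/
def Tot (V : BiSpace.{u}) : Submodule ℝ (∀ a, V.V a) where
  carrier := {v | ∃ k, ∀ a, k < (V.deg a).2 → v a = 0}
  zero_mem' := ⟨0, fun _ _ => rfl⟩
  add_mem' := by
    rintro v w ⟨k, hk⟩ ⟨l, hl⟩
    refine ⟨max k l, fun a ha => ?_⟩
    rw [Pi.add_apply, hk a (by omega), hl a (by omega), add_zero]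
  smul_mem' := by
    rintro c v ⟨k, hk⟩
    exact ⟨k, fun a ha => by rw [Pi.smul_apply, hk a ha, smul_zero]⟩

/-- The partial order `m ≥ n` on bidegrees: `m₁ ≥ n₁` and `m₂ ≤ n₂`. -/
def DegGE (m n : ℕ × ℕ) : Prop := n.1 ≤ m.1 ∧ m.2 ≤ n.2

/-- Triangular families of linear maps. -/
@[ext] structure Tri (V : BiSpace.{u}) (W : BiSpace.{v}) where
  mat : ∀ b a, V.V a →ₗ[ℝ] W.V b
  tri : ∀ b a, ¬ DegGE (W.deg b) (V.deg a) → mat b a = 0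

theorem Tri.finite_support {V : BiSpace.{u}} {W : BiSpace.{v}} (f : Tri V W) (v : Tot V)
    (b : W.ι) : (Function.support fun a => f.mat b a (v.1 a)).Finite := by
  obtain ⟨k, hk⟩ := v.2
  refine (Set.Finite.preimage' (f := V.deg) ((Set.finite_Iic (W.deg b).1).prod (Set.finite_Iic k))
    fun n _ => V.fin n).subset fun a ha => ?_
  rw [Function.mem_support] at ha
  refine ⟨?_, ?_⟩
  · by_contra h
    rw [f.tri b a fun hg => h hg.1] at ha
    exact ha rfl
  · by_contra h
    exact ha (by rw [hk a (not_le.1 h), map_zero])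

/-- The triangular map `∑_a v_a ↦ ∑_b (∑_a f_{ba} v_a)` defined by a triangular family. -/
noncomputable def Tri.toLin {V : BiSpace.{u}} {W : BiSpace.{v}} (f : Tri V W) :
    Tot V →ₗ[ℝ] Tot W where
  toFun v := ⟨fun b => ∑ᶠ a, f.mat b a (v.1 a), by
    obtain ⟨k, hk⟩ := v.2
    refine ⟨k, fun b hb => finsum_eq_zero_of_forall_eq_zero fun a => ?_⟩
    by_cases h : k < (V.deg a).2
    · rw [hk a h, map_zero]
    · rw [f.tri b a fun hg => h (hb.trans_le hg.2)]
      rfl⟩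
  map_add' v w := by
    refine Subtype.ext (funext fun b => ?_)
    change ∑ᶠ a, f.mat b a (v.1 a + w.1 a) = _ + _
    simp only [map_add]
    exact finsum_add_distrib (f.finite_support v b) (f.finite_support w b)
  map_smul' c v := by
    refine Subtype.ext (funext fun b => ?_)
    change ∑ᶠ a, f.mat b a (c • v.1 a) = c • _
    simp only [map_smul]
    exact (smul_finsum' c (f.finite_support v b)).symm

open Classical in
/-- The identity as a triangular family. -/
noncomputable def Tri.id (V : BiSpace.{u}) : Tri V V where
  mat b a := LinearMap.proj b ∘ₗ LinearMap.single ℝ V.V a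
  tri b a h := by
    have hab : b ≠ a := by
      rintro rfl
      exact h ⟨le_rfl, le_rfl⟩
    ext x
    exact Pi.single_eq_of_ne hab x

/-- The tensor product `V ⊗̂ W`. -/
noncomputable abbrev tens (V : BiSpace.{u}) (W : BiSpace.{v}) : BiSpace.{max u v} where
  ι := V.ι × W.ι
  deg p := V.deg p.1 + W.deg p.2
  fin n := by
    have h : ((Prod.map V.deg W.deg) ⁻¹' ((Set.Iic n) ×ˢ (Set.Iic n))).Finite := by
      refine Set.Finite.preimage' ((Set.finite_Iic n).prod (Set.finite_Iic n)) ?_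
      rintro ⟨a, b⟩ -
      refine ((V.fin a).prod (W.fin b)).subset ?_
      rintro ⟨c, e⟩ h
      simpa using h
    refine h.subset ?_
    rintro ⟨a, b⟩ rfl
    exact ⟨Set.mem_Iic.2 le_self_add, Set.mem_Iic.2 le_add_self⟩
  V p := V.V p.1 ⊗[ℝ] W.V p.2

/-- The unit object: `ℝ` in bidegree `0`. -/
abbrev one : BiSpace.{0} where
  ι := Unit
  deg _ := 0
  fin _ := Set.toFinite _
  V _ := ℝ

/-- The element `1` of the unit object. -/
def oneElt : Tot one := ⟨fun _ => (1 : ℝ), 0, fun _ h => absurd h (Nat.lt_irrefl 0)⟩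

/-- The tensor product of triangular families. -/
noncomputable def Tri.tens {V : BiSpace.{u}} {W : BiSpace.{v}} {V' : BiSpace.{u'}}
    {W' : BiSpace.{v'}} (f : Tri V W) (g : Tri V' W') :
    Tri (V.tens V') (W.tens W') where
  mat b a := TensorProduct.map (f.mat b.1 a.1) (g.mat b.2 a.2)
  tri b a h := by
    by_cases h1 : DegGE (W.deg b.1) (V.deg a.1)
    · have h2 : ¬ DegGE (W'.deg b.2) (V'.deg a.2) := fun h2 =>
        h ⟨add_le_add h1.1 h2.1, add_le_add h1.2 h2.2⟩
      rw [g.tri _ _ h2]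
      exact TensorProduct.map_zero_right _
    · rw [f.tri _ _ h1]
      exact TensorProduct.map_zero_left _

/-- The canonical map from the algebraic tensor product, on pure tensors. -/
noncomputable def tmul {V : BiSpace.{u}} {W : BiSpace.{v}} (x : Tot V) (y : Tot W) :
    Tot (V.tens W) :=
  ⟨fun p => x.1 p.1 ⊗ₜ[ℝ] y.1 p.2, by
    obtain ⟨k, hk⟩ := x.2
    obtain ⟨l, hl⟩ := y.2
    refine ⟨k + l, fun p hp => ?_⟩
    change k + l < (V.deg p.1).2 + (W.deg p.2).2 at hp
    change x.1 p.1 ⊗ₜ[ℝ] y.1 p.2 = 0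
    by_cases h : k < (V.deg p.1).2
    · rw [hk _ h, TensorProduct.zero_tmul]
    · rw [hl p.2 (by omega), TensorProduct.tmul_zero]⟩

/-- The canonical map `(V ⊗̂ W) ⊗̂ U → V ⊗̂ (W ⊗̂ U)`. -/
noncomputable def assoc (V : BiSpace.{u}) (W : BiSpace.{v}) (U : BiSpace.{w}) :
    Tot ((V.tens W).tens U) →ₗ[ℝ] Tot (V.tens (W.tens U)) where
  toFun x := ⟨fun p => TensorProduct.assoc ℝ (V.V p.1) (W.V p.2.1) (U.V p.2.2)
      (x.1 ((p.1, p.2.1), p.2.2)), by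
    obtain ⟨k, hk⟩ := x.2
    refine ⟨k, fun p hp => (congrArg _ (hk _ ?_)).trans (map_zero _)⟩
    change k < (V.deg p.1).2 + ((W.deg p.2.1).2 + (U.deg p.2.2).2) at hp
    change k < (V.deg p.1).2 + (W.deg p.2.1).2 + (U.deg p.2.2).2
    omega⟩
  map_add' x y := Subtype.ext (funext fun p => map_add (TensorProduct.assoc ℝ _ _ _) _ _)
  map_smul' c x := Subtype.ext (funext fun p => map_smul (TensorProduct.assoc ℝ _ _ _) _ _)

/-- The canonical map `ℝ ⊗̂ V → V`. -/
noncomputable def lunit (V : BiSpace.{u}) : Tot (one.tens V) →ₗ[ℝ] Tot V where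
  toFun x := ⟨fun a => TensorProduct.lid ℝ (V.V a) (x.1 ((), a)), by
    obtain ⟨k, hk⟩ := x.2
    refine ⟨k, fun a ha => (congrArg _ (hk _ ?_)).trans (map_zero _)⟩
    change k < 0 + (V.deg a).2
    omega⟩
  map_add' x y := Subtype.ext (funext fun p => map_add (TensorProduct.lid ℝ _) _ _)
  map_smul' c x := Subtype.ext (funext fun p => map_smul (TensorProduct.lid ℝ (V.V p)) c (x.1 ((), p)))

/-- The canonical map `V ⊗̂ ℝ → V`. -/
noncomputable def runit (V : BiSpace.{u}) : Tot (V.tens one) →ₗ[ℝ] Tot V where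
  toFun x := ⟨fun a => TensorProduct.rid ℝ (V.V a) (x.1 (a, ())), by
    obtain ⟨k, hk⟩ := x.2
    refine ⟨k, fun a ha => (congrArg _ (hk _ ?_)).trans (map_zero _)⟩
    change k < (V.deg a).2 + 0
    omega⟩
  map_add' x y := Subtype.ext (funext fun p => map_add (TensorProduct.rid ℝ _) _ _)
  map_smul' c x := Subtype.ext (funext fun p => map_smul (TensorProduct.rid ℝ (V.V p)) c (x.1 (p, ())))

/-- The exchange of the two middle factors of `(V ⊗̂ V) ⊗̂ (V ⊗̂ V)`. -/
noncomputable def mid (V : BiSpace.{u}) :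
    Tot ((V.tens V).tens (V.tens V)) →ₗ[ℝ] Tot ((V.tens V).tens (V.tens V)) where
  toFun x := ⟨fun p => TensorProduct.tensorTensorTensorComm ℝ (V.V p.1.1) (V.V p.2.1)
      (V.V p.1.2) (V.V p.2.2) (x.1 ((p.1.1, p.2.1), (p.1.2, p.2.2))), by
    obtain ⟨k, hk⟩ := x.2
    refine ⟨k, fun p hp => (congrArg _ (hk _ ?_)).trans (map_zero _)⟩
    change k < (V.deg p.1.1).2 + (V.deg p.1.2).2 + ((V.deg p.2.1).2 + (V.deg p.2.2).2) at hp
    change k < (V.deg p.1.1).2 + (V.deg p.2.1).2 + ((V.deg p.1.2).2 + (V.deg p.2.2).2)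
    omega⟩
  map_add' x y := Subtype.ext (funext fun p =>
    map_add (TensorProduct.tensorTensorTensorComm ℝ _ _ _ _) _ _)
  map_smul' c x := Subtype.ext (funext fun p =>
    map_smul (TensorProduct.tensorTensorTensorComm ℝ _ _ _ _) _ _)

/-- The quotient of a bigraded space by a family of subspaces of its components. -/
abbrev quot (V : BiSpace.{u}) (P : ∀ a, Submodule ℝ (V.V a)) : BiSpace.{u} where
  ι := V.ι
  deg := V.deg
  fin := V.fin
  V a := V.V a ⧸ P a

/-- The quotient map. -/
def mkQ (V : BiSpace.{u}) (P : ∀ a, Submodule ℝ (V.V a)) : Tot V →ₗ[ℝ] Tot (V.quot P) where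
  toFun x := ⟨fun a => (P a).mkQ (x.1 a), by
    obtain ⟨k, hk⟩ := x.2
    exact ⟨k, fun a ha => (congrArg _ (hk a ha)).trans (map_zero _)⟩⟩
  map_add' x y := Subtype.ext (funext fun a => map_add (P a).mkQ _ _)
  map_smul' c x := Subtype.ext (funext fun a => map_smul (P a).mkQ _ _)

/-- The quotient `V.quot P` is the quotient of the space of formal sums by the subspace of those
all of whose components lie in `P`: the quotient map is onto and has this kernel. -/
theorem mkQ_surjective_and_ker (V : BiSpace.{u}) (P : ∀ a, Submodule ℝ (V.V a)) :
    Function.Surjective (mkQ V P) ∧ ∀ x, mkQ V P x = 0 ↔ ∀ a, x.1 a ∈ P a := by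
  refine ⟨fun y => ?_, fun x => ?_⟩
  · obtain ⟨k, hk⟩ := y.2
    choose f hf using fun a => (P a).mkQ_surjective (y.1 a)
    classical
    refine ⟨⟨fun a => if k < (V.deg a).2 then 0 else f a, k, fun a ha => if_pos ha⟩, ?_⟩
    refine Subtype.ext (funext fun a => ?_)
    change (P a).mkQ (if k < (V.deg a).2 then 0 else f a) = y.1 a
    split_ifs with h
    · rw [map_zero]
      exact (hk a h).symm
    · exact hf a
  · rw [Subtype.ext_iff, funext_iff]
    exact forall_congr' fun a => Submodule.Quotient.mk_eq_zero (P a)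

end BiSpace

/-! ## Hopf algebras in the category of bigraded spaces -/

/-- Structure maps of a Hopf algebra in the category of bigraded spaces and triangular maps. -/
structure HopfData (H : BiSpace) where
  mul : BiSpace.Tri (H.tens H) H
  unit : BiSpace.Tri BiSpace.one H
  comul : BiSpace.Tri H (H.tens H)
  counit : BiSpace.Tri H BiSpace.one
  antipode : BiSpace.Tri H H

open BiSpace in
/-- The axioms of a Hopf algebra: unital associative algebra, counital coassociative coalgebra,
coproduct and counit are algebra morphisms, antipode. -/
structure HopfData.IsHopf {H : BiSpace} (h : HopfData H) : Prop where
  mul_assoc : h.mul.toLin ∘ₗ (Tri.tens h.mul (Tri.id H)).toLin =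
    h.mul.toLin ∘ₗ (Tri.tens (Tri.id H) h.mul).toLin ∘ₗ assoc H H H
  one_mul : h.mul.toLin ∘ₗ (Tri.tens h.unit (Tri.id H)).toLin = lunit H
  mul_one : h.mul.toLin ∘ₗ (Tri.tens (Tri.id H) h.unit).toLin = runit H
  coassoc : assoc H H H ∘ₗ (Tri.tens h.comul (Tri.id H)).toLin ∘ₗ h.comul.toLin =
    (Tri.tens (Tri.id H) h.comul).toLin ∘ₗ h.comul.toLin
  counit_left : lunit H ∘ₗ (Tri.tens h.counit (Tri.id H)).toLin ∘ₗ h.comul.toLin = LinearMap.id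
  counit_right : runit H ∘ₗ (Tri.tens (Tri.id H) h.counit).toLin ∘ₗ h.comul.toLin = LinearMap.id
  comul_mul : h.comul.toLin ∘ₗ h.mul.toLin =
    (Tri.tens h.mul h.mul).toLin ∘ₗ mid H ∘ₗ (Tri.tens h.comul h.comul).toLin
  comul_one : h.comul.toLin (h.unit.toLin oneElt) =
    tmul (h.unit.toLin oneElt) (h.unit.toLin oneElt)
  counit_mul : h.counit.toLin ∘ₗ h.mul.toLin = lunit one ∘ₗ (Tri.tens h.counit h.counit).toLin
  counit_one : h.counit.toLin (h.unit.toLin oneElt) = oneElt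
  antipode_left : h.mul.toLin ∘ₗ (Tri.tens h.antipode (Tri.id H)).toLin ∘ₗ h.comul.toLin =
    h.unit.toLin ∘ₗ h.counit.toLin
  antipode_right : h.mul.toLin ∘ₗ (Tri.tens (Tri.id H) h.antipode).toLin ∘ₗ h.comul.toLin =
    h.unit.toLin ∘ₗ h.counit.toLin

/-! ## The space `𝓗_i` -/

/-- The bigraded space `⟨S⟩` built on a set `S` of decorated forests: the component of bidegree
`n` is the free vector space on the elements of `S` of bidegree `n`. -/
noncomputable abbrev spn {d : ℕ} {L : Type} (S : Set (DecForest d L)) : BiSpace.{1} where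
  ι := ℕ × ℕ
  deg n := n
  fin n := Set.finite_singleton n
  V n := {τ : DecForest d L // τ ∈ S ∧ τ.deg = n} →₀ ℝ

open Classical in
/-- The basis element of `⟨S⟩` given by `τ` (zero if `τ ∉ S`). -/
noncomputable def spnBasis {d : ℕ} {L : Type} (S : Set (DecForest d L)) (τ : DecForest d L) :
    BiSpace.Tot (spn S) :=
  ⟨fun n => if h : τ ∈ S ∧ τ.deg = n then Finsupp.single ⟨τ, h⟩ (1 : ℝ) else 0, τ.deg.2,
    fun n hn => dif_neg (by
      rintro ⟨-, rfl⟩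
      exact lt_irrefl _ hn)⟩

/-- The restriction of `𝒦_i` to the component of bidegree `n` of `⟨S⟩`. -/
noncomputable def kiLin {d : ℕ} {L : Type} (i : ℕ) (S : Set (DecForest d L)) (n : ℕ × ℕ) :
    (spn S).V n →ₗ[ℝ] (DecForest d L →₀ ℝ) :=
  Finsupp.lmapDomain ℝ ℝ fun τ : {τ : DecForest d L // τ ∈ S ∧ τ.deg = n} => DecForest.ki i τ.1

namespace SubforestFamily

variable {L : Type} {i : ℕ} (𝔄 : SubforestFamily L i) (d : ℕ)

/-- `𝓗_i = ⟨𝔉_i⟩ / ker 𝒦_i`. As `𝒦_i` preserves the bigrading, its extension to formal sums acts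
componentwise and the quotient is bigraded with components `⟨𝔉_i⟩_n / ker (𝒦_i ↾ ⟨𝔉_i⟩_n)`; its space
of formal sums is the quotient of that of `⟨𝔉_i⟩` (`BiSpace.mkQ_surjective_and_ker`). -/
noncomputable abbrev hopfSpace : BiSpace.{1} :=
  (spn (𝔄.goodSet d)).quot fun n => LinearMap.ker (kiLin i (𝔄.goodSet d) n)

variable {d}

/-- The class in `𝓗_i` of a decorated forest in `𝔉_i`. -/
noncomputable def cls (x : DForest d L) : BiSpace.Tot (𝔄.hopfSpace d) :=
  BiSpace.mkQ _ _ (spnBasis (𝔄.goodSet d) ⟦x⟧)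

end SubforestFamily

end HopfForest

open HopfForest HopfForest.BiSpace

/-! ## Formal sums and triangular maps -/

namespace HopfForest
namespace BiSpace

universe u v w u' v'

variable {V : BiSpace.{u}} {W : BiSpace.{v}} {U : BiSpace.{w}} {V' : BiSpace.{u'}}
  {W' : BiSpace.{v'}}

/-! Everything is computed on representatives. One component of the value of a triangular map
depends on only finitely many components of the argument. Hence triangular maps commute with locally
finite sums (`IsTri.hasFSum`) and are determined by their values on the classes `cls x` of good
forests and on tensors of these (`IsTri.ext`, `gen_cls`). Each Hopf axiom thus becomes an identity
between sums over cuts.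

Well-definedness. Equality under `𝒦_i` is the relation `Eqv`: isomorphic contracted cores and equal
total decoration of the full part. A forest is the product of its full part and its core, and the
coproduct is multiplicative because cuts of a disjoint union are pairs of cuts (`comulVec_mul`).
Under a contraction that matches admissible subforests, cuts are pushed forward; the image
determines `A` and `ε`, while `𝔫_A` varies with prescribed sums over the contracted classes.
Vandermonde's identity (`finsum_choose_fiber`) shows that the coefficients add up. The same identity
for the map to a point settles the full part.

Coassociativity. By the exchange property both iterated coproducts are sums over flags `A ⊆ B`; in
one the decorations of `A` are chosen first, in the other those of `B`. `flagMap` passes from the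
first description to the second and preserves the three tensor factors. Its fibres record how the
decorations `𝔫` and `ε` of `B` are shared out to `A`, so once more Vandermonde's identity, now for
the map from nodes and edges to nodes (identity and source), matches the coefficients.

Counit. A left factor is a unit only for `A = F̂_i` with zero decorations, a right factor only for
`A = F`, `𝔫_A = 𝔫`; so a single term survives on each side.

Antipode. In `m (S ⊗ 1) Δ τ` the term with `A = F`, `𝔫_A = 𝔫` is `S τ` itself, and all other terms
involve smaller left factors. So `f ↦ m (f ⊗ 1) Δ` is unitriangular (`mulLeft_sub`), which yields a
left antipode by recursion and injectivity by induction (`eq_of_mulLeft_eq`). Since `|·|_i` depends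
on the representative, the recursion uses its minimum over the class. The right antipode axiom
follows from associativity, coassociativity and injectivity; injectivity on forests of colour `i`
also gives the explicit sign, and the recursion is the left axiom with the leading term isolated. -/

theorem DegGE.refl (n : ℕ × ℕ) : DegGE n n := ⟨le_rfl, le_rfl⟩

theorem DegGE.trans {l m n : ℕ × ℕ} (h : DegGE l m) (h' : DegGE m n) : DegGE l n :=
  ⟨h'.1.trans h.1, h.2.trans h'.2⟩

theorem DegGE.add {m n m' n' : ℕ × ℕ} (h : DegGE m n) (h' : DegGE m' n') :
    DegGE (m + m') (n + n') :=
  ⟨add_le_add h.1 h'.1, add_le_add h.2 h'.2⟩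

/-- The formal sum `v` lives in bidegrees `≥ n`. -/
def SuppGE (n : ℕ × ℕ) (v : Tot V) : Prop := ∀ a, ¬ DegGE (V.deg a) n → v.1 a = 0

/-- Membership in `Tot` bounds only the second degree, so the first entry of the bound is the
vacuous `0`. -/
theorem exists_suppGE (v : Tot V) : ∃ k, SuppGE (0, k) v := by
  obtain ⟨k, hk⟩ := v.2
  exact ⟨k, fun a ha => hk a (not_le.1 fun h => ha ⟨Nat.zero_le _, h⟩)⟩

theorem SuppGE.mono {m n : ℕ × ℕ} (h : DegGE m n) {v : Tot V} (hv : SuppGE m v) : SuppGE n v :=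
  fun a ha => hv a fun h' => ha (h'.trans h)

theorem SuppGE.zero (n : ℕ × ℕ) : SuppGE n (0 : Tot V) := fun _ _ => rfl

theorem SuppGE.add {n : ℕ × ℕ} {v w : Tot V} (hv : SuppGE n v) (hw : SuppGE n w) :
    SuppGE n (v + w) := fun a ha => by
  change v.1 a + w.1 a = 0
  rw [hv a ha, hw a ha, add_zero]

theorem SuppGE.smul {n : ℕ × ℕ} {v : Tot V} (c : ℝ) (hv : SuppGE n v) :
    SuppGE n (c • v) := fun a ha => by
  change c • v.1 a = 0
  rw [hv a ha, smul_zero]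

theorem SuppGE.neg {n : ℕ × ℕ} {v : Tot V} (hv : SuppGE n v) : SuppGE n (-v) := fun a ha => by
  change -v.1 a = 0
  rw [hv a ha, neg_zero]

theorem SuppGE.sub {n : ℕ × ℕ} {v w : Tot V} (hv : SuppGE n v) (hw : SuppGE n w) :
    SuppGE n (v - w) := by
  rw [sub_eq_add_neg]
  exact hv.add hw.neg

theorem SuppGE.sum {n : ℕ × ℕ} {P : Type*} (s : Finset P) {t : P → Tot V}
    (h : ∀ p ∈ s, SuppGE n (t p)) : SuppGE n (∑ p ∈ s, t p) :=
  Finset.sum_induction t (SuppGE n) (fun _ _ => SuppGE.add) (SuppGE.zero n) h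

theorem SuppGE.tmul {m n : ℕ × ℕ} {v : Tot V} {w : Tot W} (hv : SuppGE m v) (hw : SuppGE n w) :
    SuppGE (m + n) (tmul v w) := fun p hp => by
  change v.1 p.1 ⊗ₜ[ℝ] w.1 p.2 = 0
  by_cases h : DegGE (V.deg p.1) m
  · rw [hw p.2 fun h' => hp (h.add h'), TensorProduct.tmul_zero]
  · rw [hv p.1 h, TensorProduct.zero_tmul]

/-! ### Triangular maps as linear maps of formal sums -/

/-- A linear map of formal sums that does not lower the bidegree, i.e. a triangular map. -/
def IsTri (T : Tot V →ₗ[ℝ] Tot W) : Prop := ∀ n v, SuppGE n v → SuppGE n (T v)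

theorem IsTri.id : IsTri (LinearMap.id : Tot V →ₗ[ℝ] Tot V) := fun _ _ h => h

theorem IsTri.comp {T : Tot W →ₗ[ℝ] Tot U} {S : Tot V →ₗ[ℝ] Tot W} (hT : IsTri T)
    (hS : IsTri S) : IsTri (T ∘ₗ S) := fun n v h => hT n _ (hS n v h)

theorem IsTri.sub {T S : Tot V →ₗ[ℝ] Tot W} (hT : IsTri T) (hS : IsTri S) : IsTri (T - S) :=
  fun n v h => (hT n v h).sub (hS n v h)

/-- `IsTri` is a property of linear maps, stable under composition; composites with `assoc`,
`lunit`, `runit` and `mid` can therefore be treated without writing down their matrices. -/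
theorem Tri.isTri (f : Tri V W) : IsTri f.toLin := fun n v h b hb => by
  change ∑ᶠ a, f.mat b a (v.1 a) = 0
  refine finsum_eq_zero_of_forall_eq_zero fun a => ?_
  by_cases ha : DegGE (V.deg a) n
  · rw [f.tri b a fun h' => hb (h'.trans ha)]
    rfl
  · rw [h a ha, map_zero]

theorem isTri_assoc : IsTri (assoc V W U) := fun n v h p hp => by
  refine (congrArg _ (h ((p.1, p.2.1), p.2.2) ?_)).trans (map_zero _)
  change ¬ DegGE (V.deg p.1 + W.deg p.2.1 + U.deg p.2.2) n
  rwa [add_assoc]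

theorem isTri_lunit : IsTri (lunit V) := fun n v h a ha => by
  refine (congrArg _ (h ((), a) ?_)).trans (map_zero _)
  change ¬ DegGE (0 + V.deg a) n
  rwa [zero_add]

theorem isTri_runit : IsTri (runit V) := fun n v h a ha => by
  refine (congrArg _ (h (a, ()) ?_)).trans (map_zero _)
  change ¬ DegGE (V.deg a + 0) n
  rwa [add_zero]

theorem isTri_mid : IsTri (mid V) := fun n v h p hp => by
  refine (congrArg _ (h ((p.1.1, p.2.1), (p.1.2, p.2.2)) ?_)).trans (map_zero _)
  change ¬ DegGE (V.deg p.1.1 + V.deg p.2.1 + (V.deg p.1.2 + V.deg p.2.2)) n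
  rwa [add_add_add_comm]

/-- Locality: the component at `b` of the image only feels input of first degree at most that of
`b`. If that input vanishes, `v` lives above `((W.deg b).1 + 1, k)`, hence so does `T v`, and `b`
lies too low. With the bound `k`, only the finite set of `finite_low` matters. -/
theorem IsTri.apply_eq_zero {T : Tot V →ₗ[ℝ] Tot W} (hT : IsTri T) {k : ℕ} {v : Tot V}
    (hv : SuppGE (0, k) v) (b : W.ι) (h : ∀ a, (V.deg a).1 ≤ (W.deg b).1 → v.1 a = 0) :
    (T v).1 b = 0 := by
  refine hT ((W.deg b).1 + 1, k) v (fun a ha => ?_) b fun h' => absurd h'.1 (by simp)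
  by_cases h1 : (V.deg a).1 ≤ (W.deg b).1
  · exact h a h1
  · exact hv a fun h2 => ha ⟨not_le.1 h1, h2.2⟩

theorem finite_low (V : BiSpace.{u}) (n k : ℕ) :
    {a | (V.deg a).1 ≤ n ∧ (V.deg a).2 ≤ k}.Finite :=
  Set.Finite.preimage' (f := V.deg) ((Set.finite_Iic n).prod (Set.finite_Iic k))
    fun n _ => V.fin n

open Classical in
/-- The homogeneous formal sum with the only component `x` at `a`. -/
noncomputable def single (a : V.ι) : V.V a →ₗ[ℝ] Tot V where
  toFun x := ⟨Pi.single a x, (V.deg a).2, fun b hb => Pi.single_eq_of_ne (by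
    rintro rfl
    exact lt_irrefl _ hb) x⟩
  map_add' x y := Subtype.ext (Pi.single_add a x y)
  map_smul' c x := Subtype.ext (Pi.single_smul a c x)

theorem single_same (a : V.ι) (x : V.V a) : (single a x).1 a = x := by
  classical
  exact Pi.single_eq_same a x

theorem single_ne {a b : V.ι} (h : b ≠ a) (x : V.V a) : (single a x).1 b = 0 := by
  classical
  exact Pi.single_eq_of_ne h x

/-- For a fixed output index `b`, the argument is truncated to the finitely many indices that `b`
can feel; the remainder `r` contributes nothing at `b` by `IsTri.apply_eq_zero`, and finite
linearity does the rest. -/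
theorem IsTri.ext_single {T T' : Tot V →ₗ[ℝ] Tot W} (hT : IsTri T) (hT' : IsTri T')
    (h : ∀ a x, T (single a x) = T' (single a x)) : T = T' := by
  classical
  refine LinearMap.ext fun v => Subtype.ext (funext fun b => ?_)
  obtain ⟨k, hk⟩ := exists_suppGE v
  let A := (finite_low V (W.deg b).1 k).toFinset
  let r := v - ∑ a ∈ A, single a (v.1 a)
  have hA : ∀ a, (∑ a ∈ A, single a (v.1 a)).1 a = if a ∈ A then v.1 a else 0 := by
    intro a
    rw [Submodule.coe_sum, Finset.sum_apply]
    by_cases ha : a ∈ A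
    · rw [if_pos ha, Finset.sum_eq_single a, single_same]
      · intro c _ hc
        exact single_ne hc.symm _
      · exact fun h => absurd ha h
    · rw [if_neg ha]
      refine Finset.sum_eq_zero fun c hc => single_ne ?_ _
      rintro rfl
      exact ha hc
  have hr : SuppGE (0, k) r := fun a ha => by
    change v.1 a - (∑ a ∈ A, single a (v.1 a)).1 a = 0
    rw [hA, hk a ha]
    simp
  have hr0 : ∀ a, (V.deg a).1 ≤ (W.deg b).1 → r.1 a = 0 := fun a ha => by
    change v.1 a - (∑ a ∈ A, single a (v.1 a)).1 a = 0
    rw [hA]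
    by_cases haA : a ∈ A
    · rw [if_pos haA, sub_self]
    · rw [if_neg haA, sub_zero]
      refine hk a fun h' => haA ?_
      exact (Set.Finite.mem_toFinset _).2 ⟨ha, h'.2⟩
  have hv : v = r + ∑ a ∈ A, single a (v.1 a) := (sub_add_cancel _ _).symm
  have e : ∀ S : Tot V →ₗ[ℝ] Tot W, IsTri S →
      (S v).1 b = (∑ a ∈ A, S (single a (v.1 a))).1 b := by
    intro S hS
    conv_lhs => rw [hv]
    rw [map_add, map_sum]
    change (S r).1 b + _ = _
    rw [hS.apply_eq_zero hr b hr0, zero_add]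
  rw [e T hT, e T' hT']
  simp only [h]

/-- The homogeneous formal sums are linear combinations of elements of `S`. -/
def Gen (S : Set (Tot V)) : Prop := ∀ a x, single a x ∈ Submodule.span ℝ S

/-- The form in which the Hopf axioms are verified, with `S` consisting of classes of good forests
or of tensors of such classes. -/
theorem IsTri.ext {S : Set (Tot V)} (hS : Gen S) {T T' : Tot V →ₗ[ℝ] Tot W} (hT : IsTri T)
    (hT' : IsTri T') (h : ∀ x ∈ S, T x = T' x) : T = T' :=
  hT.ext_single hT' fun a x => LinearMap.eqOn_span h (hS a x)

/-! ### Pure tensors of formal sums -/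

theorem tmul_single (a : V.ι) (b : W.ι) (x : V.V a) (y : W.V b) :
    tmul (single a x) (single b y) = single (V := V.tens W) (a, b) (x ⊗ₜ[ℝ] y) := by
  refine Subtype.ext (funext ?_)
  rintro ⟨c, e⟩
  change (single a x).1 c ⊗ₜ[ℝ] (single b y).1 e = _
  by_cases hc : c = a
  · by_cases he : e = b
    · subst hc he
      rw [single_same, single_same, single_same]
    · rw [single_ne he, TensorProduct.tmul_zero, single_ne]
      exact fun h => he (congrArg Prod.snd h)
  · rw [single_ne hc, TensorProduct.zero_tmul, single_ne]
    exact fun h => hc (congrArg Prod.fst h)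

/-- `tmul` as a bilinear map. -/
noncomputable def tmulLin (V : BiSpace.{u}) (W : BiSpace.{v}) :
    Tot V →ₗ[ℝ] Tot W →ₗ[ℝ] Tot (V.tens W) :=
  LinearMap.mk₂ ℝ tmul
    (fun x y _ => Subtype.ext (funext fun p => TensorProduct.add_tmul (x.1 p.1) (y.1 p.1) _))
    (fun c x _ => Subtype.ext (funext fun p => TensorProduct.smul_tmul' c (x.1 p.1) _))
    (fun _ y z => Subtype.ext (funext fun p => TensorProduct.tmul_add _ (y.1 p.2) (z.1 p.2)))
    (fun c x z => Subtype.ext (funext fun p => TensorProduct.tmul_smul c (x.1 p.1) (z.1 p.2)))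

theorem tmulLin_apply (x : Tot V) (y : Tot W) : tmulLin V W x y = tmul x y := rfl

theorem tmul_smul_left (c : ℝ) (x : Tot V) (y : Tot W) : tmul (c • x) y = c • tmul x y := by
  rw [← tmulLin_apply, map_smul]
  rfl

theorem tmul_smul_right (c : ℝ) (x : Tot V) (y : Tot W) : tmul x (c • y) = c • tmul x y := by
  rw [← tmulLin_apply, map_smul]
  rfl

theorem tmul_zero_left (y : Tot W) : tmul (0 : Tot V) y = 0 := by
  rw [← tmulLin_apply, map_zero]
  rfl

theorem tmul_zero_right (x : Tot V) : tmul x (0 : Tot W) = 0 := by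
  rw [← tmulLin_apply, map_zero]

theorem Gen.tmul {S : Set (Tot V)} {S' : Set (Tot W)} (hS : Gen S) (hS' : Gen S') :
    Gen (V := V.tens W) {z | ∃ x ∈ S, ∃ y ∈ S', z = BiSpace.tmul x y} := by
  rintro ⟨a, b⟩ z
  change V.V a ⊗[ℝ] W.V b at z
  induction z using TensorProduct.induction_on with
  | zero => rw [map_zero]; exact Submodule.zero_mem _
  | add z z' h h' => rw [map_add]; exact Submodule.add_mem _ h h'
  | tmul x y =>
    rw [← tmul_single, ← tmulLin_apply]
    have h : Submodule.map₂ (tmulLin V W) (Submodule.span ℝ S) (Submodule.span ℝ S') ≤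
        Submodule.span ℝ {z : Tot (V.tens W) | ∃ x ∈ S, ∃ y ∈ S', z = BiSpace.tmul x y} := by
      rw [Submodule.map₂_span_span]
      refine Submodule.span_mono ?_
      rintro _ ⟨x, hx, y, hy, rfl⟩
      exact ⟨x, hx, y, hy, rfl⟩
    exact h (Submodule.apply_mem_map₂ _ (hS a x) (hS' b y))

theorem gen_one : Gen {oneElt} := by
  rintro ⟨⟩ x
  have : single (V := one) () x = (show ℝ from x) • oneElt := by
    refine Subtype.ext (funext ?_)
    rintro ⟨⟩
    rw [single_same]
    exact (mul_one (show ℝ from x)).symm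
  rw [this]
  exact Submodule.smul_mem _ _ (Submodule.subset_span rfl)

/-! ### Locally finite sums -/

/-- `s` is the locally finite sum of the family `t`. -/
structure HasFSum {P : Type*} (t : P → Tot V) (s : Tot V) : Prop where
  bdd : ∃ k, ∀ p, SuppGE (0, k) (t p)
  fin : ∀ a, (Function.support fun p => (t p).1 a).Finite
  eq : ∀ a, s.1 a = ∑ᶠ p, (t p).1 a

theorem HasFSum.unique {P : Type*} {t : P → Tot V} {s s' : Tot V} (h : HasFSum t s)
    (h' : HasFSum t s') : s = s' :=
  Subtype.ext (funext fun a => (h.eq a).trans (h'.eq a).symm)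

theorem HasFSum.suppGE {P : Type*} {t : P → Tot V} {s : Tot V} (h : HasFSum t s) {n : ℕ × ℕ}
    (ht : ∀ p, SuppGE n (t p)) : SuppGE n s := fun a ha => by
  rw [h.eq]
  exact finsum_eq_zero_of_forall_eq_zero fun p => ht p a ha

/-- A term whose first degree exceeds that of `a` cannot contribute at `a`. For sums over cuts the
first degree grows with `ε`, the only parameter with an infinite range. -/
theorem finite_support_of_suppGE {P : Type*} {t : P → Tot V} {D : P → ℕ × ℕ}
    (ht : ∀ p, SuppGE (D p) (t p)) (hD : ∀ n, {p | (D p).1 ≤ n}.Finite) (a : V.ι) :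
    (Function.support fun p => (t p).1 a).Finite := by
  refine (hD (V.deg a).1).subset fun p hp => ?_
  by_contra h
  exact hp (ht p a fun h' => h h'.1)

/-- The uniform bound `k` leaves finitely many input indices that can influence the output at `b`,
and each of them meets finitely many terms. The resulting finite set `A b` contains every term that
counts at `b`. -/
theorem IsTri.hasFSum {T : Tot V →ₗ[ℝ] Tot W} (hT : IsTri T) {P : Type*} {t : P → Tot V}
    {s : Tot V} (h : HasFSum t s) : HasFSum (fun p => T (t p)) (T s) := by
  classical
  obtain ⟨k, hk⟩ := h.bdd
  have hs : SuppGE (0, k) s := h.suppGE hk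
  let A : W.ι → Finset P := fun b =>
    ((finite_low V (W.deg b).1 k).biUnion fun a _ => h.fin a).toFinset
  have hA : ∀ b p, p ∉ A b → (T (t p)).1 b = 0 := by
    intro b p hp
    refine hT.apply_eq_zero (hk p) b fun a ha => ?_
    by_contra h0
    refine hp ((Set.Finite.mem_toFinset _).2 (Set.mem_biUnion (x := a) ⟨ha, ?_⟩ h0))
    by_contra h1
    exact h0 (hk p a fun h2 => h1 h2.2)
  have hA' : ∀ b, (Function.support fun p => (T (t p)).1 b) ⊆ A b := fun b p hp => by
    by_contra h0
    exact hp (hA b p h0)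
  refine ⟨⟨k, fun p => hT _ _ (hk p)⟩, fun b => (A b).finite_toSet.subset (hA' b), fun b => ?_⟩
  rw [finsum_eq_sum_of_support_subset _ (hA' b)]
  -- After the terms in `A b` are removed, no component of `s` of first degree at most that of `b`
  -- is left, so the image of the remainder vanishes at `b`.
  have hr : SuppGE (0, k) (s - ∑ p ∈ A b, t p) := hs.sub (SuppGE.sum _ fun p _ => hk p)
  have h0 : (T (s - ∑ p ∈ A b, t p)).1 b = 0 := by
    refine hT.apply_eq_zero hr b fun a ha => ?_
    change s.1 a - (∑ p ∈ A b, t p).1 a = 0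
    by_cases hak : (V.deg a).2 ≤ k
    · rw [h.eq, Submodule.coe_sum, Finset.sum_apply,
        finsum_eq_sum_of_support_subset (s := A b), sub_self]
      intro p hp
      exact (Set.Finite.mem_toFinset _).2 (Set.mem_biUnion (x := a) ⟨ha, hak⟩ hp)
    · exact hr a fun h2 => hak h2.2
  rw [map_sub, map_sum] at h0
  have h1 : (T s).1 b - (∑ p ∈ A b, T (t p)).1 b = 0 := h0
  rw [sub_eq_zero.1 h1, Submodule.coe_sum, Finset.sum_apply]

theorem finsum_tmul_finsum {P Q : Type*} {M N : Type*} [AddCommGroup M] [Module ℝ M]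
    [AddCommGroup N] [Module ℝ N] {f : P → M} {g : Q → N} (hf : f.support.Finite)
    (hg : g.support.Finite) :
    (∑ᶠ p, f p) ⊗ₜ[ℝ] (∑ᶠ q, g q) = ∑ᶠ r : P × Q, f r.1 ⊗ₜ[ℝ] g r.2 := by
  rw [finsum_eq_sum_of_support_subset f (s := hf.toFinset) (by simp),
    finsum_eq_sum_of_support_subset g (s := hg.toFinset) (by simp),
    finsum_eq_sum_of_support_subset (s := hf.toFinset ×ˢ hg.toFinset), TensorProduct.sum_tmul,
    Finset.sum_product]
  · exact Finset.sum_congr rfl fun p _ => TensorProduct.tmul_sum _ _ _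
  · rintro ⟨p, q⟩ h
    simp only [Finset.coe_product, Set.Finite.coe_toFinset, Set.mem_prod, Function.mem_support]
    refine ⟨fun h0 => h ?_, fun h0 => h ?_⟩
    · change f p ⊗ₜ[ℝ] g q = 0
      rw [h0, TensorProduct.zero_tmul]
    · change f p ⊗ₜ[ℝ] g q = 0
      rw [h0, TensorProduct.tmul_zero]

theorem HasFSum.tmul {P Q : Type*} {t : P → Tot V} {s : Tot V} {t' : Q → Tot W} {s' : Tot W}
    (h : HasFSum t s) (h' : HasFSum t' s') :
    HasFSum (fun r : P × Q => tmul (t r.1) (t' r.2)) (tmul s s') := by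
  obtain ⟨k, hk⟩ := h.bdd
  obtain ⟨l, hl⟩ := h'.bdd
  refine ⟨⟨k + l, fun r => (hk r.1).tmul (hl r.2)⟩, fun a => ?_, fun a => ?_⟩
  · refine ((h.fin a.1).prod (h'.fin a.2)).subset fun r hr => ⟨fun h0 => hr ?_, fun h0 => hr ?_⟩
    · change (t r.1).1 a.1 ⊗ₜ[ℝ] (t' r.2).1 a.2 = 0
      rw [show (t r.1).1 a.1 = 0 from h0, TensorProduct.zero_tmul]
    · change (t r.1).1 a.1 ⊗ₜ[ℝ] (t' r.2).1 a.2 = 0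
      rw [show (t' r.2).1 a.2 = 0 from h0, TensorProduct.tmul_zero]
  · change s.1 a.1 ⊗ₜ[ℝ] s'.1 a.2 = _
    rw [h.eq, h'.eq, finsum_tmul_finsum (h.fin _) (h'.fin _)]
    rfl

theorem Tri.tens_tmul (f : Tri V W) (g : Tri V' W') (x : Tot V) (y : Tot V') :
    (Tri.tens f g).toLin (tmul x y) = tmul (f.toLin x) (g.toLin y) := by
  refine Subtype.ext (funext fun b => ?_)
  change _ = (∑ᶠ a, f.mat b.1 a (x.1 a)) ⊗ₜ[ℝ] (∑ᶠ a, g.mat b.2 a (y.1 a))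
  rw [finsum_tmul_finsum (f.finite_support _ _) (g.finite_support _ _)]
  rfl

theorem Tri.toLin_single (f : Tri V W) (a : V.ι) (x : V.V a) (b : W.ι) :
    (f.toLin (single a x)).1 b = f.mat b a x := by
  change ∑ᶠ c, f.mat b c ((single a x).1 c) = _
  rw [finsum_eq_single _ a, single_same]
  intro c hc
  rw [single_ne hc, map_zero]

theorem Tri.toLin_id : (Tri.id V).toLin = LinearMap.id := by
  classical
  refine (Tri.isTri _).ext_single IsTri.id fun a x => Subtype.ext (funext fun b => ?_)
  rw [Tri.toLin_single]
  change (LinearMap.single ℝ V.V a x) b = (single a x).1 b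
  by_cases h : b = a
  · subst h
    rw [single_same]
    exact Pi.single_eq_same b x
  · rw [single_ne h]
    exact Pi.single_eq_of_ne h x

theorem HasFSum.smul {P : Type*} {t : P → Tot V} {s : Tot V} (h : HasFSum t s) (c : ℝ) :
    HasFSum (fun p => c • t p) (c • s) := by
  have : IsTri (c • (LinearMap.id : Tot V →ₗ[ℝ] Tot V)) := fun n v hv => hv.smul c
  exact this.hasFSum h

theorem HasFSum.congr {P : Type*} {t t' : P → Tot V} {s : Tot V} (h : HasFSum t s)
    (h' : ∀ p, t p = t' p) : HasFSum t' s := by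
  rwa [show t = t' from funext h'] at h

/-! ### Reindexing and iterating locally finite sums -/

/-- Reindexing along a map: the coefficients are summed over the fibres. -/
theorem finsum_fiberwise {P Q M : Type*} [AddCommGroup M] [Module ℝ M] (g : P → Q) (w : P → ℝ)
    (W : Q → ℝ) (f : Q → M) (hg : ∀ q, (g ⁻¹' {q}).Finite) (hf : f.support.Finite)
    (hW : ∀ q, ∑ᶠ p ∈ g ⁻¹' {q}, w p = W q) :
    ∑ᶠ p, w p • f (g p) = ∑ᶠ q, W q • f q := by
  classical
  rw [finsum_eq_sum_of_support_subset (s := (hf.biUnion fun q _ => hg q).toFinset),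
    finsum_eq_sum_of_support_subset (s := hf.toFinset),
    ← Finset.sum_fiberwise_of_maps_to (g := g) (t := hf.toFinset)]
  · refine Finset.sum_congr rfl fun q hq => ?_
    rw [← hW q, finsum_mem_eq_finite_toFinset_sum _ (hg q), Finset.sum_smul]
    refine Finset.sum_congr ?_ ?_
    · ext p
      simp only [Finset.mem_filter, Set.Finite.mem_toFinset, Set.mem_iUnion, Set.mem_preimage,
        Set.mem_singleton_iff, exists_prop]
      constructor
      · exact fun h => h.2
      · rintro rfl
        exact ⟨⟨_, (Set.Finite.mem_toFinset _).1 hq, rfl⟩, rfl⟩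
    · intro p hp
      rw [show g p = q by simpa using hp]
  · intro p hp
    simp only [Set.Finite.mem_toFinset, Set.mem_iUnion, Set.mem_preimage,
      Set.mem_singleton_iff, exists_prop] at hp
    obtain ⟨q, hq, rfl⟩ := hp
    simpa using hq
  · intro q hq
    simp only [Set.Finite.coe_toFinset, Function.mem_support]
    intro h
    exact hq (by simp [h])
  · intro p hp
    simp only [Set.Finite.coe_toFinset, Set.mem_iUnion, Set.mem_preimage,
      Set.mem_singleton_iff, exists_prop]
    refine ⟨g p, fun h => hp ?_, rfl⟩
    simp [h]

/-- The entry point of Vandermonde's identity: the vectors depend on `p` only through `g p`, and the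
weights are summed over the finite fibres of `g`. -/
theorem HasFSum.fiberwise {P Q : Type*} {g : P → Q} {w : P → ℝ} {W : Q → ℝ} {f : Q → Tot V}
    {s s' : Tot V} (h : HasFSum (fun p => w p • f (g p)) s) (h' : HasFSum (fun q => W q • f q) s')
    (hg : ∀ q, (g ⁻¹' {q}).Finite) (hf : ∀ a, (Function.support fun q => (f q).1 a).Finite)
    (hW : ∀ q, ∑ᶠ p ∈ g ⁻¹' {q}, w p = W q) : s = s' := by
  refine Subtype.ext (funext fun a => ?_)
  rw [h.eq, h'.eq]
  exact finsum_fiberwise g w W (fun q => (f q).1 a) hg (hf a) hW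

/-- Cancellation inside the inner sums could hide infinitely many nonzero terms, so the bound and
the local finiteness of the double family are separate hypotheses. -/
theorem HasFSum.sigma {P : Type*} {Q : P → Type*} {t : ∀ p, Q p → Tot V} {u : P → Tot V}
    {s : Tot V} (hu : HasFSum u s) (ht : ∀ p, HasFSum (t p) (u p))
    (hb : ∃ k, ∀ r : Σ p, Q p, SuppGE (0, k) (t r.1 r.2))
    (hf : ∀ a, (Function.support fun r : Σ p, Q p => (t r.1 r.2).1 a).Finite) :
    HasFSum (fun r : Σ p, Q p => t r.1 r.2) s := by
  classical
  refine ⟨hb, hf, fun a => ?_⟩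
  rw [hu.eq, finsum_eq_sum_of_support_subset (s := (hf a).toFinset) _ (by simp),
    finsum_eq_sum_of_support_subset (s := (hf a).toFinset.image Sigma.fst)]
  · rw [← Finset.sum_fiberwise_of_maps_to (g := Sigma.fst)
      (t := (hf a).toFinset.image Sigma.fst) fun r hr => Finset.mem_image_of_mem _ hr]
    refine Finset.sum_congr rfl fun p _ => ?_
    rw [(ht p).eq, finsum_eq_sum_of_support_subset (s := ((ht p).fin a).toFinset) _ (by simp)]
    refine Finset.sum_bij (fun q _ => ⟨p, q⟩) ?_ ?_ ?_ ?_
    · intro q hq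
      simpa using hq
    · intro q _ q' _ h
      simpa using h
    · rintro ⟨p', q⟩ h
      simp only [Finset.mem_filter] at h
      obtain ⟨h1, rfl⟩ := h
      exact ⟨q, by simpa using h1, rfl⟩
    · intro q _
      rfl
  · intro p hp
    by_contra h
    refine hp ?_
    change (u p).1 a = 0
    rw [(ht p).eq]
    refine finsum_eq_zero_of_forall_eq_zero fun q => ?_
    by_contra h0
    refine h ?_
    simp only [Finset.coe_image, Set.Finite.coe_toFinset, Set.mem_image]
    exact ⟨⟨p, q⟩, h0, rfl⟩

theorem assoc_tmul (x : Tot V) (y : Tot W) (z : Tot U) :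
    assoc V W U (tmul (tmul x y) z) = tmul x (tmul y z) := rfl

theorem mid_tmul (x y z w : Tot V) :
    mid V (tmul (tmul x y) (tmul z w)) = tmul (tmul x z) (tmul y w) := rfl

theorem lunit_tmul (x : Tot V) : lunit V (tmul oneElt x) = x :=
  Subtype.ext (funext fun a => TensorProduct.lid_tmul (x.1 a) (1 : ℝ) |>.trans (one_smul _ _))

theorem runit_tmul (x : Tot V) : runit V (tmul x oneElt) = x :=
  Subtype.ext (funext fun a => TensorProduct.rid_tmul (x.1 a) (1 : ℝ) |>.trans (one_smul _ _))

end BiSpace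
end HopfForest

/-! ## Contractions of decorated forests -/

namespace HopfForest

/-! ### Finite sums over subtypes, disjoint unions and ranges -/

theorem ite_eq_of_iff {p q : Prop} {_ : Decidable p} {_ : Decidable q} {α : Type*} {a b : α}
    (h : p ↔ q) : (if p then a else b) = if q then a else b := by
  by_cases hp : p
  · rw [if_pos hp, if_pos (h.1 hp)]
  · rw [if_neg hp, if_neg fun hq => hp (h.2 hq)]

theorem sum_subtype_eq_sum {α M : Type*} [AddCommMonoid M] [Fintype α] {p : α → Prop}
    {inst : Fintype {a // p a}} (f : α → M) (h : ∀ a, ¬ p a → f a = 0) :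
    ∑ a : {a // p a}, f a.1 = ∑ a, f a := by
  classical
  rw [← Finset.sum_subtype (Finset.univ.filter p) (by simp) f, Finset.sum_filter]
  refine Finset.sum_congr rfl fun a _ => ?_
  split_ifs with hp
  · rfl
  · exact (h a hp).symm

theorem prod_subtype_eq_prod {α M : Type*} [CommMonoid M] [Fintype α] {p : α → Prop}
    {inst : Fintype {a // p a}} (f : α → M) (h : ∀ a, ¬ p a → f a = 1) :
    ∏ a : {a // p a}, f a.1 = ∏ a, f a := by
  classical
  rw [← Finset.prod_subtype (Finset.univ.filter p) (by simp) f, Finset.prod_filter]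
  refine Finset.prod_congr rfl fun a _ => ?_
  split_ifs with hp
  · rfl
  · exact (h a hp).symm

theorem sum_sum_eq {α β M : Type*} [AddCommMonoid M] [Fintype α] [Fintype β]
    {inst : Fintype (α ⊕ β)} (f : α ⊕ β → M) :
    ∑ a, f a = ∑ a, f (.inl a) + ∑ b, f (.inr b) := by
  rw [← Fintype.sum_sum_type]
  refine Finset.sum_congr ?_ fun _ _ => rfl
  ext
  simp

theorem eq_sum_inl {α β M : Type*} [AddCommMonoid M] [Fintype α] [Fintype β]
    {inst : Fintype (α ⊕ β)} {f : α → M} {g : α ⊕ β → M} (h : ∀ a, f a = g (.inl a))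
    (h' : ∀ b, g (.inr b) = 0) : ∑ a, f a = ∑ a, g a := by
  rw [sum_sum_eq g, Finset.sum_eq_zero fun b _ => h' b, add_zero, Finset.sum_congr rfl fun a _ => h a]

theorem eq_sum_inr {α β M : Type*} [AddCommMonoid M] [Fintype α] [Fintype β]
    {inst : Fintype (α ⊕ β)} {f : β → M} {g : α ⊕ β → M} (h : ∀ b, f b = g (.inr b))
    (h' : ∀ a, g (.inl a) = 0) : ∑ b, f b = ∑ a, g a := by
  rw [sum_sum_eq g, Finset.sum_eq_zero (s := (Finset.univ : Finset α)) fun a _ => h' a, zero_add,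
    Finset.sum_congr rfl fun b _ => h b]

theorem prod_sum_eq {α β M : Type*} [CommMonoid M] [Fintype α] [Fintype β]
    {inst : Fintype (α ⊕ β)} (f : α ⊕ β → M) :
    ∏ a, f a = (∏ a, f (.inl a)) * ∏ b, f (.inr b) := by
  rw [← Fintype.prod_sum_type]
  refine Finset.prod_congr ?_ fun _ _ => rfl
  ext
  simp

/-- Applied with `g = gE`: a sum over the edges of `x` splits into the contracted edges and the
edges kept in `y`. -/
theorem sum_eq_add_sum_range {α β M : Type*} [AddCommMonoid M] [Fintype α] [Fintype β]
    {g : β → α} (hg : Function.Injective g) [DecidablePred (· ∉ Set.range g)] (f : α → M) :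
    ∑ a, f a = (∑ a, if a ∉ Set.range g then f a else 0) + ∑ b, f (g b) := by
  classical
  have h : ∑ b, f (g b) = ∑ a, if a ∈ Set.range g then f a else 0 := by
    rw [← Finset.sum_filter]
    refine (Finset.sum_map Finset.univ ⟨g, hg⟩ f).symm.trans (Finset.sum_congr ?_ fun _ _ => rfl)
    ext a
    simp
  rw [h, ← Finset.sum_add_distrib]
  refine Finset.sum_congr rfl fun a _ => ?_
  by_cases ha : a ∈ Set.range g
  · rw [if_neg (not_not_intro ha), if_pos ha, zero_add]
  · rw [if_pos ha, if_neg ha, add_zero]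

section

variable {d : ℕ} {L : Type}

/-- An isomorphism of decorated forests from bijections on nodes and edges. -/
noncomputable def DIso.ofBijective {x y : DForest d L} (fN : x.N → y.N) (fE : x.E → y.E)
    (hN : Function.Bijective fN) (hE : Function.Bijective fE)
    (src : ∀ a, y.src (fE a) = fN (x.src a)) (tgt : ∀ a, y.tgt (fE a) = fN (x.tgt a))
    (typ : ∀ a, y.typ (fE a) = x.typ a) (cN : ∀ v, y.cN (fN v) = x.cN v)
    (cE : ∀ a, y.cE (fE a) = x.cE a) (nn : ∀ v, y.nn (fN v) = x.nn v)
    (oo : ∀ v, y.oo (fN v) = x.oo v) (ee : ∀ a, y.ee (fE a) = x.ee a) : DIso x y where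
  eN := Equiv.ofBijective fN hN
  eE := Equiv.ofBijective fE hE
  src := src
  tgt := tgt
  typ := typ
  cN := cN
  cE := cE
  nn := nn
  oo := oo
  ee := ee

/-- A contraction of coloured forests: some coloured edges are contracted (those outside the range
of `gE`), the other edges are kept. -/
structure Contr (x y : CForest L) where
  fN : x.N → y.N
  gE : y.E → x.E
  surj : Function.Surjective fN
  inj : Function.Injective gE
  src : ∀ b, fN (x.src (gE b)) = y.src b
  tgt : ∀ b, fN (x.tgt (gE b)) = y.tgt b
  typ : ∀ b, x.typ (gE b) = y.typ b
  cN : ∀ v, y.cN (fN v) = x.cN v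
  cE : ∀ b, y.cE b = x.cE (gE b)
  col : ∀ a, a ∉ Set.range gE → x.cE a ≠ 0
  loop : ∀ a, a ∉ Set.range gE → fN (x.src a) = fN (x.tgt a)
  fib : ∀ v w, fN v = fN w → Relation.EqvGen
    (fun v w => ∃ a, a ∉ Set.range gE ∧ x.src a = v ∧ x.tgt a = w) v w

open Classical in
/-- A contraction of decorated forests. -/
structure DContr (x y : DForest d L) extends Contr x.toCForest y.toCForest where
  nn : ∀ X, y.nn X = ∑ v, if fN v = X then x.nn v else 0
  oo : ∀ X, y.oo X = (∑ v, if fN v = X then x.oo v else 0) +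
    ∑ a, if a ∉ Set.range gE ∧ fN (x.src a) = X then (0, Finsupp.single (x.typ a) 1) else 0
  ee : ∀ b, y.ee b = x.ee (gE b)

namespace Contr

variable {x y : CForest L} (φ : Contr x y)

/-- The contracted edges are coloured, so the full contraction of `x` identifies their endpoints
anyway. -/
theorem mk_eq {v w : x.N} (h : φ.fN v = φ.fN w) : Quot.mk x.Step v = Quot.mk x.Step w := by
  refine Quot.eqvGen_sound ((φ.fib v w h).mono ?_)
  rintro _ _ ⟨a, ha, rfl, rfl⟩
  exact ⟨a, φ.col a ha, rfl, rfl⟩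

theorem exists_of_uncoloured {a : x.E} (h : x.cE a = 0) : ∃ b, φ.gE b = a := by
  by_contra h'
  exact φ.col a h' h

/-- The map induced on the nodes of the contracted forests. -/
def quotMap : x.KN → y.KN := Quot.lift (fun v => Quot.mk _ (φ.fN v)) (by
  rintro _ _ ⟨a, ha, rfl, rfl⟩
  by_cases h : a ∈ Set.range φ.gE
  · obtain ⟨b, rfl⟩ := h
    rw [φ.src, φ.tgt]
    exact Quot.sound ⟨b, by rwa [φ.cE], rfl, rfl⟩
  · rw [φ.loop a h])

theorem quotMap_bijective : Function.Bijective φ.quotMap := by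
  constructor
  · rintro ⟨v⟩ ⟨w⟩ h
    -- A chain in `y` is lifted link by link. The claim is stated for all preimages, because an
    -- intermediate node may have several; any two of them agree in the quotient by `mk_eq`.
    have key : ∀ X Y, Relation.EqvGen y.Step X Y → ∀ v w, φ.fN v = X → φ.fN w = Y →
        Quot.mk x.Step v = Quot.mk x.Step w := by
      intro X Y hXY
      induction hXY with
      | rel X Y h =>
        obtain ⟨b, hb, rfl, rfl⟩ := h
        intro v w hv hw
        rw [φ.mk_eq (hv.trans (φ.src b).symm), φ.mk_eq (hw.trans (φ.tgt b).symm)]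
        exact Quot.sound ⟨φ.gE b, by rwa [← φ.cE], rfl, rfl⟩
      | refl X => exact fun v w hv hw => φ.mk_eq (hv.trans hw.symm)
      | symm _ _ _ ih => exact fun v w hv hw => (ih w v hw hv).symm
      | trans X Y Z _ _ ih ih' =>
        intro v w hv hw
        obtain ⟨u, hu⟩ := φ.surj Y
        exact (ih v u hv hu).trans (ih' u w hu hw)
    exact key _ _ (Quot.eqvGen_exact h) v w rfl rfl
  · rintro ⟨X⟩
    obtain ⟨v, rfl⟩ := φ.surj X
    exact ⟨Quot.mk _ v, rfl⟩

theorem conn_map {v w : x.N} (h : (⊤ : Subforest x.toForest).Conn v w) :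
    (⊤ : Subforest y.toForest).Conn (φ.fN v) (φ.fN w) := by
  induction h with
  | rel v w h =>
    obtain ⟨a, -, rfl, rfl⟩ := h
    by_cases h : a ∈ Set.range φ.gE
    · obtain ⟨b, rfl⟩ := h
      exact .rel _ _ ⟨b, trivial, (φ.src b).symm, (φ.tgt b).symm⟩
    · rw [φ.loop a h]
      exact .refl _
  | refl => exact .refl _
  | symm _ _ _ ih => exact .symm _ _ ih
  | trans _ _ _ _ _ ih ih' => exact .trans _ _ _ ih ih'

theorem conn_of_eq {v w : x.N} (h : φ.fN v = φ.fN w) :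
    (⊤ : Subforest x.toForest).Conn v w := by
  refine (φ.fib v w h).mono ?_
  rintro _ _ ⟨a, -, rfl, rfl⟩
  exact ⟨a, trivial, rfl, rfl⟩

theorem conn_of_conn_map {v w : x.N}
    (h : (⊤ : Subforest y.toForest).Conn (φ.fN v) (φ.fN w)) :
    (⊤ : Subforest x.toForest).Conn v w := by
  have key : ∀ X Y, (⊤ : Subforest y.toForest).Conn X Y → ∀ v w, φ.fN v = X → φ.fN w = Y →
      (⊤ : Subforest x.toForest).Conn v w := by
    intro X Y hXY
    induction hXY with
    | rel X Y h =>
      obtain ⟨b, hb, rfl, rfl⟩ := h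
      intro v w hv hw
      refine (φ.conn_of_eq (hv.trans (φ.src b).symm)).trans _ _ _ (.trans _ _ _ ?_
        (φ.conn_of_eq ((φ.tgt b).trans hw.symm)))
      exact .rel _ _ ⟨φ.gE b, trivial, rfl, rfl⟩
    | refl X => exact fun v w hv hw => φ.conn_of_eq (hv.trans hw.symm)
    | symm _ _ _ ih => exact fun v w hv hw => (ih w v hw hv).symm
    | trans X Y Z _ _ ih ih' =>
      intro v w hv hw
      obtain ⟨u, hu⟩ := φ.surj Y
      exact (ih v u hv hu).trans _ _ _ (ih' u w hu hw)
  exact key _ _ h v w rfl rfl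

/-- Connectedness passes along `fN` in both directions and colours are kept. A contracted edge has
the colour of its endpoints, so it imposes no condition beyond that on the nodes. -/
theorem full_iff {i : ℕ} (v : x.N) : y.Full i (φ.fN v) ↔ x.Full i v := by
  constructor
  · intro h
    refine ⟨fun w hw => ?_, fun a ha => ?_⟩
    · rw [← φ.cN]
      exact h.1 _ (φ.conn_map hw)
    · by_cases hr : a ∈ Set.range φ.gE
      · obtain ⟨b, rfl⟩ := hr
        rw [← φ.cE]
        refine h.2 b ?_
        rw [← φ.src]
        exact φ.conn_map ha
      · rw [← (x.col a (φ.col a hr)).1, ← φ.cN]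
        exact h.1 _ (φ.conn_map ha)
  · intro h
    refine ⟨fun Y hY => ?_, fun b hb => ?_⟩
    · obtain ⟨w, rfl⟩ := φ.surj Y
      rw [φ.cN]
      exact h.1 w (φ.conn_of_conn_map hY)
    · rw [φ.cE]
      refine h.2 _ (φ.conn_of_conn_map ?_)
      rwa [φ.src]

/-- The preimage of a subforest under a contraction. -/
def sharp (B : Subforest y.toForest) : Subforest x.toForest where
  N := {v | φ.fN v ∈ B.N}
  E := {a | (a ∉ Set.range φ.gE ∧ φ.fN (x.src a) ∈ B.N) ∨ ∃ b ∈ B.E, φ.gE b = a}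
  src_mem := by
    rintro a (⟨-, h⟩ | ⟨b, hb, rfl⟩)
    · exact h
    · rw [Set.mem_ofPred_eq, φ.src]
      exact B.src_mem b hb
  tgt_mem := by
    rintro a (⟨hr, h⟩ | ⟨b, hb, rfl⟩)
    · rw [Set.mem_ofPred_eq, ← φ.loop a hr]
      exact h
    · rw [Set.mem_ofPred_eq, φ.tgt]
      exact B.tgt_mem b hb

theorem gE_mem_sharp {B : Subforest y.toForest} {b : y.E} : φ.gE b ∈ (φ.sharp B).E ↔ b ∈ B.E := by
  constructor
  · rintro (⟨h, -⟩ | ⟨c, hc, h⟩)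
    · exact absurd ⟨b, rfl⟩ h
    · rwa [← φ.inj h]
  · exact fun h => Or.inr ⟨b, h, rfl⟩

theorem mem_sharp_of_notMem_range {B : Subforest y.toForest} {a : x.E}
    (ha : a ∉ Set.range φ.gE) : a ∈ (φ.sharp B).E ↔ φ.fN (x.src a) ∈ B.N := by
  constructor
  · rintro (⟨-, h⟩ | ⟨c, -, h⟩)
    · exact h
    · exact absurd ⟨c, h⟩ ha
  · exact fun h => Or.inl ⟨ha, h⟩

/-- This allows a contraction to be restricted to the cores, which is how it produces an instance of
`Eqv`. -/
theorem sharp_core (i : ℕ) : φ.sharp (y.core i) = x.core i := by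
  ext a
  · exact not_congr (φ.full_iff a)
  · by_cases ha : a ∈ Set.range φ.gE
    · obtain ⟨b, rfl⟩ := ha
      rw [φ.gE_mem_sharp]
      change ¬ y.Full i (y.src b) ↔ ¬ x.Full i (x.src (φ.gE b))
      rw [← φ.src, φ.full_iff]
    · rw [φ.mem_sharp_of_notMem_range ha]
      exact not_congr (φ.full_iff _)

end Contr

/-- The class of a node, as a contraction onto the contracted forest. -/
def CForest.toContract (x : CForest L) : Contr x x.contract where
  fN := Quot.mk _
  gE := Subtype.val
  surj := Quot.mk_surjective
  inj := Subtype.val_injective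
  src _ := rfl
  tgt _ := rfl
  typ _ := rfl
  cN _ := rfl
  cE b := b.2.symm
  col a ha h := ha ⟨⟨a, h⟩, rfl⟩
  loop a ha := Quot.sound ⟨a, fun h => ha ⟨⟨a, h⟩, rfl⟩, rfl, rfl⟩
  fib v w h := by
    refine (Quot.eqvGen_exact h).mono ?_
    rintro _ _ ⟨a, ha, rfl, rfl⟩
    refine ⟨a, ?_, rfl, rfl⟩
    rintro ⟨b, rfl⟩
    exact ha b.2

/-- An uncoloured edge never becomes a loop (`mk_src_ne`). This reconciles the two ways of singling
out the edges whose types enter `𝔬`: both endpoints in one class, or not kept by the contraction. -/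
theorem CForest.notMem_range_iff (x : CForest L) (a : x.E) :
    a ∉ Set.range x.toContract.gE ↔
      Quot.mk x.Step (x.src a) = Quot.mk x.Step (x.tgt a) := by
  constructor
  · exact x.toContract.loop a
  · rintro h ⟨b, rfl⟩
    exact x.mk_src_ne b.2 h

theorem CForest.toContract_sharp (x : CForest L) (B : Subforest x.contract.toForest) :
    x.toContract.sharp B = x.sharp B := by
  ext a
  · exact Iff.rfl
  · refine or_congr (and_congr_left fun _ => x.notMem_range_iff a) ?_
    constructor
    · rintro ⟨b, hb, rfl⟩
      exact ⟨b.2, hb⟩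
    · rintro ⟨h, ha⟩
      exact ⟨⟨a, h⟩, ha, rfl⟩

/-- The projection to the contracted decorated forest. -/
def DForest.toContract (x : DForest d L) : DContr x x.contract where
  toContr := x.toCForest.toContract
  nn _ := rfl
  oo X := by
    classical
    refine congrArg₂ (· + ·) rfl (Finset.sum_congr rfl fun a _ => if_congr ?_ rfl rfl)
    refine Iff.trans ?_ (and_congr_left fun _ => (x.notMem_range_iff a).symm)
    constructor
    · rintro ⟨h1, h2⟩
      exact ⟨h1.trans h2.symm, h1⟩
    · rintro ⟨h1, h2⟩
      exact ⟨h2, h1.symm.trans h2⟩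
  ee _ := rfl

/-- An isomorphism as a contraction. -/
def CIso.toContr {x y : CForest L} (φ : CIso x y) : Contr x y where
  fN := φ.eN
  gE := φ.eE.symm
  surj := φ.eN.surjective
  inj := φ.eE.symm.injective
  src b := by rw [← φ.src, Equiv.apply_symm_apply]
  tgt b := by rw [← φ.tgt, Equiv.apply_symm_apply]
  typ b := by rw [← φ.typ, Equiv.apply_symm_apply]
  cN := φ.cN
  cE b := by rw [← φ.cE, Equiv.apply_symm_apply]
  col a ha := absurd ⟨φ.eE a, φ.eE.symm_apply_apply a⟩ ha
  loop a ha := absurd ⟨φ.eE a, φ.eE.symm_apply_apply a⟩ ha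
  fib v w h := by
    rw [φ.eN.injective h]
    exact .refl _

/-- An isomorphism as a contraction. -/
def DIso.toDContr {x y : DForest d L} (φ : DIso x y) : DContr x y where
  toContr := φ.toCIso.toContr
  nn X := by
    classical
    change _ = ∑ v, if φ.eN v = X then x.nn v else 0
    obtain ⟨w, rfl⟩ := φ.eN.surjective X
    simp [φ.nn]
  oo X := by
    classical
    change _ = (∑ v, if φ.eN v = X then x.oo v else 0) + _
    obtain ⟨w, rfl⟩ := φ.eN.surjective X
    rw [Finset.sum_eq_zero (s := (Finset.univ : Finset x.E)), add_zero]
    · simp [φ.oo]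
    · exact fun a _ => if_neg fun h => h.1 ⟨φ.eE a, φ.eE.symm_apply_apply a⟩
  ee b := by
    change _ = x.ee (φ.eE.symm b)
    rw [← φ.ee, Equiv.apply_symm_apply]

namespace DContr

variable {x y : DForest d L}

open Classical in
theorem sum_fiber {M : Type*} [AddCommMonoid M] (φ : DContr x y) (p : y.N → Prop)
    (f : x.N → M) :
    (∑ X, if p X then ∑ v, if φ.fN v = X then f v else 0 else 0) =
      ∑ v, if p (φ.fN v) then f v else 0 := by
  have h : ∀ X, (if p X then ∑ v, if φ.fN v = X then f v else 0 else 0) =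
      ∑ v, if φ.fN v = X then (if p (φ.fN v) then f v else 0) else 0 := by
    intro X
    split_ifs with hX
    · refine Finset.sum_congr rfl fun v _ => ?_
      by_cases h1 : φ.fN v = X
      · rw [if_pos h1, if_pos h1, if_pos (h1 ▸ hX)]
      · rw [if_neg h1, if_neg h1]
    · refine (Finset.sum_eq_zero fun v _ => ?_).symm
      split_ifs with h1 h2
      · exact absurd (h1 ▸ h2) hX
      · rfl
      · rfl
  rw [Finset.sum_congr rfl fun X _ => h X, Finset.sum_comm]
  simp

open Classical in
theorem sum_fiber_edge {M : Type*} [AddCommMonoid M] (φ : DContr x y) (p : y.N → Prop)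
    (f : x.E → M) :
    (∑ X, if p X then ∑ a, if a ∉ Set.range φ.gE ∧ φ.fN (x.src a) = X then f a else 0 else 0) =
      ∑ a, if a ∉ Set.range φ.gE ∧ p (φ.fN (x.src a)) then f a else 0 := by
  have h : ∀ X, (if p X then ∑ a, if a ∉ Set.range φ.gE ∧ φ.fN (x.src a) = X then f a else 0
      else 0) = ∑ a, if φ.fN (x.src a) = X then
        (if a ∉ Set.range φ.gE ∧ p (φ.fN (x.src a)) then f a else 0) else 0 := by
    intro X
    by_cases hX : p X
    · rw [if_pos hX]
      refine Finset.sum_congr rfl fun a _ => ?_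
      by_cases h1 : φ.fN (x.src a) = X
      · by_cases h2 : a ∈ Set.range φ.gE
        · simp [h2]
        · rw [if_pos ⟨h2, h1⟩, if_pos h1, if_pos ⟨h2, h1.symm ▸ hX⟩]
      · rw [if_neg fun h => h1 h.2, if_neg h1]
    · rw [if_neg hX]
      refine (Finset.sum_eq_zero fun a _ => ?_).symm
      by_cases h1 : φ.fN (x.src a) = X
      · rw [if_pos h1, if_neg fun h => hX (h1 ▸ h.2)]
      · rw [if_neg h1]
  rw [Finset.sum_congr rfl fun X _ => h X, Finset.sum_comm]
  simp

/-- A contraction induces an isomorphism of the fully contracted forests. -/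
noncomputable def contractIso (φ : DContr x y) : DIso x.contract y.contract := by
  let g : {b // y.cE b = 0} → {a // x.cE a = 0} := fun b => ⟨φ.gE b.1, by rw [← φ.cE, b.2]⟩
  have hg : Function.Bijective g := by
    constructor
    · intro b c h
      exact Subtype.ext (φ.inj (congrArg Subtype.val h))
    · rintro ⟨a, ha⟩
      obtain ⟨b, rfl⟩ := φ.exists_of_uncoloured ha
      exact ⟨⟨b, by rw [φ.cE, ha]⟩, rfl⟩
  let e := Equiv.ofBijective g hg
  have he : ∀ b, e.symm (g b) = b := fun b => e.symm_apply_apply b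
  have hm : ∀ (v : x.N) (V : x.KN),
      Quot.mk y.Step (φ.fN v) = φ.quotMap V ↔ Quot.mk x.Step v = V := fun v V =>
    ⟨fun h => φ.quotMap_bijective.1 h, fun h => congrArg φ.quotMap h⟩
  refine DIso.ofBijective φ.quotMap e.symm φ.quotMap_bijective e.symm.bijective ?_ ?_ ?_ ?_ ?_ ?_
    ?_ ?_
  · intro a
    obtain ⟨b, rfl⟩ := hg.2 a
    rw [he]
    exact congrArg (Quot.mk y.Step) (φ.src b.1).symm
  · intro a
    obtain ⟨b, rfl⟩ := hg.2 a
    rw [he]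
    exact congrArg (Quot.mk y.Step) (φ.tgt b.1).symm
  · intro a
    obtain ⟨b, rfl⟩ := hg.2 a
    rw [he]
    exact (φ.typ b.1).symm
  · rintro ⟨v⟩
    exact φ.cN v
  · exact fun _ => rfl
  · intro (V : x.KN)
    classical
    change (∑ X, if Quot.mk y.Step X = φ.quotMap V then y.nn X else 0) =
      ∑ v, if Quot.mk x.Step v = V then x.nn v else 0
    simp only [φ.nn]
    rw [φ.sum_fiber]
    exact Finset.sum_congr rfl fun v _ => if_congr (hm v V) rfl rfl
  · intro (V : x.KN)
    classical
    change ((∑ X, if Quot.mk y.Step X = φ.quotMap V then y.oo X else 0) +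
        ∑ b, if Quot.mk y.Step (y.src b) = φ.quotMap V ∧ Quot.mk y.Step (y.tgt b) = φ.quotMap V
          then ((0, Finsupp.single (y.typ b) 1) : (Fin d → ℤ) × (L →₀ ℤ)) else 0) =
      (∑ v, if Quot.mk x.Step v = V then x.oo v else 0) +
        ∑ a, if Quot.mk x.Step (x.src a) = V ∧ Quot.mk x.Step (x.tgt a) = V
          then ((0, Finsupp.single (x.typ a) 1) : (Fin d → ℤ) × (L →₀ ℤ)) else 0
    have h1 : ∀ X, (if Quot.mk y.Step X = φ.quotMap V then y.oo X else 0) =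
        (if Quot.mk y.Step X = φ.quotMap V then
          ∑ v, if φ.fN v = X then x.oo v else 0 else 0) +
        (if Quot.mk y.Step X = φ.quotMap V then
          ∑ a, if a ∉ Set.range φ.gE ∧ φ.fN (x.src a) = X then
            ((0, Finsupp.single (x.typ a) 1) : (Fin d → ℤ) × (L →₀ ℤ)) else 0 else 0) := by
      intro X
      split_ifs with h
      · exact φ.oo X
      · rw [add_zero]
    -- An edge inside the class `V` is contracted either already by `φ`, and then its type is
    -- recorded in `y.oo`, or only afterwards in `y`. The edge sum of `x` is split accordingly.
    rw [Finset.sum_congr rfl fun X _ => h1 X, Finset.sum_add_distrib, φ.sum_fiber,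
      φ.sum_fiber_edge, add_assoc, sum_eq_add_sum_range φ.inj (fun a : x.E =>
        if Quot.mk x.Step (x.src a) = V ∧ Quot.mk x.Step (x.tgt a) = V
          then ((0, Finsupp.single (x.typ a) 1) : (Fin d → ℤ) × (L →₀ ℤ)) else 0)]
    refine congrArg₂ (· + ·) ?_ (congrArg₂ (· + ·) ?_ ?_)
    · exact Finset.sum_congr rfl fun v _ => if_congr (hm v V) rfl rfl
    · refine Finset.sum_congr rfl fun a _ => ?_
      by_cases ha : a ∈ Set.range φ.gE
      · rw [if_neg fun h => h.1 ha, if_neg (not_not_intro ha)]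
      · rw [if_pos ha]
        refine if_congr ?_ rfl rfl
        rw [hm]
        refine ⟨fun h => ⟨h.2, ?_⟩, fun h => ⟨ha, h.1⟩⟩
        rw [← φ.mk_eq (φ.loop a ha)]
        exact h.2
    · refine Finset.sum_congr rfl fun b _ => ?_
      rw [φ.typ, ← φ.src, ← φ.tgt]
      exact if_congr (and_congr (hm _ V) (hm _ V)) rfl rfl
  · intro a
    obtain ⟨b, rfl⟩ := hg.2 a
    rw [he]
    exact φ.ee b.1

open Classical in
/-- The restriction of a contraction to a subforest and its preimage. -/
noncomputable def restr (φ : DContr x y) {A : Subforest x.toForest} {B : Subforest y.toForest}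
    (h : φ.sharp B = A) {m : x.N → Fin d → ℕ} {m' : y.N → Fin d → ℕ}
    (hm : ∀ X ∈ B.N, m' X = ∑ v, if φ.fN v = X then m v else 0) :
    DContr (x.restr A m) (y.restr B m') where
  fN v := ⟨φ.fN v.1, by
    have := v.2
    subst h
    exact this⟩
  gE b := ⟨φ.gE b.1, by
    subst h
    exact φ.gE_mem_sharp.2 b.2⟩
  surj X := by
    subst h
    obtain ⟨v, hv⟩ := φ.surj X.1
    have hv' : φ.fN v ∈ B.N := hv.symm ▸ X.2
    exact ⟨⟨v, hv'⟩, Subtype.ext hv⟩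
  inj b c hbc := Subtype.ext (φ.inj (congrArg Subtype.val hbc))
  src b := Subtype.ext (φ.src b.1)
  tgt b := Subtype.ext (φ.tgt b.1)
  typ b := φ.typ b.1
  cN v := φ.cN v.1
  cE b := φ.cE b.1
  col a ha := by
    subst h
    refine φ.col a.1 ?_
    rintro ⟨b, hb⟩
    have h2 : φ.gE b ∈ (φ.sharp B).E := hb.symm ▸ a.2
    exact ha ⟨⟨b, φ.gE_mem_sharp.1 h2⟩, Subtype.ext hb⟩
  loop a ha := by
    subst h
    refine Subtype.ext (φ.loop a.1 ?_)
    rintro ⟨b, hb⟩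
    have h2 : φ.gE b ∈ (φ.sharp B).E := hb.symm ▸ a.2
    exact ha ⟨⟨b, φ.gE_mem_sharp.1 h2⟩, Subtype.ext hb⟩
  fib := by
    subst h
    rintro ⟨v, hv⟩ ⟨w, hw⟩ hvw
    -- A chain of contracted edges stays within one fibre of `fN`, hence inside or outside the
    -- preimage of `B` as a whole, so it can be restricted to that preimage.
    have key : ∀ v w, Relation.EqvGen
        (fun v w => ∃ a, a ∉ Set.range φ.gE ∧ x.src a = v ∧ x.tgt a = w) v w →
        (v ∈ (φ.sharp B).N ↔ w ∈ (φ.sharp B).N) ∧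
        ∀ (hv : v ∈ (φ.sharp B).N) (hw : w ∈ (φ.sharp B).N), Relation.EqvGen
          (fun v w : {v // v ∈ (φ.sharp B).N} => ∃ a : {a // a ∈ (φ.sharp B).E},
            a ∉ Set.range (fun b : {b // b ∈ B.E} =>
              (⟨φ.gE b.1, φ.gE_mem_sharp.2 b.2⟩ : {a // a ∈ (φ.sharp B).E})) ∧
            (x.restr (φ.sharp B) m).src a = v ∧ (x.restr (φ.sharp B) m).tgt a = w)
          ⟨v, hv⟩ ⟨w, hw⟩ := by
      intro v w hvw
      induction hvw with
      | rel v w h =>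
        obtain ⟨a, ha, rfl, rfl⟩ := h
        refine ⟨by change φ.fN _ ∈ B.N ↔ φ.fN _ ∈ B.N; rw [φ.loop a ha], fun hv hw => ?_⟩
        refine .rel _ _ ⟨⟨a, Or.inl ⟨ha, hv⟩⟩, ?_, rfl, rfl⟩
        rintro ⟨b, hb⟩
        exact ha ⟨b.1, congrArg Subtype.val hb⟩
      | refl v => exact ⟨Iff.rfl, fun _ _ => .refl _⟩
      | symm _ _ _ ih => exact ⟨ih.1.symm, fun hv hw => (ih.2 hw hv).symm⟩
      | trans u v w _ _ ih ih' =>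
        refine ⟨ih.1.trans ih'.1, fun hu hw => ?_⟩
        have hv := ih.1.1 hu
        exact (ih.2 hu hv).trans _ _ _ (ih'.2 hv hw)
    exact (key v w (φ.fib v w (congrArg Subtype.val hvw))).2 hv hw
  nn X := by
    subst h
    refine (hm X.1 X.2).trans ?_
    refine (sum_subtype_eq_sum (p := fun v => v ∈ (φ.sharp B).N)
        (inst := instFintypeN (x.toForest.restr (φ.sharp B)))
      (fun v => if φ.fN v = X.1 then m v else 0) ?_).symm.trans ?_
    · intro v hv
      refine if_neg fun h => hv ?_
      change φ.fN v ∈ B.N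
      rw [h]
      exact X.2
    · exact Finset.sum_congr rfl fun v _ => ite_eq_of_iff
          ⟨fun h => Subtype.ext h, fun h => congrArg Subtype.val h⟩
  oo X := by
    subst h
    refine (φ.oo X.1).trans (congrArg₂ (· + ·) ?_ ?_)
    · refine (sum_subtype_eq_sum (p := fun v => v ∈ (φ.sharp B).N)
        (inst := instFintypeN (x.toForest.restr (φ.sharp B)))
        (fun v => if φ.fN v = X.1 then x.oo v else 0) ?_).symm.trans ?_
      · intro v hv
        refine if_neg fun h => hv ?_
        change φ.fN v ∈ B.N
        rw [h]
        exact X.2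
      · exact Finset.sum_congr rfl fun v _ => ite_eq_of_iff
          ⟨fun h => Subtype.ext h, fun h => congrArg Subtype.val h⟩
    · refine (sum_subtype_eq_sum (p := fun a => a ∈ (φ.sharp B).E)
        (inst := instFintypeE (x.toForest.restr (φ.sharp B)))
        (fun a => if a ∉ Set.range φ.gE ∧ φ.fN (x.src a) = X.1 then
          ((0, Finsupp.single (x.typ a) 1) : (Fin d → ℤ) × (L →₀ ℤ)) else 0) ?_).symm.trans ?_
      · intro a ha
        refine if_neg fun h => ha (Or.inl ⟨h.1, ?_⟩)
        rw [h.2]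
        exact X.2
      · refine Finset.sum_congr rfl fun a _ => ite_eq_of_iff (and_congr
          (not_congr ?_) ⟨fun h => Subtype.ext h, fun h => congrArg Subtype.val h⟩)
        constructor
        · rintro ⟨b, hb⟩
          have h2 : φ.gE b ∈ (φ.sharp B).E := hb.symm ▸ a.2
          exact ⟨⟨b, φ.gE_mem_sharp.1 h2⟩, Subtype.ext hb⟩
        · rintro ⟨b, hb⟩
          exact ⟨b.1, congrArg Subtype.val hb⟩
  ee b := φ.ee b.1

end DContr

end

end HopfForest

/-! ## The equivalence relation defined by `𝒦_i` -/

namespace HopfForest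

variable {d : ℕ} {L : Type}

theorem card_subtype_eq_sum {α : Type*} [Fintype α] (p : α → Prop) [DecidablePred p] :
    Nat.card {a // p a} = ∑ a, if p a then 1 else 0 := by
  rw [Nat.card_eq_fintype_card, Fintype.card_subtype, Finset.card_filter]

open Classical in
/-- The bidegree in terms of edges only. -/
theorem DForest.deg_eq (x : DForest d L) : x.deg = (∑ a, ∑ j, x.ee a j,
    ∑ a, ((if x.cE a = 0 then 1 else 0) + if x.cN (x.tgt a) = 0 then 1 else 0)) := by
  refine Prod.ext rfl ?_
  change Nat.card {a // x.cE a = 0} + Nat.card {v // x.cN v = 0 ∧ ∃ a, x.tgt a = v} = _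
  -- A non-root node corresponds to its unique incoming edge.
  have h : Nat.card {a // x.cN (x.tgt a) = 0} =
      Nat.card {v // x.cN v = 0 ∧ ∃ a, x.tgt a = v} := by
    refine Nat.card_congr (Equiv.ofBijective (fun a => ⟨x.tgt a.1, a.2, a.1, rfl⟩) ⟨?_, ?_⟩)
    · intro a b h
      exact Subtype.ext (x.tgt_inj (congrArg Subtype.val h))
    · rintro ⟨v, hv, a, rfl⟩
      exact ⟨⟨a, hv⟩, rfl⟩
  rw [← h, card_subtype_eq_sum, card_subtype_eq_sum, ← Finset.sum_add_distrib]

theorem CForest.cE_eq_zero_of_tgt (x : CForest L) {a : x.E} (h : x.cN (x.tgt a) = 0) :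
    x.cE a = 0 := by
  by_contra h0
  exact h0 ((x.col a h0).2 ▸ h)

/-- A contracted edge is coloured, and so is its target; hence its `𝔢` vanishes, and neither the
edge nor the target is counted in the second degree. -/
theorem DContr.deg_eq {x y : DForest d L} (φ : DContr x y) : x.deg = y.deg := by
  classical
  rw [DForest.deg_eq, DForest.deg_eq, sum_eq_add_sum_range φ.inj,
    sum_eq_add_sum_range φ.inj (fun a => (if x.cE a = 0 then 1 else 0) + _)]
  refine Prod.ext ?_ ?_
  · change _ + _ = _
    rw [Finset.sum_eq_zero, zero_add]
    · exact Finset.sum_congr rfl fun b _ => by rw [φ.ee]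
    · intro a _
      by_cases h : a ∈ Set.range φ.gE
      · exact if_neg (not_not_intro h)
      · rw [if_pos h]
        simp [x.ee_supp a (φ.col a h)]
  · change _ + _ = _
    rw [Finset.sum_eq_zero, zero_add]
    · refine Finset.sum_congr rfl fun b _ => ?_
      rw [← φ.cE, ← φ.cN, φ.tgt]
    · intro a _
      by_cases h : a ∈ Set.range φ.gE
      · exact if_neg (not_not_intro h)
      · rw [if_pos h, if_neg (φ.col a h), if_neg fun h2 => φ.col a h (x.cE_eq_zero_of_tgt h2),
          add_zero]

/-! ### Full part and core -/

/-- All nodes and edges have colour `i`. -/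
def CForest.AllCol (x : CForest L) (i : ℕ) : Prop := (∀ v, x.cN v = i) ∧ ∀ a, x.cE a = i

theorem CForest.AllCol.full {x : CForest L} {i : ℕ} (h : x.AllCol i) (v : x.N) : x.Full i v :=
  ⟨fun w _ => h.1 w, fun a _ => h.2 a⟩

/-- The union of the components that are entirely coloured with `i`. -/
def CForest.fullPart (F : CForest L) (i : ℕ) : Subforest F.toForest where
  N := {v | F.Full i v}
  E := {a | F.Full i (F.src a)}
  src_mem _ h := h
  tgt_mem a h := CForest.Full.of_conn (.rel _ _ ⟨a, trivial, rfl, rfl⟩) h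

namespace DForest

/-- The components of `x` that are not entirely coloured with `i`. -/
def coreForest (i : ℕ) (x : DForest d L) : DForest d L := x.restr (x.core i) x.nn

/-- The components of `x` that are entirely coloured with `i`. -/
def fullForest (i : ℕ) (x : DForest d L) : DForest d L := x.restr (x.fullPart i) x.nn

theorem allCol_fullForest (i : ℕ) (x : DForest d L) :
    (x.fullForest i).toCForest.AllCol i :=
  ⟨fun v => v.2.1 _ (.refl _), fun a => a.2.2 _ (.refl _)⟩

/-- The total decoration `∑ 𝔫`. -/
noncomputable def nTot (x : DForest d L) : Fin d → ℕ := ∑ v, x.nn v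

theorem fullSum_of_allCol {i : ℕ} {x : DForest d L} (h : x.toCForest.AllCol i) :
    x.fullSum i = x.nTot := by
  classical
  exact Finset.sum_congr rfl fun v _ => if_pos (h.full v)

open Classical in
/-- A decorated forest is the product of its full part and its core. -/
noncomputable def decompose (i : ℕ) (x : DForest d L) :
    DIso ((x.fullForest i).mul (x.coreForest i)) x where
  eN := Equiv.sumCompl fun v => x.Full i v
  eE := Equiv.sumCompl fun a => x.Full i (x.src a)
  src := by rintro (a | a) <;> rfl
  tgt := by rintro (a | a) <;> rfl
  typ := by rintro (a | a) <;> rfl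
  cN := by rintro (a | a) <;> rfl
  cE := by rintro (a | a) <;> rfl
  nn := by rintro (a | a) <;> rfl
  oo := by rintro (a | a) <;> rfl
  ee := by rintro (a | a) <;> rfl

theorem nTot_fullForest (i : ℕ) (x : DForest d L) : (x.fullForest i).nTot = x.fullSum i := by
  classical
  refine Eq.trans ?_ (sum_subtype_eq_sum (p := fun v => x.Full i v)
    (inst := instFintypeN (x.toForest.restr (x.fullPart i)))
    (fun v => if x.Full i v then x.nn v else 0) fun v hv => if_neg hv)
  exact Finset.sum_congr rfl fun v _ => (if_pos v.2).symm

end DForest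

namespace CForest

theorem conn_inl {F G : CForest L} {v w : F.N} (h : (⊤ : Subforest F.toForest).Conn v w) :
    (⊤ : Subforest (F.mul G).toForest).Conn (.inl v) (.inl w) := by
  induction h with
  | rel v w h =>
    obtain ⟨a, -, rfl, rfl⟩ := h
    exact .rel _ _ ⟨.inl a, trivial, rfl, rfl⟩
  | refl => exact .refl _
  | symm _ _ _ ih => exact .symm _ _ ih
  | trans _ _ _ _ _ ih ih' => exact .trans _ _ _ ih ih'

theorem conn_inr {F G : CForest L} {v w : G.N} (h : (⊤ : Subforest G.toForest).Conn v w) :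
    (⊤ : Subforest (F.mul G).toForest).Conn (.inr v) (.inr w) := by
  induction h with
  | rel v w h =>
    obtain ⟨a, -, rfl, rfl⟩ := h
    exact .rel _ _ ⟨.inr a, trivial, rfl, rfl⟩
  | refl => exact .refl _
  | symm _ _ _ ih => exact .symm _ _ ih
  | trans _ _ _ _ _ ih ih' => exact .trans _ _ _ ih ih'

theorem conn_mul {F G : CForest L} {v w : (F.mul G).N}
    (h : (⊤ : Subforest (F.mul G).toForest).Conn v w) :
    (∃ v' w', v = .inl v' ∧ w = .inl w' ∧ (⊤ : Subforest F.toForest).Conn v' w') ∨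
    ∃ v' w', v = .inr v' ∧ w = .inr w' ∧ (⊤ : Subforest G.toForest).Conn v' w' := by
  induction h with
  | rel v w h =>
    obtain ⟨a | a, -, rfl, rfl⟩ := h
    · exact Or.inl ⟨_, _, rfl, rfl, .rel _ _ ⟨a, trivial, rfl, rfl⟩⟩
    · exact Or.inr ⟨_, _, rfl, rfl, .rel _ _ ⟨a, trivial, rfl, rfl⟩⟩
  | refl v =>
    rcases v with v | v
    · exact Or.inl ⟨v, v, rfl, rfl, .refl _⟩
    · exact Or.inr ⟨v, v, rfl, rfl, .refl _⟩
  | symm _ _ _ ih =>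
    rcases ih with ⟨v, w, rfl, rfl, h⟩ | ⟨v, w, rfl, rfl, h⟩
    · exact Or.inl ⟨w, v, rfl, rfl, h.symm⟩
    · exact Or.inr ⟨w, v, rfl, rfl, h.symm⟩
  | trans _ _ _ _ _ ih ih' =>
    rcases ih with ⟨u, v, rfl, rfl, h⟩ | ⟨u, v, rfl, rfl, h⟩
    · rcases ih' with ⟨v', w, hv, rfl, h'⟩ | ⟨v', w, hv, rfl, h'⟩
      · cases hv
        exact Or.inl ⟨u, w, rfl, rfl, h.trans _ _ _ h'⟩
      · cases hv
    · rcases ih' with ⟨v', w, hv, rfl, h'⟩ | ⟨v', w, hv, rfl, h'⟩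
      · cases hv
      · cases hv
        exact Or.inr ⟨u, w, rfl, rfl, h.trans _ _ _ h'⟩

theorem full_inl {F G : CForest L} {i : ℕ} (v : F.N) :
    (F.mul G).Full i (.inl v) ↔ F.Full i v := by
  constructor
  · exact fun h => ⟨fun w hw => h.1 (.inl w) (conn_inl hw), fun a ha => h.2 (.inl a) (conn_inl ha)⟩
  · intro h
    refine ⟨fun w hw => ?_, fun a ha => ?_⟩
    · rcases conn_mul hw with ⟨v', w', hv, rfl, hc⟩ | ⟨v', w', hv, rfl, hc⟩
      · cases hv
        exact h.1 w' hc
      · cases hv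
    · rcases conn_mul ha with ⟨v', w', hv, hw, hc⟩ | ⟨v', w', hv, hw, hc⟩
      · cases hv
        rcases a with a | a
        · cases hw
          exact h.2 a hc
        · cases hw
      · cases hv

theorem full_inr {F G : CForest L} {i : ℕ} (v : G.N) :
    (F.mul G).Full i (.inr v) ↔ G.Full i v := by
  constructor
  · exact fun h => ⟨fun w hw => h.1 (.inr w) (conn_inr hw), fun a ha => h.2 (.inr a) (conn_inr ha)⟩
  · intro h
    refine ⟨fun w hw => ?_, fun a ha => ?_⟩
    · rcases conn_mul hw with ⟨v', w', hv, rfl, hc⟩ | ⟨v', w', hv, rfl, hc⟩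
      · cases hv
      · cases hv
        exact h.1 w' hc
    · rcases conn_mul ha with ⟨v', w', hv, hw, hc⟩ | ⟨v', w', hv, hw, hc⟩
      · cases hv
      · cases hv
        rcases a with a | a
        · cases hw
        · cases hw
          exact h.2 a hc

/-- The core is a union of whole components, so chains of edges starting in it stay in it, and a
full component of the core would already be full in `F`. -/
theorem not_full_restr_core {F : CForest L} {i : ℕ} (v : (F.restr (F.core i)).N) :
    ¬ (F.restr (F.core i)).Full i v := by
  intro h
  have key : ∀ v w, (⊤ : Subforest F.toForest).Conn v w →
      (v ∈ (F.core i).N ↔ w ∈ (F.core i).N) ∧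
      ∀ (hv : v ∈ (F.core i).N) (hw : w ∈ (F.core i).N),
        (⊤ : Subforest (F.restr (F.core i)).toForest).Conn ⟨v, hv⟩ ⟨w, hw⟩ := by
    intro v w h
    induction h with
    | rel v w h =>
      obtain ⟨a, -, rfl, rfl⟩ := h
      have hc : (⊤ : Subforest F.toForest).Conn (F.src a) (F.tgt a) :=
        .rel _ _ ⟨a, trivial, rfl, rfl⟩
      exact ⟨not_congr ⟨fun h => h.of_conn hc, fun h => h.of_conn hc.symm⟩,
        fun hv hw => .rel _ _ ⟨⟨a, hv⟩, trivial, rfl, rfl⟩⟩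
    | refl => exact ⟨Iff.rfl, fun _ _ => .refl _⟩
    | symm _ _ _ ih => exact ⟨ih.1.symm, fun hv hw => (ih.2 hw hv).symm⟩
    | trans _ _ _ _ _ ih ih' => exact ⟨ih.1.trans ih'.1, fun hv hw =>
        (ih.2 hv (ih.1.1 hv)).trans _ _ _ (ih'.2 _ hw)⟩
  refine v.2 ⟨fun w hw => ?_, fun a ha => ?_⟩
  · exact h.1 ⟨w, (key _ _ hw).1.1 v.2⟩ ((key _ _ hw).2 _ _)
  · exact h.2 ⟨a, (key _ _ ha).1.1 v.2⟩ ((key _ _ ha).2 v.2 ((key _ _ ha).1.1 v.2))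

end CForest

/-- The product of contractions. -/
def DContr.mul {x x' y y' : DForest d L} (φ : DContr x x') (ψ : DContr y y') :
    DContr (x.mul y) (x'.mul y') where
  fN := Sum.map φ.fN ψ.fN
  gE := Sum.map φ.gE ψ.gE
  surj := φ.surj.sumMap ψ.surj
  inj := φ.inj.sumMap ψ.inj
  src := by
    rintro (a | a)
    · exact congrArg Sum.inl (φ.src a)
    · exact congrArg Sum.inr (ψ.src a)
  tgt := by
    rintro (a | a)
    · exact congrArg Sum.inl (φ.tgt a)
    · exact congrArg Sum.inr (ψ.tgt a)
  typ := by
    rintro (a | a)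
    · exact φ.typ a
    · exact ψ.typ a
  cN := by
    rintro (a | a)
    · exact φ.cN a
    · exact ψ.cN a
  cE := by
    rintro (a | a)
    · exact φ.cE a
    · exact ψ.cE a
  col := by
    rintro (a | a) h
    · exact φ.col a fun ⟨b, hb⟩ => h ⟨.inl b, congrArg Sum.inl hb⟩
    · exact ψ.col a fun ⟨b, hb⟩ => h ⟨.inr b, congrArg Sum.inr hb⟩
  loop := by
    rintro (a | a) h
    · exact congrArg Sum.inl (φ.loop a fun ⟨b, hb⟩ => h ⟨.inl b, congrArg Sum.inl hb⟩)
    · exact congrArg Sum.inr (ψ.loop a fun ⟨b, hb⟩ => h ⟨.inr b, congrArg Sum.inr hb⟩)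
  fib := by
    rintro (v | v) (w | w) h
    · have h1 := φ.fib v w (Sum.inl_injective h)
      induction h1 with
      | rel v w h1 =>
        obtain ⟨a, ha, rfl, rfl⟩ := h1
        refine .rel _ _ ⟨.inl a, ?_, rfl, rfl⟩
        rintro ⟨b | b, hb⟩
        · exact ha ⟨b, Sum.inl_injective hb⟩
        · cases hb
      | refl => exact .refl _
      | symm _ _ _ ih => exact .symm _ _ (ih h.symm)
      | trans a b c h1 h2 ih ih' =>
        -- The induction hypotheses require equal images of the endpoints. Since `fN` is constant
        -- along contracted edges, the intermediate node has the same image too.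
        have hab : φ.fN a = φ.fN b := by
          have : Relation.EqvGen (fun v w => φ.fN v = φ.fN w) a b := by
            refine h1.mono ?_
            rintro _ _ ⟨e, he, rfl, rfl⟩
            exact φ.loop e he
          exact ((⟨fun _ => rfl, fun h => h.symm, fun h h' => h.trans h'⟩ :
            Equivalence fun v w => φ.fN v = φ.fN w).eqvGen_iff).1 this
        exact .trans _ _ _ (ih (congrArg Sum.inl hab))
          (ih' (congrArg Sum.inl (hab.symm.trans (Sum.inl_injective h))))
    · cases h
    · cases h
    · have h1 := ψ.fib v w (Sum.inr_injective h)
      induction h1 with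
      | rel v w h1 =>
        obtain ⟨a, ha, rfl, rfl⟩ := h1
        refine .rel _ _ ⟨.inr a, ?_, rfl, rfl⟩
        rintro ⟨b | b, hb⟩
        · cases hb
        · exact ha ⟨b, Sum.inr_injective hb⟩
      | refl => exact .refl _
      | symm _ _ _ ih => exact .symm _ _ (ih h.symm)
      | trans a b c h1 h2 ih ih' =>
        have hab : ψ.fN a = ψ.fN b := by
          have : Relation.EqvGen (fun v w => ψ.fN v = ψ.fN w) a b := by
            refine h1.mono ?_
            rintro _ _ ⟨e, he, rfl, rfl⟩
            exact ψ.loop e he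
          exact ((⟨fun _ => rfl, fun h => h.symm, fun h h' => h.trans h'⟩ :
            Equivalence fun v w => ψ.fN v = ψ.fN w).eqvGen_iff).1 this
        exact .trans _ _ _ (ih (congrArg Sum.inr hab))
          (ih' (congrArg Sum.inr (hab.symm.trans (Sum.inr_injective h))))
  nn := by
    rintro (X | X)
    · exact (φ.nn X).trans (eq_sum_inl (α := x.N) (β := y.N)
        (inst := instFintypeN (x.toForest.mul y.toForest))
        (fun v => ite_eq_of_iff ⟨fun h => congrArg Sum.inl h, fun h => Sum.inl_injective h⟩)
        fun v => if_neg fun h => Sum.inr_ne_inl h)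
    · exact (ψ.nn X).trans (eq_sum_inr (α := x.N) (β := y.N)
        (inst := instFintypeN (x.toForest.mul y.toForest))
        (fun v => ite_eq_of_iff ⟨fun h => congrArg Sum.inr h, fun h => Sum.inr_injective h⟩)
        fun v => if_neg fun h => Sum.inl_ne_inr h)
  oo := by
    rintro (X | X)
    · refine (φ.oo X).trans (congrArg₂ (· + ·) (eq_sum_inl (α := x.N) (β := y.N)
        (inst := instFintypeN (x.toForest.mul y.toForest))
        (fun v => ite_eq_of_iff ⟨fun h => congrArg Sum.inl h, fun h => Sum.inl_injective h⟩)
        fun v => if_neg fun h => Sum.inr_ne_inl h)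
        (eq_sum_inl (α := x.E) (β := y.E)
          (inst := instFintypeE (x.toForest.mul y.toForest)) (fun a => ite_eq_of_iff
            (and_congr (not_congr ?_)
              ⟨fun h => congrArg Sum.inl h, fun h => Sum.inl_injective h⟩))
          fun a => if_neg fun h => Sum.inr_ne_inl h.2))
      constructor
      · rintro ⟨b, rfl⟩
        exact ⟨.inl b, rfl⟩
      · rintro ⟨b | b, hb⟩
        · exact ⟨b, Sum.inl_injective hb⟩
        · exact absurd hb Sum.inr_ne_inl
    · refine (ψ.oo X).trans (congrArg₂ (· + ·) (eq_sum_inr (α := x.N) (β := y.N)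
        (inst := instFintypeN (x.toForest.mul y.toForest))
        (fun v => ite_eq_of_iff ⟨fun h => congrArg Sum.inr h, fun h => Sum.inr_injective h⟩)
        fun v => if_neg fun h => Sum.inl_ne_inr h)
        (eq_sum_inr (α := x.E) (β := y.E)
          (inst := instFintypeE (x.toForest.mul y.toForest)) (fun a => ite_eq_of_iff
            (and_congr (not_congr ?_)
              ⟨fun h => congrArg Sum.inr h, fun h => Sum.inr_injective h⟩))
          fun a => if_neg fun h => Sum.inl_ne_inr h.2))
      constructor
      · rintro ⟨b, rfl⟩
        exact ⟨.inr b, rfl⟩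
      · rintro ⟨b | b, hb⟩
        · exact absurd hb Sum.inl_ne_inr
        · exact ⟨b, Sum.inr_injective hb⟩
  ee := by
    rintro (a | a)
    · exact φ.ee a
    · exact ψ.ee a

/-- The core of a product. -/
noncomputable def DForest.coreMul (i : ℕ) (x y : DForest d L) :
    DIso ((x.coreForest i).mul (y.coreForest i)) ((x.mul y).coreForest i) := by
  refine DIso.ofBijective
    (Sum.elim (fun v => ⟨.inl v.1, fun h => v.2 ((CForest.full_inl _).1 h)⟩)
      fun v => ⟨.inr v.1, fun h => v.2 ((CForest.full_inr _).1 h)⟩)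
    (Sum.elim (fun a => ⟨.inl a.1, fun h => a.2 ((CForest.full_inl _).1 h)⟩)
      fun a => ⟨.inr a.1, fun h => a.2 ((CForest.full_inr _).1 h)⟩) ⟨?_, ?_⟩ ⟨?_, ?_⟩
    ?_ ?_ ?_ ?_ ?_ ?_ ?_ ?_
  · rintro (v | v) (w | w) h
    · exact congrArg Sum.inl (Subtype.ext (Sum.inl_injective (congrArg Subtype.val h)))
    · cases congrArg Subtype.val h
    · cases congrArg Subtype.val h
    · exact congrArg Sum.inr (Subtype.ext (Sum.inr_injective (congrArg Subtype.val h)))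
  · rintro ⟨v | v, hv⟩
    · exact ⟨.inl ⟨v, fun h => hv ((CForest.full_inl _).2 h)⟩, rfl⟩
    · exact ⟨.inr ⟨v, fun h => hv ((CForest.full_inr _).2 h)⟩, rfl⟩
  · rintro (v | v) (w | w) h
    · exact congrArg Sum.inl (Subtype.ext (Sum.inl_injective (congrArg Subtype.val h)))
    · cases congrArg Subtype.val h
    · cases congrArg Subtype.val h
    · exact congrArg Sum.inr (Subtype.ext (Sum.inr_injective (congrArg Subtype.val h)))
  · rintro ⟨v | v, hv⟩
    · exact ⟨.inl ⟨v, fun h => hv ((CForest.full_inl _).2 h)⟩, rfl⟩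
    · exact ⟨.inr ⟨v, fun h => hv ((CForest.full_inr _).2 h)⟩, rfl⟩
  all_goals rintro (v | v) <;> rfl

theorem DForest.fullSum_mul (i : ℕ) (x y : DForest d L) :
    (x.mul y).fullSum i = x.fullSum i + y.fullSum i := by
  classical
  refine (sum_sum_eq (inst := instFintypeN (x.toForest.mul y.toForest)) (fun v : x.N ⊕ y.N =>
    if (x.mul y).Full i v then (Sum.elim x.nn y.nn v : Fin d → ℕ) else 0)).trans
      (congrArg₂ (· + ·) ?_ ?_)
  · exact Finset.sum_congr rfl fun v _ => ite_eq_of_iff (CForest.full_inl v)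
  · exact Finset.sum_congr rfl fun v _ => ite_eq_of_iff (CForest.full_inr v)

/-- The contraction of a product. -/
noncomputable def DForest.contractMul (x y : DForest d L) :
    DIso (x.mul y).contract (x.contract.mul y.contract).contract :=
  (x.toContract.mul y.toContract).contractIso

/-! ### The relation `Eqv` and its invariants -/

/-- Equality of the images under `𝒦_i`, in terms of representatives. -/
def Eqv (i : ℕ) (x y : DForest d L) : Prop :=
  Nonempty (DIso (x.coreForest i).contract (y.coreForest i).contract) ∧
    x.fullSum i = y.fullSum i

namespace Eqv

variable {i : ℕ} {x y z x' y' : DForest d L}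

theorem refl (x : DForest d L) : Eqv i x x := ⟨⟨DIso.refl _⟩, rfl⟩

theorem symm (h : Eqv i x y) : Eqv i y x := ⟨h.1.map DIso.symm, h.2.symm⟩

theorem trans (h : Eqv i x y) (h' : Eqv i y z) : Eqv i x z :=
  ⟨h.1.elim fun φ => h'.1.elim fun ψ => ⟨φ.trans ψ⟩, h.2.trans h'.2⟩

/-- The main source of equivalences: the contraction restricts to the cores, and `𝔫` is summed over
its fibres, each of which lies within one component. -/
theorem of_dContr (φ : DContr x y) : Eqv i x y := by
  classical
  refine ⟨⟨(φ.restr (φ.sharp_core i) fun X _ => φ.nn X).contractIso⟩, ?_⟩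
  change (∑ v : x.N, if x.Full i v then x.nn v else 0) =
    ∑ v : y.N, if y.Full i v then y.nn v else 0
  simp only [φ.nn]
  rw [φ.sum_fiber]
  exact Finset.sum_congr rfl fun v _ => ite_eq_of_iff (φ.full_iff v).symm

theorem of_dIso (φ : DIso x y) : Eqv i x y := of_dContr φ.toDContr

theorem mul (h : Eqv i x x') (h' : Eqv i y y') : Eqv i (x.mul y) (x'.mul y') := by
  obtain ⟨⟨φ⟩, h1⟩ := h
  obtain ⟨⟨ψ⟩, h2⟩ := h'
  refine ⟨⟨?_⟩, by rw [DForest.fullSum_mul, DForest.fullSum_mul, h1, h2]⟩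
  -- `contractMul` leaves one further contraction around the product of contracted cores. It occurs
  -- for both pairs, and the product isomorphism passes through it.
  have e : ∀ x y : DForest d L, DIso ((x.mul y).coreForest i).contract
      ((x.coreForest i).contract.mul (y.coreForest i).contract).contract := fun x y =>
    (x.coreMul i y).contract.symm.trans (DForest.contractMul _ _)
  exact (e x y).trans ((φ.mul ψ).contract.trans (e x' y').symm)

theorem ki (h : Eqv i x y) : DecForest.ki i ⟦x⟧ = DecForest.ki i ⟦y⟧ := by
  obtain ⟨⟨φ⟩, h1⟩ := h
  exact Quotient.sound (s := DForest.setoid d L) ⟨φ.mul (h1 ▸ DIso.refl _)⟩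

end Eqv

theorem DForest.allCol_dot (i : ℕ) (k : Fin d → ℕ) : (DForest.dot L i k).toCForest.AllCol i :=
  ⟨fun _ => rfl, fun a => Empty.elim a⟩

/-- The core of `𝒦_i x`. -/
noncomputable def DForest.coreKi (i : ℕ) (x : DForest d L) :
    DIso (x.coreForest i).contract ((x.ki i).coreForest i) := by
  have h : ∀ X : (x.coreForest i).contract.N, ¬ (x.ki i).Full i (.inl X) := by
    rintro ⟨v⟩ h
    exact CForest.not_full_restr_core v
      (((x.coreForest i).toCForest.toContract.full_iff v).1 ((CForest.full_inl _).1 h))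
  refine DIso.ofBijective (fun X => ⟨.inl X, h X⟩) (fun a => ⟨.inl a, h _⟩) ⟨?_, ?_⟩ ⟨?_, ?_⟩
    (fun _ => rfl) (fun _ => rfl) (fun _ => rfl) (fun _ => rfl) (fun _ => rfl) (fun _ => rfl)
    (fun _ => rfl) (fun _ => rfl)
  · exact fun v w h => Sum.inl_injective (congrArg Subtype.val h)
  · rintro ⟨v | v, hv⟩
    · exact ⟨v, rfl⟩
    · refine absurd ((CForest.full_inr _).2 ?_) hv
      exact (DForest.allCol_dot i _).full v
  · exact fun v w h => Sum.inl_injective (congrArg Subtype.val h)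
  · rintro ⟨v | v, hv⟩
    · exact ⟨v, rfl⟩
    · exact v.elim

theorem DForest.fullSum_ki (i : ℕ) (x : DForest d L) : (x.ki i).fullSum i = x.fullSum i := by
  classical
  refine (DForest.fullSum_mul i _ _).trans ?_
  have h : (x.coreForest i).contract.fullSum i = 0 := by
    refine Finset.sum_eq_zero fun X _ => if_neg fun h => ?_
    obtain ⟨v, rfl⟩ := Quot.mk_surjective X
    exact CForest.not_full_restr_core v
      (((x.coreForest i).toCForest.toContract.full_iff v).1 h)
  have h' : (DForest.dot L i (x.fullSum i)).fullSum i = x.fullSum i := by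
    rw [DForest.fullSum_of_allCol (DForest.allCol_dot i _)]
    refine (Finset.sum_const (s := Finset.univ) (x.fullSum i)).trans ?_
    have : (Finset.univ : Finset (DForest.dot L i (x.fullSum i)).N).card = 1 :=
      Finset.card_eq_one.2 ⟨(), Finset.ext fun v =>
        iff_of_true (Finset.mem_univ _) (Finset.mem_singleton.2 rfl)⟩
    exact (congrArg (· • x.fullSum i) this).trans (one_smul _ _)
  exact (congrArg₂ (· + ·) h h').trans (zero_add _)

/-- The two factors of `𝒦_i x` can be recovered from it: its core is the contracted core of `x`, and
its full part is the dot, which carries `x.fullSum i`. With `Eqv.ki`, this makes `Eqv` the kernel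
relation of `𝒦_i`. -/
theorem Eqv.of_ki {i : ℕ} {x y : DForest d L} (h : DecForest.ki i ⟦x⟧ = DecForest.ki i ⟦y⟧) :
    Eqv i x y := by
  obtain ⟨φ⟩ : Nonempty (DIso (x.ki i) (y.ki i)) := Quotient.exact (s := DForest.setoid d L) h
  refine ⟨⟨(x.coreKi i).trans ((φ.core i).trans (y.coreKi i).symm)⟩, ?_⟩
  rw [← DForest.fullSum_ki, φ.fullSum_eq i, DForest.fullSum_ki]

theorem DForest.deg_mul (x y : DForest d L) : (x.mul y).deg = x.deg + y.deg := by
  classical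
  rw [DForest.deg_eq, DForest.deg_eq, DForest.deg_eq]
  refine Prod.ext ?_ ?_
  · exact sum_sum_eq (inst := instFintypeE (x.toForest.mul y.toForest)) _
  · exact sum_sum_eq (inst := instFintypeE (x.toForest.mul y.toForest)) _

theorem DForest.deg_of_allCol {i : ℕ} (hi : 0 < i) {x : DForest d L}
    (h : x.toCForest.AllCol i) : x.deg = 0 := by
  classical
  rw [DForest.deg_eq]
  refine Prod.ext (Finset.sum_eq_zero fun a _ => ?_) (Finset.sum_eq_zero fun a _ => ?_)
  · rw [x.ee_supp a (by rw [h.2]; exact hi.ne')]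
    simp
  · rw [h.1, h.2, if_neg hi.ne', add_zero]

/-- The full part has bidegree zero because `i > 0`, and contraction preserves the bidegree of the
core. Hence `𝒦_i` never mixes bidegrees. -/
theorem Eqv.deg_eq {i : ℕ} (hi : 0 < i) {x y : DForest d L} (h : Eqv i x y) :
    x.deg = y.deg := by
  have e : ∀ x : DForest d L, x.deg = (x.coreForest i).contract.deg := fun x => by
    rw [← (x.decompose i).deg_eq, DForest.deg_mul,
      DForest.deg_of_allCol hi (x.allCol_fullForest i), zero_add]
    exact (x.coreForest i).toContract.deg_eq
  obtain ⟨⟨φ⟩, -⟩ := h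
  rw [e x, e y, φ.deg_eq]

/-- Both cores are empty, so only the total decoration survives `𝒦_i`; the number and the shape of
the components are forgotten. -/
theorem eqv_of_allCol {i : ℕ} {x y : DForest d L} (hx : x.toCForest.AllCol i)
    (hy : y.toCForest.AllCol i) (h : x.nTot = y.nTot) : Eqv i x y := by
  have hx' : IsEmpty (x.coreForest i).contract.N := ⟨by
    rintro ⟨v⟩
    exact v.2 (hx.full v.1)⟩
  have hy' : IsEmpty (y.coreForest i).contract.N := ⟨by
    rintro ⟨v⟩
    exact v.2 (hy.full v.1)⟩
  refine ⟨⟨?_⟩, by rw [DForest.fullSum_of_allCol hx, DForest.fullSum_of_allCol hy, h]⟩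
  exact
    { eN := Equiv.equivOfIsEmpty _ _
      eE := ⟨fun a => (hx'.false ((x.coreForest i).contract.src a)).elim,
        fun a => (hy'.false ((y.coreForest i).contract.src a)).elim,
        fun a => (hx'.false ((x.coreForest i).contract.src a)).elim,
        fun a => (hy'.false ((y.coreForest i).contract.src a)).elim⟩
      src := fun a => (hx'.false ((x.coreForest i).contract.src a)).elim
      tgt := fun a => (hx'.false ((x.coreForest i).contract.src a)).elim
      typ := fun a => (hx'.false ((x.coreForest i).contract.src a)).elim
      cN := fun v => hx'.elim v
      cE := fun a => (hx'.false ((x.coreForest i).contract.src a)).elim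
      nn := fun v => hx'.elim v
      oo := fun v => hx'.elim v
      ee := fun a => (hx'.false ((x.coreForest i).contract.src a)).elim }

/-- Associativity of the forest product. -/
def DForest.mulAssoc (x y z : DForest d L) : DIso ((x.mul y).mul z) (x.mul (y.mul z)) where
  eN := Equiv.sumAssoc _ _ _
  eE := Equiv.sumAssoc _ _ _
  src := by rintro ((a | a) | a) <;> rfl
  tgt := by rintro ((a | a) | a) <;> rfl
  typ := by rintro ((a | a) | a) <;> rfl
  cN := by rintro ((a | a) | a) <;> rfl
  cE := by rintro ((a | a) | a) <;> rfl
  nn := by rintro ((a | a) | a) <;> rfl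
  oo := by rintro ((a | a) | a) <;> rfl
  ee := by rintro ((a | a) | a) <;> rfl

/-- The empty forest is a right unit. -/
def DForest.mulEmpty (x : DForest d L) : DIso (x.mul (DForest.empty d L)) x where
  eN := Equiv.sumEmpty _ Empty
  eE := Equiv.sumEmpty _ Empty
  src := by rintro (a | a); exacts [rfl, a.elim]
  tgt := by rintro (a | a); exacts [rfl, a.elim]
  typ := by rintro (a | a); exacts [rfl, a.elim]
  cN := by rintro (a | a); exacts [rfl, a.elim]
  cE := by rintro (a | a); exacts [rfl, a.elim]
  nn := by rintro (a | a); exacts [rfl, a.elim]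
  oo := by rintro (a | a); exacts [rfl, a.elim]
  ee := by rintro (a | a); exacts [rfl, a.elim]

/-- The empty forest is a left unit. -/
def DForest.emptyMul (x : DForest d L) : DIso ((DForest.empty d L).mul x) x where
  eN := Equiv.emptySum Empty _
  eE := Equiv.emptySum Empty _
  src := by rintro (a | a); exacts [a.elim, rfl]
  tgt := by rintro (a | a); exacts [a.elim, rfl]
  typ := by rintro (a | a); exacts [a.elim, rfl]
  cN := by rintro (a | a); exacts [a.elim, rfl]
  cE := by rintro (a | a); exacts [a.elim, rfl]
  nn := by rintro (a | a); exacts [a.elim, rfl]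
  oo := by rintro (a | a); exacts [a.elim, rfl]
  ee := by rintro (a | a); exacts [a.elim, rfl]

theorem DForest.empty_allCol (d : ℕ) (L : Type) (i : ℕ) :
    (DForest.empty d L).toCForest.AllCol i := ⟨fun v => v.elim, fun a => a.elim⟩

theorem DForest.nTot_empty (d : ℕ) (L : Type) : (DForest.empty d L).nTot = 0 :=
  Finset.sum_eq_zero fun v _ => v.elim

theorem DForest.isUnit_iff {i : ℕ} (hi : 0 < i) {x : DForest d L} :
    x.IsUnit i ↔ x.toCForest.AllCol i ∧ x.nTot = 0 := by
  constructor
  · exact fun h => ⟨⟨fun v => (h.1 v).1, fun a => (h.2 a).1⟩,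
      Finset.sum_eq_zero fun v _ => (h.1 v).2⟩
  · rintro ⟨h, h0⟩
    refine ⟨fun v => ⟨h.1 v, ?_⟩, fun a => ⟨h.2 a, x.ee_supp a (by rw [h.2]; exact hi.ne')⟩⟩
    have : x.nn v ≤ x.nTot := Finset.single_le_sum (f := fun v => x.nn v)
      (fun _ _ => zero_le) (Finset.mem_univ v)
    rw [h0] at this
    exact le_antisymm this zero_le

/-- A node of `y` in a component that is not full would give a node of the contracted core of `x`,
which is empty. -/
theorem Eqv.allCol {i : ℕ} {x y : DForest d L} (h : Eqv i x y) (hx : x.toCForest.AllCol i) :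
    y.toCForest.AllCol i := by
  obtain ⟨⟨φ⟩, -⟩ := h
  have hy : ∀ v, y.Full i v := by
    intro v
    by_contra hv
    obtain ⟨w, -⟩ := Quot.mk_surjective (φ.eN.symm (Quot.mk _ ⟨v, hv⟩))
    exact w.2 (hx.full w.1)
  exact ⟨fun v => (hy v).1 v (.refl _), fun a => (hy _).2 a (.refl _)⟩

theorem Eqv.isUnit {i : ℕ} (hi : 0 < i) {x y : DForest d L} (h : Eqv i x y)
    (hx : x.IsUnit i) : y.IsUnit i := by
  rw [DForest.isUnit_iff hi] at hx ⊢
  refine ⟨h.allCol hx.1, ?_⟩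
  rw [← DForest.fullSum_of_allCol (h.allCol hx.1), ← h.2, DForest.fullSum_of_allCol hx.1, hx.2]

end HopfForest

/-! ## The set `𝔉_i` and the space `𝓗_i` -/

namespace HopfForest

variable {d : ℕ} {L : Type} {i : ℕ}

theorem Subforest.sum_inj {F G : Forest L} {C C' : Subforest F} {D D' : Subforest G}
    (h : Subforest.sum C D = Subforest.sum C' D') : C = C' ∧ D = D' := by
  have hN : (Sum.elim C.N D.N : F.N ⊕ G.N → Prop) = Sum.elim C'.N D'.N := congrArg Subforest.N h
  have hE : (Sum.elim C.E D.E : F.E ⊕ G.E → Prop) = Sum.elim C'.E D'.E := congrArg Subforest.E h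
  constructor
  · exact Subforest.ext (funext fun v => congrFun hN (.inl v))
      (funext fun v => congrFun hE (.inl v))
  · exact Subforest.ext (funext fun v => congrFun hN (.inr v))
      (funext fun v => congrFun hE (.inr v))

theorem Subforest.top_eq_sum (F G : Forest L) :
    (⊤ : Subforest (F.mul G)) = Subforest.sum ⊤ ⊤ := by
  ext (v | v) <;> exact Iff.rfl

theorem CForest.hat_mul (F G : CForest L) (i : ℕ) :
    (F.mul G).hat i = Subforest.sum (F.hat i) (G.hat i) := by
  ext (v | v) <;> exact Iff.rfl

namespace SubforestFamily

variable {𝔄 : SubforestFamily L i}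

theorem Good.of_iso {F G : CForest L} (φ : CIso F G) (h : 𝔄.Good F) : 𝔄.Good G := by
  refine ⟨⟨fun v => ?_, fun a => ?_⟩, ?_, ?_⟩
  · obtain ⟨v, rfl⟩ := φ.eN.surjective v
    rw [φ.cN]
    exact h.1.1 v
  · obtain ⟨a, rfl⟩ := φ.eE.surjective a
    rw [φ.cE]
    exact h.1.2 a
  · have := 𝔄.iso F G φ _ h.2.1
    rwa [show (⊤ : Subforest F.toForest).map φ = ⊤ from
      Subforest.ext (Set.image_univ_of_surjective φ.eN.surjective)
        (Set.image_univ_of_surjective φ.eE.surjective)] at this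
  · have := 𝔄.iso F G φ _ h.2.2
    rwa [show (F.hat i).map φ = G.hat i from ?_] at this
    ext v
    · obtain ⟨v, rfl⟩ := φ.eN.surjective v
      refine (φ.eN.injective.mem_set_image).trans ?_
      change F.cN v = i ↔ G.cN _ = i
      rw [φ.cN]
    · obtain ⟨v, rfl⟩ := φ.eE.surjective v
      refine (φ.eE.injective.mem_set_image).trans ?_
      change F.cE v = i ∧ _ ↔ G.cE _ = i ∧ _
      rw [φ.cE]

theorem good_mul_iff (hM : 𝔄.MulCoassoc) {F G : CForest L} :
    𝔄.Good (F.mul G) ↔ 𝔄.Good F ∧ 𝔄.Good G := by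
  have key : ∀ (C : Subforest F.toForest) (D : Subforest G.toForest),
      Subforest.sum C D ∈ 𝔄.adm (F.mul G) ↔ C ∈ 𝔄.adm F ∧ D ∈ 𝔄.adm G := by
    intro C D
    rw [hM.sum]
    constructor
    · rintro ⟨C', hC, D', hD, h⟩
      obtain ⟨rfl, rfl⟩ := Subforest.sum_inj h
      exact ⟨hC, hD⟩
    · exact fun h => ⟨C, h.1, D, h.2, rfl⟩
  have e1 := key ⊤ ⊤
  have e2 := key (F.hat i) (G.hat i)
  rw [← CForest.hat_mul] at e2
  have e0 : (F.mul G).ColLE i ↔ F.ColLE i ∧ G.ColLE i :=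
    ⟨fun h => ⟨⟨fun v => h.1 (.inl v), fun a => h.2 (.inl a)⟩,
      ⟨fun v => h.1 (.inr v), fun a => h.2 (.inr a)⟩⟩, fun h =>
      ⟨by rintro (v | v); exacts [h.1.1 v, h.2.1 v],
        by rintro (a | a); exacts [h.1.2 a, h.2.2 a]⟩⟩
  have e1' : (⊤ : Subforest (F.mul G).toForest) ∈ 𝔄.adm (F.mul G) ↔
      ⊤ ∈ 𝔄.adm F ∧ ⊤ ∈ 𝔄.adm G := by
    rw [← e1]
    exact iff_of_eq (congrArg (· ∈ 𝔄.adm (F.mul G)) (Subforest.top_eq_sum F.toForest G.toForest))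
  exact (and_congr e0 (and_congr e1' e2)).trans (by unfold Good; tauto)

/-- The bijection provides some admissible preimage of `F.sharp B`; as `sharp` is injective on all
subforests, that preimage is `B`. It remains to see that `⊤` and the colour-`i` part of the
contraction are sent to those of `F`. -/
theorem good_contract (hC : 𝔄.ContractionInvariant) {F : CForest L} (h : 𝔄.Good F) :
    𝔄.Good F.contract := by
  have key : ∀ B : Subforest F.contract.toForest,
      F.sharp B ∈ 𝔄.adm F → B ∈ 𝔄.adm F.contract := by
    intro B hB
    obtain ⟨B', hB', he⟩ := (hC F).surjOn hB
    suffices B' = B from this ▸ hB'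
    rw [← F.toContract_sharp, ← F.toContract_sharp] at he
    ext v
    · obtain ⟨v, rfl⟩ := Quot.mk_surjective v
      exact iff_of_eq (congrArg (fun A : Subforest F.toForest => v ∈ A.N) he)
    · rw [← F.toContract.gE_mem_sharp, he, F.toContract.gE_mem_sharp]
  refine ⟨⟨?_, fun _ => zero_le⟩, key _ ?_, key _ ?_⟩
  · rintro ⟨v⟩
    exact h.1.1 v
  · convert h.2.1
    ext v
    · exact iff_of_true trivial trivial
    · refine iff_of_true ?_ trivial
      by_cases hv : F.cE v = 0
      · exact Or.inr ⟨hv, trivial⟩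
      · exact Or.inl ⟨Quot.sound ⟨v, hv, rfl, rfl⟩, trivial⟩
  · convert h.2.2
    ext v
    · exact Iff.rfl
    · constructor
      · rintro (⟨h1, h2⟩ | ⟨h1, h2, h3⟩)
        · have hc : F.cE v ≠ 0 := fun h0 => F.mk_src_ne h0 h1
          have h2 : F.cN (F.src v) = i := h2
          exact ⟨(F.col v hc).1 ▸ h2, 𝔄.pos.ne'⟩
        · exact absurd h2.symm h3
      · rintro ⟨h1, h2⟩
        have hc : F.cE v ≠ 0 := h1 ▸ h2
        exact Or.inl ⟨Quot.sound ⟨v, hc, rfl, rfl⟩, (F.col v hc).1.trans h1⟩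

theorem good_left (hU : 𝔄.Counital) {x : DForest d L} (h : 𝔄.Good x.toCForest) (p : Cut 𝔄 x) :
    𝔄.Good p.left.toCForest :=
  ⟨⟨fun v => h.1.1 v.1, fun a => h.1.2 a.1⟩, hU.restr x.toCForest h.2.2 p.A p.mem⟩

theorem hat_cup (F : CForest L) (A : Subforest F.toForest) (hA : Compat i F A) (hi : 0 < i) :
    (F.cup i A hA).hat i = A := by
  classical
  ext v
  · change (if v ∈ A.N then i else F.cN v) = i ↔ v ∈ A.N
    split_ifs with h
    · exact iff_of_true rfl h
    · exact iff_of_false (fun h' => h (hA.hat_le.1 h')) h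
  · change ((if v ∈ A.E then i else F.cE v) = i ∧ i ≠ 0) ↔ v ∈ A.E
    split_ifs with h
    · exact iff_of_true ⟨rfl, hi.ne'⟩ h
    · exact iff_of_false (fun h' => h (hA.hat_le.2 h')) h

theorem good_right (hU : 𝔄.Counital) {x : DForest d L} (h : 𝔄.Good x.toCForest)
    (p : Cut 𝔄 x) : 𝔄.Good p.right.toCForest := by
  classical
  have h1 := hU.cup x.toCForest h.2.2 h.1 p.A p.mem
  refine ⟨⟨fun v => ?_, fun a => ?_⟩, h1.1, ?_⟩
  · change (if v ∈ p.A.N then i else x.cN v) ≤ i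
    split_ifs
    · exact le_rfl
    · exact h.1.1 v
  · change (if a ∈ p.A.E then i else x.cE a) ≤ i
    split_ifs
    · exact le_rfl
    · exact h.1.2 a
  · exact (iff_of_eq (congrArg (· ∈ 𝔄.adm (x.cup i p.A (𝔄.compat _ _ p.mem)))
      (hat_cup x.toCForest p.A (𝔄.compat _ _ p.mem) 𝔄.pos))).2 h1.2

theorem good_full_core (hM : 𝔄.MulCoassoc) {x : DForest d L} (h : 𝔄.Good x.toCForest) :
    𝔄.Good (x.fullForest i).toCForest ∧ 𝔄.Good (x.coreForest i).toCForest :=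
  (good_mul_iff hM).1 (h.of_iso (x.decompose i).symm.toCIso)

theorem mem_goodSet {x : DForest d L} : (⟦x⟧ : DecForest d L) ∈ 𝔄.goodSet d ↔
    𝔄.Good x.toCForest := by
  constructor
  · rintro ⟨y, hy, hg⟩
    obtain ⟨φ⟩ := Quotient.exact (s := DForest.setoid d L) hy
    exact hg.of_iso φ.toCIso
  · exact fun h => ⟨x, rfl, h⟩

theorem cls_of_not_good {x : DForest d L} (h : ¬ 𝔄.Good x.toCForest) : 𝔄.cls x = 0 := by
  refine Subtype.ext (funext fun n => ?_)
  have : (spnBasis (𝔄.goodSet d) ⟦x⟧).1 n = 0 := dif_neg fun h' => h (mem_goodSet.1 h'.1)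
  exact (congrArg (Submodule.mkQ _) this).trans (map_zero (Submodule.mkQ _))

theorem cls_apply {x : DForest d L} (h : 𝔄.Good x.toCForest) :
    (𝔄.cls x).1 x.deg = Submodule.Quotient.mk
      (Finsupp.single ⟨⟦x⟧, mem_goodSet.2 h, rfl⟩ (1 : ℝ)) :=
  congrArg (Submodule.Quotient.mk) (dif_pos (show (⟦x⟧ : DecForest d L) ∈ 𝔄.goodSet d ∧
    DecForest.deg ⟦x⟧ = x.deg from ⟨mem_goodSet.2 h, rfl⟩))

theorem cls_apply_of_ne {x : DForest d L} {n : ℕ × ℕ} (h : n ≠ x.deg) : (𝔄.cls x).1 n = 0 := by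
  have : (spnBasis (𝔄.goodSet d) ⟦x⟧).1 n = 0 := dif_neg fun h' => h h'.2.symm
  exact (congrArg (Submodule.mkQ _) this).trans (map_zero (Submodule.mkQ _))

theorem suppGE_cls (x : DForest d L) : SuppGE x.deg (𝔄.cls x) := fun n hn =>
  cls_apply_of_ne (by
    rintro rfl
    exact hn (DegGE.refl _))

theorem cls_eq_single (x : DForest d L) :
    𝔄.cls x = single (V := 𝔄.hopfSpace d) x.deg ((𝔄.cls x).1 x.deg) := by
  refine Subtype.ext (funext fun n => ?_)
  by_cases h : n = x.deg
  · subst h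
    exact (single_same (V := 𝔄.hopfSpace d) _ _).symm
  · rw [cls_apply_of_ne h, single_ne h]

theorem cls_eq {x y : DForest d L} (hx : 𝔄.Good x.toCForest) (hy : 𝔄.Good y.toCForest)
    (h : Eqv i x y) : 𝔄.cls x = 𝔄.cls y := by
  have hd := h.deg_eq 𝔄.pos
  refine Subtype.ext (funext fun n => ?_)
  by_cases hn : n = x.deg
  · subst hn
    have e1 : (spnBasis (𝔄.goodSet d) ⟦x⟧).1 x.deg =
        Finsupp.single ⟨⟦x⟧, mem_goodSet.2 hx, rfl⟩ (1 : ℝ) :=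
      dif_pos (show (⟦x⟧ : DecForest d L) ∈ 𝔄.goodSet d ∧
        DecForest.deg ⟦x⟧ = x.deg from ⟨mem_goodSet.2 hx, rfl⟩)
    have e2 : (spnBasis (𝔄.goodSet d) ⟦y⟧).1 x.deg =
        Finsupp.single ⟨⟦y⟧, mem_goodSet.2 hy, hd.symm⟩ (1 : ℝ) :=
      dif_pos (show (⟦y⟧ : DecForest d L) ∈ 𝔄.goodSet d ∧
        DecForest.deg ⟦y⟧ = x.deg from ⟨mem_goodSet.2 hy, hd.symm⟩)
    refine (Submodule.Quotient.eq _).2 ?_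
    rw [e1, e2, LinearMap.mem_ker, map_sub]
    simp only [kiLin, Finsupp.lmapDomain_apply, Finsupp.mapDomain_single]
    rw [h.ki, sub_self]
  · rw [cls_apply_of_ne hn, cls_apply_of_ne (hd ▸ hn)]

/-! ### Linear and triangular maps out of the quotient -/

/-- A function on decorated forests that depends only on the image under `𝒦_i` for elements of
`𝔉_i`. -/
def Inv (𝔄 : SubforestFamily L i) {M : Type*} (f : DForest d L → M) : Prop :=
  ∀ x y, 𝔄.Good x.toCForest → 𝔄.Good y.toCForest → Eqv i x y → f x = f y

variable (𝔄) in
open Classical in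
/-- The linear map on a component of `𝓗_i` defined by an invariant function on `𝔉_i`. -/
noncomputable def liftLin {M : Type*} [AddCommGroup M] [Module ℝ M] (n : ℕ × ℕ)
    (f : DForest d L → M) : (𝔄.hopfSpace d).V n →ₗ[ℝ] M :=
  -- The value `0` for functions that are not invariant makes this total, so that it can be nested
  -- in `liftTri₂`, where the inner function is invariant for good `x` only.
  if h : 𝔄.Inv f then
    Submodule.liftQ _ (Finsupp.linearCombination ℝ
      fun τ : {τ : DecForest d L // τ ∈ 𝔄.goodSet d ∧ τ.deg = n} => f (Classical.choose τ.2.1)) (by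
      let g := fun τ : {τ : DecForest d L // τ ∈ 𝔄.goodSet d ∧ τ.deg = n} => DecForest.ki i τ.1
      let F := fun τ : {τ : DecForest d L // τ ∈ 𝔄.goodSet d ∧ τ.deg = n} =>
        f (Classical.choose τ.2.1)
      -- An invariant function factors through `𝒦_i`; its linear extension then factors through that
      -- of `𝒦_i` and kills the kernel.
      have hF : F.FactorsThrough g := by
        intro σ τ hστ
        obtain ⟨h1, h1'⟩ := Classical.choose_spec σ.2.1
        obtain ⟨h2, h2'⟩ := Classical.choose_spec τ.2.1
        refine h _ _ h1' h2' (Eqv.of_ki ?_)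
        rw [h1, h2]
        exact hστ
      intro v hv
      have hv : Finsupp.mapDomain g v = 0 := hv
      rw [LinearMap.mem_ker]
      change Finsupp.linearCombination ℝ F v = 0
      have hF' : Function.extend g F (fun _ => 0) ∘ g = F := hF.extend_comp _
      rw [← hF', ← Finsupp.linearCombination_mapDomain, hv, map_zero])
  else 0

theorem liftLin_cls {M : Type*} [AddCommGroup M] [Module ℝ M] {n : ℕ × ℕ} {f : DForest d L → M}
    (hf : 𝔄.Inv f) {x : DForest d L} (hx : 𝔄.Good x.toCForest) (hn : x.deg = n) :
    𝔄.liftLin n f ((𝔄.cls x).1 n) = f x := by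
  subst hn
  rw [liftLin, dif_pos hf, cls_apply hx]
  refine (Submodule.liftQ_apply _ _ _).trans ?_
  rw [Finsupp.linearCombination_single, one_smul]
  obtain ⟨h1, h1'⟩ := Classical.choose_spec (mem_goodSet.2 hx)
  obtain ⟨φ⟩ := Quotient.exact (s := DForest.setoid d L) h1
  exact hf _ _ h1' hx (Eqv.of_dIso φ)

theorem span_cls (n : ℕ × ℕ) (w : (𝔄.hopfSpace d).V n) : w ∈ Submodule.span ℝ
    {w | ∃ x : DForest d L, 𝔄.Good x.toCForest ∧ x.deg = n ∧ (𝔄.cls x).1 n = w} := by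
  obtain ⟨v, rfl⟩ := Submodule.Quotient.mk_surjective _ w
  induction v using Finsupp.induction_linear with
  | zero => exact Submodule.zero_mem _
  | add v w hv hw => exact Submodule.add_mem _ hv hw
  | single τ c =>
    obtain ⟨τ, ⟨x, rfl, hx⟩, hn⟩ := τ
    change x.deg = n at hn
    subst hn
    let σ : {τ : DecForest d L // τ ∈ 𝔄.goodSet d ∧ τ.deg = x.deg} := ⟨⟦x⟧, mem_goodSet.2 hx, rfl⟩
    have h1 : Finsupp.single σ c = c • Finsupp.single σ (1 : ℝ) := by
      rw [Finsupp.smul_single, smul_eq_mul, mul_one]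
    have h2 : Submodule.mkQ (LinearMap.ker (kiLin i (𝔄.goodSet d) x.deg)) (Finsupp.single σ c) =
        c • (𝔄.cls x).1 x.deg := by
      rw [cls_apply hx, h1, map_smul]
      rfl
    have h3 : c • (𝔄.cls x).1 x.deg ∈ Submodule.span ℝ
        {w | ∃ y : DForest d L, 𝔄.Good y.toCForest ∧ y.deg = x.deg ∧ (𝔄.cls y).1 x.deg = w} :=
      Submodule.smul_mem _ _ (Submodule.subset_span ⟨x, hx, rfl, rfl⟩)
    rw [← h2] at h3
    exact h3

theorem hom_ext {M : Type*} [AddCommGroup M] [Module ℝ M] {n : ℕ × ℕ}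
    {f g : (𝔄.hopfSpace d).V n →ₗ[ℝ] M}
    (h : ∀ x : DForest d L, 𝔄.Good x.toCForest → x.deg = n →
      f ((𝔄.cls x).1 n) = g ((𝔄.cls x).1 n)) : f = g := by
  refine LinearMap.ext fun w => LinearMap.eqOn_span ?_ (span_cls n w)
  rintro _ ⟨x, hx, hn, rfl⟩
  exact h x hx hn

theorem gen_cls : Gen {v | ∃ x : DForest d L, 𝔄.Good x.toCForest ∧ 𝔄.cls x = v} := by
  intro n w
  have h := Submodule.mem_map_of_mem (f := single (V := 𝔄.hopfSpace d) n) (span_cls n w)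
  rw [Submodule.map_span] at h
  refine Submodule.span_mono ?_ h
  rintro _ ⟨_, ⟨x, hx, rfl, rfl⟩, rfl⟩
  exact ⟨x, hx, cls_eq_single x⟩

universe u

variable (𝔄) in
/-- The triangular map on `𝓗_i` with given values on the elements of `𝔉_i`. -/
noncomputable def liftTri {W : BiSpace.{u}} (f : DForest d L → Tot W) (hf : 𝔄.Inv f)
    (hdeg : ∀ x, 𝔄.Good x.toCForest → SuppGE x.deg (f x)) : Tri (𝔄.hopfSpace d) W where
  mat b n := 𝔄.liftLin n fun x => (f x).1 b
  tri b n h := hom_ext fun x hx hn => by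
    rw [liftLin_cls (fun x y hx hy h => congrArg (fun v : Tot W => v.1 b) (hf x y hx hy h)) hx hn,
      hdeg x hx b (by rwa [hn])]
    rfl

theorem liftTri_cls {W : BiSpace.{u}} {f : DForest d L → Tot W} (hf : 𝔄.Inv f)
    (hdeg : ∀ x, 𝔄.Good x.toCForest → SuppGE x.deg (f x)) {x : DForest d L}
    (hx : 𝔄.Good x.toCForest) : (𝔄.liftTri f hf hdeg).toLin (𝔄.cls x) = f x := by
  refine Subtype.ext (funext fun b => ?_)
  rw [cls_eq_single, Tri.toLin_single]
  exact liftLin_cls (f := fun x => (f x).1 b) (fun x y hx hy h =>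
    congrArg (fun v : Tot W => v.1 b) (hf x y hx hy h)) hx rfl

variable (𝔄) in
/-- The triangular map on `𝓗_i ⊗̂ 𝓗_i` with given values on pairs of elements of `𝔉_i`. -/
noncomputable def liftTri₂ {W : BiSpace.{u}} (f : DForest d L → DForest d L → Tot W)
    (hf : ∀ x x' y y', 𝔄.Good x.toCForest → 𝔄.Good x'.toCForest → 𝔄.Good y.toCForest →
      𝔄.Good y'.toCForest → Eqv i x x' → Eqv i y y' → f x y = f x' y')
    (hdeg : ∀ x y, 𝔄.Good x.toCForest → 𝔄.Good y.toCForest → SuppGE (x.deg + y.deg) (f x y)) :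
    Tri ((𝔄.hopfSpace d).tens (𝔄.hopfSpace d)) W where
  mat b n := TensorProduct.lift (𝔄.liftLin n.1 fun x => 𝔄.liftLin n.2 fun y => (f x y).1 b)
  tri b n h := by
    refine TensorProduct.ext (hom_ext fun x hx hn => hom_ext fun y hy hm => ?_)
    have h1 : ∀ x, 𝔄.Good x.toCForest → 𝔄.Inv fun y => (f x y).1 b := fun x hx y y' hy hy' h =>
      congrArg (fun v : Tot W => v.1 b) (hf x x y y' hx hx hy hy' (Eqv.refl x) h)
    change TensorProduct.lift _ ((𝔄.cls x).1 n.1 ⊗ₜ[ℝ] (𝔄.cls y).1 n.2) = 0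
    rw [TensorProduct.lift.tmul, liftLin_cls (fun x x' hx hx' h => hom_ext fun y hy hm => ?_) hx hn,
      liftLin_cls (h1 x hx) hy hm, hdeg x y hx hy b]
    · rw [hn, hm]
      exact h
    · rw [liftLin_cls (h1 x hx) hy hm, liftLin_cls (h1 x' hx') hy hm,
        hf x x' y y hx hx' hy hy h (Eqv.refl y)]

theorem liftTri₂_cls {W : BiSpace.{u}} {f : DForest d L → DForest d L → Tot W}
    (hf : ∀ x x' y y', 𝔄.Good x.toCForest → 𝔄.Good x'.toCForest → 𝔄.Good y.toCForest →
      𝔄.Good y'.toCForest → Eqv i x x' → Eqv i y y' → f x y = f x' y')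
    (hdeg : ∀ x y, 𝔄.Good x.toCForest → 𝔄.Good y.toCForest → SuppGE (x.deg + y.deg) (f x y))
    {x y : DForest d L} (hx : 𝔄.Good x.toCForest) (hy : 𝔄.Good y.toCForest) :
    (𝔄.liftTri₂ f hf hdeg).toLin (tmul (𝔄.cls x) (𝔄.cls y)) = f x y := by
  refine Subtype.ext (funext fun b => ?_)
  have h1 : ∀ x, 𝔄.Good x.toCForest → 𝔄.Inv fun y => (f x y).1 b := fun x hx y y' hy hy' h =>
    congrArg (fun v : Tot W => v.1 b) (hf x x y y' hx hx hy hy' (Eqv.refl x) h)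
  rw [cls_eq_single x, cls_eq_single y, tmul_single, Tri.toLin_single]
  change TensorProduct.lift _ ((𝔄.cls x).1 x.deg ⊗ₜ[ℝ] (𝔄.cls y).1 y.deg) = _
  rw [TensorProduct.lift.tmul, liftLin_cls (fun x x' hx hx' h => hom_ext fun y hy hm => ?_) hx rfl,
    liftLin_cls (h1 x hx) hy rfl]
  rw [liftLin_cls (h1 x hx) hy hm, liftLin_cls (h1 x' hx') hy hm,
    hf x x' y y hx hx' hy hy h (Eqv.refl y)]

variable (d) in
/-- The product of `𝓗_i`. -/
noncomputable def mulTri (hM : 𝔄.MulCoassoc) :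
    Tri ((𝔄.hopfSpace d).tens (𝔄.hopfSpace d)) (𝔄.hopfSpace d) :=
  𝔄.liftTri₂ (fun x y => 𝔄.cls (x.mul y))
    (fun _ _ _ _ hx hx' hy hy' h h' => cls_eq ((good_mul_iff hM).2 ⟨hx, hy⟩)
      ((good_mul_iff hM).2 ⟨hx', hy'⟩) (h.mul h'))
    fun x y _ _ => by
      rw [← DForest.deg_mul]
      exact suppGE_cls _

theorem mulTri_cls' (hM : 𝔄.MulCoassoc) {x y : DForest d L} (hx : 𝔄.Good x.toCForest)
    (hy : 𝔄.Good y.toCForest) :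
    (mulTri d hM).toLin (tmul (𝔄.cls x) (𝔄.cls y)) = 𝔄.cls (x.mul y) := liftTri₂_cls _ _ hx hy

/-- Goodness can be dropped: a product is good only if both factors are, and the class of a forest
that is not good is zero, so otherwise both sides vanish. -/
theorem mulTri_cls (hM : 𝔄.MulCoassoc) (x y : DForest d L) :
    (mulTri d hM).toLin (tmul (𝔄.cls x) (𝔄.cls y)) = 𝔄.cls (x.mul y) := by
  by_cases hx : 𝔄.Good x.toCForest
  · by_cases hy : 𝔄.Good y.toCForest
    · exact mulTri_cls' hM hx hy
    · rw [cls_of_not_good hy, tmul_zero_right, map_zero,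
        cls_of_not_good fun h => hy ((good_mul_iff hM).1 h).2]
  · rw [cls_of_not_good hx, tmul_zero_left, map_zero,
      cls_of_not_good fun h => hx ((good_mul_iff hM).1 h).1]

open Classical in
variable (𝔄 d) in
/-- The counit of `𝓗_i`. -/
noncomputable def counitTri : Tri (𝔄.hopfSpace d) one :=
  𝔄.liftTri (fun x => if x.IsUnit i then oneElt else 0)
    (fun _ _ _ _ h => ite_eq_of_iff ⟨h.isUnit 𝔄.pos, h.symm.isUnit 𝔄.pos⟩)
    fun x _ => by
      split_ifs with h
      · rw [DForest.deg_of_allCol 𝔄.pos ((DForest.isUnit_iff 𝔄.pos).1 h).1]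
        exact fun a ha => absurd (DegGE.refl _) ha
      · exact SuppGE.zero _

open Classical in
theorem counitTri_cls {x : DForest d L} (hx : 𝔄.Good x.toCForest) :
    (𝔄.counitTri d).toLin (𝔄.cls x) = if x.IsUnit i then oneElt else 0 := liftTri_cls _ _ hx

variable (𝔄 d) in
/-- The unit of `𝓗_i`. -/
noncomputable def unitTri : Tri one (𝔄.hopfSpace d) where
  mat b _ := LinearMap.toSpanSingleton ℝ _ ((𝔄.cls (DForest.empty d L)).1 b)
  tri b _ h := by
    have h0 : (DForest.empty d L).deg = 0 :=
      DForest.deg_of_allCol 𝔄.pos (DForest.empty_allCol d L i)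
    have h1 : (𝔄.cls (DForest.empty d L)).1 b = 0 := suppGE_cls _ b (by rwa [h0])
    rw [h1, LinearMap.toSpanSingleton_zero]

theorem unitTri_one : (𝔄.unitTri d).toLin oneElt = 𝔄.cls (DForest.empty d L) := by
  refine Subtype.ext (funext fun b => ?_)
  change ∑ᶠ a : Unit, (𝔄.unitTri d).mat b a (1 : ℝ) = _
  rw [finsum_eq_single _ () fun a h => absurd rfl h]
  exact one_smul ℝ _

/-- All units are equivalent to the empty forest. This is why the right factor of the leading term
of a coproduct acts as `1`. -/
theorem cls_of_isUnit {x : DForest d L} (he : 𝔄.Good (CForest.empty L))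
    (hx : 𝔄.Good x.toCForest) (h : x.IsUnit i) :
    𝔄.cls x = 𝔄.cls (DForest.empty d L) := by
  obtain ⟨h1, h2⟩ := (DForest.isUnit_iff 𝔄.pos).1 h
  exact cls_eq hx he (eqv_of_allCol h1 (DForest.empty_allCol d L i)
    (h2.trans (DForest.nTot_empty d L).symm))

end SubforestFamily

end HopfForest

/-! ## Sums of binomial coefficients -/

namespace HopfForest

section Vandermonde

open MvPolynomial

variable {I J : Type*} [Fintype I]

/-- A generating function with one variable for each fibre of `f`: the exponent of a monomial
records the sums of `m` over the fibres. -/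
theorem prod_one_add_X_pow [DecidableEq I] (f : I → J) (N : I → ℕ) :
    ∏ v, ((X (f v) + 1 : MvPolynomial J ℕ) ^ N v) =
      ∑ m ∈ Fintype.piFinset fun v => Finset.range (N v + 1),
        monomial (∑ v, Finsupp.single (f v) (m v)) (∏ v, (N v).choose (m v)) := by
  have h : ∀ v, (X (f v) + 1 : MvPolynomial J ℕ) ^ N v =
      ∑ k ∈ Finset.range (N v + 1), monomial (Finsupp.single (f v) k) ((N v).choose k) := by
    intro v
    rw [add_pow]
    refine Finset.sum_congr rfl fun k _ => ?_
    rw [one_pow, mul_one, X_pow_eq_monomial, ← C_eq_coe_nat, mul_comm, C_mul_monomial, mul_one,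
      Nat.cast_id]
  rw [Finset.prod_congr rfl fun v _ => h v, Finset.prod_univ_sum]
  refine Finset.sum_congr rfl fun m _ => ?_
  induction (Finset.univ : Finset I) using Finset.induction_on with
  | empty => simp
  | insert v s hv ih => rw [Finset.prod_insert hv, ih, monomial_mul, Finset.sum_insert hv,
      Finset.prod_insert hv]

theorem sum_single_apply [DecidableEq J] (f : I → J) (m : I → ℕ) (X : J) :
    (∑ v, Finsupp.single (f v) (m v)) X = ∑ v, if f v = X then m v else 0 := by
  rw [Finsupp.finsetSum_apply]
  exact Finset.sum_congr rfl fun v _ => Finsupp.single_apply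

theorem mem_piFinset_range {I : Type*} [Fintype I] [DecidableEq I] {N m : I → ℕ} :
    m ∈ Fintype.piFinset (fun v => Finset.range (N v + 1)) ↔ m ≤ N := by
  simp [Fintype.mem_piFinset, Pi.le_def]

theorem coeff_prod_one_add_X_pow [Fintype J] [DecidableEq I] [DecidableEq J] (f : I → J) (N : I → ℕ) (M : J → ℕ) :
    coeff (Finsupp.equivFunOnFinite.symm M) (∏ v, ((X (f v) + 1 : MvPolynomial J ℕ) ^ N v)) =
      ∑ m ∈ (Fintype.piFinset fun v => Finset.range (N v + 1)).filter
        (fun m => ∀ X, (∑ v, if f v = X then m v else 0) = M X), ∏ v, (N v).choose (m v) := by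
  rw [prod_one_add_X_pow, coeff_sum, Finset.sum_filter]
  refine Finset.sum_congr rfl fun m _ => ?_
  rw [coeff_monomial]
  refine ite_eq_of_iff ?_
  rw [DFunLike.ext_iff]
  exact forall_congr' fun X => by rw [sum_single_apply]; rfl

/-- Vandermonde's identity along the fibres of a map. -/
theorem vandermonde_fiber [Fintype J] [DecidableEq I] [DecidableEq J] (f : I → J) (N : I → ℕ) (M : J → ℕ) :
    ∑ m ∈ (Fintype.piFinset fun v => Finset.range (N v + 1)).filter
        (fun m => ∀ X, (∑ v, if f v = X then m v else 0) = M X), ∏ v, (N v).choose (m v) =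
      ∏ X, (∑ v, if f v = X then N v else 0).choose (M X) := by
  rw [← coeff_prod_one_add_X_pow]
  -- Powers with the same base are collected. The identity then compares one coefficient of this
  -- polynomial in its expansions for `f` and for the identity map of `J`.
  have h : ∏ v, ((X (f v) + 1 : MvPolynomial J ℕ) ^ N v) =
      ∏ Y, ((X (id Y) + 1 : MvPolynomial J ℕ) ^ (∑ v, if f v = Y then N v else 0)) := by
    rw [← Finset.prod_fiberwise_of_maps_to (g := f) (t := Finset.univ)
      fun v _ => Finset.mem_univ _]
    refine Finset.prod_congr rfl fun Y _ => ?_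
    rw [← Finset.sum_filter, ← Finset.prod_pow_eq_pow_sum]
    refine Finset.prod_congr rfl fun v hv => ?_
    rw [(Finset.mem_filter.1 hv).2, id]
  rw [h, coeff_prod_one_add_X_pow]
  -- For the identity map the fibre condition leaves only `m = M`. If this is out of range, the sum
  -- is empty and one of the binomials on the right is zero.
  by_cases hM : M ≤ fun Y => ∑ v, if f v = Y then N v else 0
  · rw [Finset.sum_eq_single M]
    · intro m hm hne
      refine absurd (funext fun Y => ?_) hne
      rw [← (Finset.mem_filter.1 hm).2 Y]
      simp
    · intro h
      refine absurd (Finset.mem_filter.2 ⟨mem_piFinset_range.2 hM, fun Y => ?_⟩) h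
      simp
  · rw [Finset.sum_eq_zero]
    · rw [Pi.le_def, not_forall] at hM
      obtain ⟨Y, hY⟩ := hM
      exact (Finset.prod_eq_zero (Finset.mem_univ Y)
        (Nat.choose_eq_zero_of_lt (not_le.1 hY))).symm
    · intro m hm
      refine absurd ?_ hM
      obtain ⟨h1, h2⟩ := Finset.mem_filter.1 hm
      have : m = M := funext fun Y => by
        rw [← h2 Y]
        simp
      exact this ▸ mem_piFinset_range.1 h1

open Classical in
/-- Vandermonde's identity along the fibres of a map, for decorations. -/
theorem finsum_choose_fiber {I J : Type*} [Fintype I] [Fintype J] {d : ℕ} (f : I → J)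
    (N : I → Fin d → ℕ) (M : J → Fin d → ℕ) :
    ∑ᶠ m ∈ {m : I → Fin d → ℕ | m ≤ N ∧ ∀ X, (∑ v, if f v = X then m v else 0) = M X},
        ∏ v, ∏ j, ((N v j).choose (m v j) : ℝ) =
      ∏ X, ∏ j, (((∑ v, if f v = X then N v else 0) j).choose (M X j) : ℝ) := by
  -- The coordinates of the decorations are independent, so the scalar identity is applied to pairs
  -- of a point and a coordinate.
  have h := vandermonde_fiber (Prod.map f id : I × Fin d → J × Fin d) (Function.uncurry N)
    (Function.uncurry M)
  have hs : ∀ (m : I → Fin d → ℕ) (X : J) (j : Fin d),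
      (∑ v : I × Fin d, if Prod.map f id v = (X, j) then Function.uncurry m v else 0) =
        (∑ v, if f v = X then m v else 0) j := by
    intro m X j
    rw [Fintype.sum_prod_type, Finset.sum_apply]
    refine Finset.sum_congr rfl fun v _ => ?_
    rw [Finset.sum_eq_single j]
    · by_cases hv : f v = X
      · rw [if_pos hv, if_pos (by rw [Prod.map_apply, hv]; rfl)]
        rfl
      · rw [if_neg hv, if_neg fun h => hv (congrArg Prod.fst h)]
        rfl
    · exact fun k _ hk => if_neg fun h => hk (congrArg Prod.snd h)
    · exact fun h => absurd (Finset.mem_univ _) h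
  have h2 : ∏ X : J × Fin d, (∑ v, if Prod.map f id v = X then Function.uncurry N v else 0).choose
      (Function.uncurry M X) = ∏ X, ∏ j, ((∑ v, if f v = X then N v else 0) j).choose (M X j) := by
    rw [Fintype.prod_prod_type]
    exact Finset.prod_congr rfl fun X _ => Finset.prod_congr rfl fun j _ => by rw [hs]; rfl
  rw [h2] at h
  have h3 := congrArg (fun n : ℕ => (n : ℝ)) h
  simp only [Nat.cast_prod, Nat.cast_sum] at h3
  rw [← h3, ← finsum_mem_coe_finset]
  refine finsum_mem_eq_of_bijOn Function.uncurry ⟨?_, ?_, ?_⟩ ?_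
  · rintro m ⟨h1, h2⟩
    refine Finset.mem_coe.2 (Finset.mem_filter.2 ⟨mem_piFinset_range.2 fun v => h1 v.1 v.2, ?_⟩)
    rintro ⟨X, j⟩
    rw [hs, h2]
    rfl
  · intro m _ m' _ h
    exact funext fun v => funext fun j => congrFun h (v, j)
  · intro m hm
    obtain ⟨h1, h2⟩ := Finset.mem_filter.1 (Finset.mem_coe.1 hm)
    refine ⟨Function.curry m, ⟨fun v j => mem_piFinset_range.1 h1 (v, j), fun X => ?_⟩,
      Function.uncurry_curry m⟩
    funext j
    rw [← hs, Function.uncurry_curry, h2]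
    rfl
  · intro m _
    rw [Fintype.prod_prod_type]
    rfl

end Vandermonde

/-! ## The terms of the coproduct -/

variable {d : ℕ} {L : Type} {i : ℕ}

namespace Cut

variable {𝔄 : SubforestFamily L i} {x : DForest d L}

theorem ext_of {p q : Cut 𝔄 x} (hA : p.A = q.A) (hn : p.nA = q.nA) (he : p.eps = q.eps) :
    p = q := by
  cases p
  cases q
  cases hA
  cases hn
  cases he
  rfl

/-- The total degree of `ε`. -/
noncomputable def epsTot (p : Cut 𝔄 x) : ℕ := ∑ a, ∑ j, p.eps a j

theorem deg_left (p : Cut 𝔄 x) [DecidablePred (· ∈ p.A.E)] : p.left.deg =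
    (∑ a, if a ∈ p.A.E then ∑ j, x.ee a j else 0, ∑ a, if a ∈ p.A.E then
      ((if x.cE a = 0 then 1 else 0) + if x.cN (x.tgt a) = 0 then 1 else 0) else 0) := by
  classical
  rw [DForest.deg_eq]
  refine Prod.ext ?_ ?_
  · refine Eq.trans ?_ (sum_subtype_eq_sum (p := fun a => a ∈ p.A.E)
      (inst := instFintypeE (x.toForest.restr p.A)) _ fun a ha => if_neg ha)
    exact Finset.sum_congr rfl fun a _ => (if_pos a.2).symm
  · refine Eq.trans ?_ (sum_subtype_eq_sum (p := fun a => a ∈ p.A.E)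
      (inst := instFintypeE (x.toForest.restr p.A)) _ fun a ha => if_neg ha)
    exact Finset.sum_congr rfl fun a _ => (if_pos a.2).symm

/-- The edges carrying `𝔢` are divided between the two factors, and `ε` is new on the right. So the
first degree grows by exactly `|ε|`, which makes the coproduct triangular in the first degree and
locally finite. -/
theorem deg_fst (p : Cut 𝔄 x) : p.left.deg.1 + p.right.deg.1 = x.deg.1 + p.epsTot := by
  classical
  rw [deg_left]
  change (∑ a, if a ∈ p.A.E then ∑ j, x.ee a j else 0) +
    (∑ a, ∑ j, ((if a ∈ p.A.E then 0 else x.ee a) + p.eps a) j) =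
    (∑ a, ∑ j, x.ee a j) + ∑ a, ∑ j, p.eps a j
  rw [← Finset.sum_add_distrib, ← Finset.sum_add_distrib]
  refine Finset.sum_congr rfl fun a _ => ?_
  simp only [Pi.add_apply, Finset.sum_add_distrib]
  rw [← add_assoc]
  split_ifs <;> simp

/-- Nodes and edges of `A` have colour `i > 0` on the right and can only be counted on the left. A
node of `A` whose incoming edge is not in `A` becomes a root on the left and is counted nowhere,
whence an inequality. -/
theorem deg_snd (p : Cut 𝔄 x) : p.left.deg.2 + p.right.deg.2 ≤ x.deg.2 := by
  classical
  rw [deg_left, DForest.deg_eq p.right, DForest.deg_eq x]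
  change (∑ a, if a ∈ p.A.E then ((if x.cE a = 0 then 1 else 0) +
      if x.cN (x.tgt a) = 0 then 1 else 0) else 0) +
    (∑ a, ((if (if a ∈ p.A.E then i else x.cE a) = 0 then 1 else 0) +
      if (if x.tgt a ∈ p.A.N then i else x.cN (x.tgt a)) = 0 then 1 else 0)) ≤
    ∑ a, ((if x.cE a = 0 then 1 else 0) + if x.cN (x.tgt a) = 0 then 1 else 0)
  rw [← Finset.sum_add_distrib]
  refine Finset.sum_le_sum fun a _ => ?_
  have hi := 𝔄.pos.ne'
  by_cases ha : a ∈ p.A.E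
  · simp [ha, p.A.tgt_mem a ha, hi]
  · by_cases hn : x.tgt a ∈ p.A.N
    · simp [ha, hn, hi]
    · simp [ha, hn]

theorem degGE (p : Cut 𝔄 x) : DegGE (p.left.deg + p.right.deg) x.deg :=
  ⟨le_of_le_of_eq le_self_add p.deg_fst.symm, p.deg_snd⟩

/-- Finitely many choices exist for `A` and for `𝔫_A ≤ 𝔫`; only `ε` has an infinite range. -/
theorem finite_epsTot_le (n : ℕ) : {p : Cut 𝔄 x | p.epsTot ≤ n}.Finite := by
  classical
  let e : Cut 𝔄 x → (Set x.N × Set x.E) × (x.N → Fin d → ℕ) × (x.E → Fin d → ℕ) :=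
    fun p => ((p.A.N, p.A.E), p.nA, p.eps)
  refine Set.Finite.of_finite_image (f := e) ?_ ?_
  · refine (Set.finite_univ.prod ((Set.finite_Icc 0 x.nn).prod
      (Set.finite_Icc 0 fun _ _ => n))).subset ?_
    rintro _ ⟨p, hp, rfl⟩
    refine ⟨trivial, ⟨zero_le, p.nA_le⟩, zero_le, fun a j => le_trans ?_ hp⟩
    exact (Finset.single_le_sum (f := fun j => p.eps a j) (fun _ _ => zero_le)
      (Finset.mem_univ j)).trans (Finset.single_le_sum (f := fun a => ∑ j, p.eps a j)
        (fun _ _ => zero_le) (Finset.mem_univ a))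
  · intro p _ q _ h
    exact ext_of (Subforest.ext (congrArg (fun z => z.1.1) h) (congrArg (fun z => z.1.2) h))
      (congrArg (fun z => z.2.1) h) (congrArg (fun z => z.2.2) h)

end Cut

/-! ### The coproduct as a locally finite sum over cuts -/

namespace SubforestFamily

variable {𝔄 : SubforestFamily L i}

variable (𝔄) in
/-- A term of the coproduct. -/
noncomputable def term (l r : DForest d L) : Tot ((𝔄.hopfSpace d).tens (𝔄.hopfSpace d)) :=
  tmul (𝔄.cls l) (𝔄.cls r)

theorem suppGE_term (l r : DForest d L) : SuppGE (l.deg + r.deg) (𝔄.term l r) :=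
  (suppGE_cls l).tmul (suppGE_cls r)

theorem finite_support_term (x : DForest d L) (a : (ℕ × ℕ) × (ℕ × ℕ)) :
    (Function.support fun p : Cut 𝔄 x => (𝔄.term p.left p.right).1 a).Finite := by
  refine finite_support_of_suppGE (V := (𝔄.hopfSpace d).tens (𝔄.hopfSpace d))
    (t := fun p : Cut 𝔄 x => 𝔄.term p.left p.right) (D := fun p => p.left.deg + p.right.deg)
    (fun p => suppGE_term p.left p.right) (fun n => ?_) a
  refine (Cut.finite_epsTot_le (𝔄 := 𝔄) (x := x) n).subset fun p hp => ?_
  have h1 : p.left.deg.1 + p.right.deg.1 ≤ n := hp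
  have h2 := p.deg_fst
  change p.epsTot ≤ n
  omega

theorem suppGE_smul_term (x : DForest d L) (p : Cut 𝔄 x) :
    SuppGE x.deg (p.coef • 𝔄.term p.left p.right) :=
  ((suppGE_term _ _).mono p.degGE).smul _

variable (𝔄) in
/-- The coproduct of `x`, with values in `𝓗_i ⊗̂ 𝓗_i`. -/
noncomputable def comulVec (x : DForest d L) : Tot ((𝔄.hopfSpace d).tens (𝔄.hopfSpace d)) :=
  ⟨fun a => ∑ᶠ p : Cut 𝔄 x, p.coef • ((𝔄.cls p.left).1 a.1 ⊗ₜ[ℝ] (𝔄.cls p.right).1 a.2),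
    x.deg.2, fun a ha => finsum_eq_zero_of_forall_eq_zero fun p =>
      suppGE_smul_term x p a fun h => absurd h.2 (not_le.2 ha)⟩

theorem hasFSum_comulVec (x : DForest d L) :
    HasFSum (fun p : Cut 𝔄 x => p.coef • 𝔄.term p.left p.right) (𝔄.comulVec x) where
  bdd := ⟨x.deg.2, fun p =>
    SuppGE.mono (m := x.deg) (n := (0, x.deg.2)) ⟨Nat.zero_le _, le_rfl⟩
      (suppGE_smul_term x p)⟩
  fin a := by
    refine (finite_support_term x a).subset fun p hp h0 => hp ?_
    change p.coef • (𝔄.term p.left p.right).1 a = 0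
    rw [show (𝔄.term p.left p.right).1 a = 0 from h0, smul_zero]
  eq _ := rfl

theorem suppGE_comulVec (x : DForest d L) : SuppGE x.deg (𝔄.comulVec x) :=
  (hasFSum_comulVec x).suppGE (suppGE_smul_term x)

theorem cls_eq_of_dIso {x y : DForest d L} (φ : DIso x y) : 𝔄.cls x = 𝔄.cls y := by
  rw [cls, cls, show (⟦x⟧ : DecForest d L) = ⟦y⟧ from Quotient.sound ⟨φ⟩]

end SubforestFamily

end HopfForest

/-! ## The coproduct and contractions -/

namespace HopfForest

variable {d : ℕ} {L : Type} {i : ℕ}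

/-- A coloured edge outside `A` does not touch `A`, so it is not a boundary edge. In particular
contracting coloured edges loses no value of `ε`. -/
theorem Cut.eps_eq_zero {𝔄 : SubforestFamily L i} {x : DForest d L} (p : Cut 𝔄 x) {a : x.E}
    (h : x.cE a ≠ 0) : p.eps a = 0 :=
  p.eps_supp a fun h' => ((𝔄.compat _ _ p.mem).notMem h'.1 h).1 h'.2

namespace DContr

variable {x y : DForest d L}

-- Summing over sources commutes with contraction: for `e = ε` this says that `π ε`, summed over a
-- fibre, is `π` of the transported `ε`, the contracted edges contributing nothing.
open Classical in
theorem sum_src (φ : DContr x y) {M : Type*} [AddCommMonoid M] (e : x.E → M)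
    (he : ∀ a, a ∉ Set.range φ.gE → e a = 0) (X : y.N) :
    (∑ v, if φ.fN v = X then ∑ a, if x.src a = v then e a else 0 else 0) =
      ∑ b, if y.src b = X then e (φ.gE b) else 0 := by
  have h : ∀ v, (if φ.fN v = X then ∑ a, if x.src a = v then e a else 0 else 0) =
      ∑ a, if x.src a = v then (if φ.fN (x.src a) = X then e a else 0) else 0 := by
    intro v
    by_cases hv : φ.fN v = X
    · rw [if_pos hv]
      refine Finset.sum_congr rfl fun a _ => ?_
      by_cases ha : x.src a = v
      · rw [if_pos ha, if_pos ha, if_pos (ha ▸ hv)]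
      · rw [if_neg ha, if_neg ha]
    · rw [if_neg hv]
      refine (Finset.sum_eq_zero fun a _ => ?_).symm
      by_cases ha : x.src a = v
      · rw [if_pos ha, if_neg (ha ▸ hv)]
      · rw [if_neg ha]
  rw [Finset.sum_congr rfl fun v _ => h v, Finset.sum_comm]
  simp only [Finset.sum_ite_eq, Finset.mem_univ, if_true]
  refine (Fintype.sum_of_injective φ.gE φ.inj _ _ (fun a ha => ?_) fun b => ?_).symm
  · rw [he a ha, ite_self]
  · rw [φ.src]

variable {𝔄 : SubforestFamily L i} (φ : DContr x y)
  (h : Set.BijOn φ.sharp (𝔄.adm y.toCForest) (𝔄.adm x.toCForest))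

open Classical in
/-- The image of a cut under a contraction. -/
noncomputable def pushCut (p : Cut 𝔄 x) : Cut 𝔄 y where
  A := (h.surjOn p.mem).choose
  mem := (h.surjOn p.mem).choose_spec.1
  nA X := ∑ v, if φ.fN v = X then p.nA v else 0
  eps b := p.eps (φ.gE b)
  nA_supp X hX := by
    refine Finset.sum_eq_zero fun v _ => ?_
    split_ifs with hv
    · refine p.nA_supp v fun hvA => hX ?_
      rw [← (h.surjOn p.mem).choose_spec.2] at hvA
      exact hv ▸ hvA
    · rfl
  nA_le X := by
    rw [φ.nn]
    refine Finset.sum_le_sum fun v _ => ?_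
    split_ifs
    · exact p.nA_le v
    · exact le_rfl
  eps_supp b hb := by
    refine p.eps_supp _ fun hA => hb ?_
    rw [← (h.surjOn p.mem).choose_spec.2] at hA
    obtain ⟨h1, h2⟩ := hA
    rw [φ.gE_mem_sharp] at h1
    refine ⟨h1, ?_⟩
    rw [← φ.src]
    exact h2

theorem pushCut_sharp (p : Cut 𝔄 x) : φ.sharp (φ.pushCut h p).A = p.A :=
  (h.surjOn p.mem).choose_spec.2

/-- The contraction of the left parts of cuts. -/
noncomputable def pushLeft (p : Cut 𝔄 x) : DContr p.left (φ.pushCut h p).left :=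
  φ.restr (φ.pushCut_sharp h p) fun X _ => by
    classical
    change (∑ v, if φ.fN v = X then p.nA v else 0) + _ = _
    have h1 : ∀ v, (if φ.fN v = X then (p.nA v + ∑ a, if x.src a = v then p.eps a else 0) else 0) =
        (if φ.fN v = X then p.nA v else 0) +
          if φ.fN v = X then ∑ a, if x.src a = v then p.eps a else 0 else 0 := by
      intro v
      split_ifs
      · rfl
      · rw [add_zero]
    rw [Finset.sum_congr rfl fun v _ => h1 v, Finset.sum_add_distrib,
      φ.sum_src p.eps fun a ha => p.eps_eq_zero (φ.col a ha)]
    rfl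

open Classical in
/-- The contraction of the right parts of cuts. -/
noncomputable def pushRight (p : Cut 𝔄 x) : DContr p.right (φ.pushCut h p).right where
  fN := φ.fN
  gE := φ.gE
  surj := φ.surj
  inj := φ.inj
  src := φ.src
  tgt := φ.tgt
  typ := φ.typ
  cN := by
    intro (v : x.N)
    change (if φ.fN v ∈ (φ.pushCut h p).A.N then i else y.cN (φ.fN v)) =
      if v ∈ p.A.N then i else x.cN v
    rw [φ.cN]
    refine ite_eq_of_iff ?_
    rw [← φ.pushCut_sharp h p]
    exact Iff.rfl
  cE := by
    intro (b : y.E)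
    change (if b ∈ (φ.pushCut h p).A.E then i else y.cE b) =
      if φ.gE b ∈ p.A.E then i else x.cE (φ.gE b)
    rw [φ.cE]
    refine ite_eq_of_iff ?_
    rw [← φ.pushCut_sharp h p, φ.gE_mem_sharp]
  col a ha := by
    change (if a ∈ p.A.E then i else x.cE a) ≠ 0
    split_ifs
    · exact 𝔄.pos.ne'
    · exact φ.col a ha
  loop := φ.loop
  fib := φ.fib
  nn := by
    intro (X : y.N)
    change y.nn X - (∑ v, if φ.fN v = X then p.nA v else 0) =
      ∑ v, if φ.fN v = X then x.nn v - p.nA v else 0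
    refine tsub_eq_of_eq_add ?_
    rw [φ.nn, ← Finset.sum_add_distrib]
    refine Finset.sum_congr rfl fun v _ => ?_
    split_ifs
    · rw [tsub_add_cancel_of_le (p.nA_le v)]
    · rfl
  oo := by
    intro (X : y.N)
    change y.oo X + (fun j => ((∑ v, if φ.fN v = X then p.nA v else 0) j : ℤ) +
        ∑ b, if y.src b = X then (p.eps (φ.gE b) j : ℤ) -
          (if b ∈ (φ.pushCut h p).A.E then (y.ee b j : ℤ) else 0) else 0, 0) =
      (∑ v, if φ.fN v = X then x.oo v + (fun j => (p.nA v j : ℤ) + ∑ a, if x.src a = v then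
          (p.eps a j : ℤ) - (if a ∈ p.A.E then (x.ee a j : ℤ) else 0) else 0, 0) else 0) +
        ∑ a, if a ∉ Set.range φ.gE ∧ φ.fN (x.src a) = X then
          ((0, Finsupp.single (x.typ a) 1) : (Fin d → ℤ) × (L →₀ ℤ)) else 0
    have h1 : ∀ (v : x.N) (w : (Fin d → ℤ) × (L →₀ ℤ)), (if φ.fN v = X then x.oo v + w else 0) =
        (if φ.fN v = X then x.oo v else 0) + if φ.fN v = X then w else 0 := by
      intro v w
      split_ifs
      · rfl
      · rw [add_zero]
    rw [Finset.sum_congr rfl fun v _ => h1 v _, Finset.sum_add_distrib, φ.oo, add_right_comm]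
    refine congrArg (· + _) (congrArg₂ (· + ·) rfl ?_)
    refine Prod.ext (funext fun j => ?_) ?_
    · rw [Prod.fst_sum, Finset.sum_apply]
      have h2 : ∀ v, (if φ.fN v = X then (((fun j => (p.nA v j : ℤ) + ∑ a, if x.src a = v then
          (p.eps a j : ℤ) - (if a ∈ p.A.E then (x.ee a j : ℤ) else 0) else 0, 0) :
            (Fin d → ℤ) × (L →₀ ℤ))) else 0).1 j =
          (if φ.fN v = X then (p.nA v j : ℤ) else 0) + if φ.fN v = X then
            ∑ a, if x.src a = v then
              (p.eps a j : ℤ) - (if a ∈ p.A.E then (x.ee a j : ℤ) else 0) else 0 else 0 := by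
        intro v
        split_ifs
        · rfl
        · rfl
      rw [Finset.sum_congr rfl fun v _ => h2 v, Finset.sum_add_distrib,
        φ.sum_src fun a => (p.eps a j : ℤ) - (if a ∈ p.A.E then (x.ee a j : ℤ) else 0)]
      · refine congrArg₂ (· + ·) ?_ ?_
        · rw [Finset.sum_apply, Nat.cast_sum]
          refine Finset.sum_congr rfl fun v _ => ?_
          split_ifs
          · rfl
          · rfl
        · refine Finset.sum_congr rfl fun b _ => ?_
          rw [φ.ee]
          refine congrArg (fun z => if y.src b = X then (p.eps (φ.gE b) j : ℤ) - z else 0) ?_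
          refine ite_eq_of_iff ?_
          rw [← φ.pushCut_sharp h p, φ.gE_mem_sharp]
      · intro a ha
        rw [p.eps_eq_zero (φ.col a ha), x.ee_supp a (φ.col a ha)]
        simp
    · rw [Prod.snd_sum]
      refine (Finset.sum_eq_zero fun v _ => ?_).symm
      split_ifs
      · rfl
      · rfl
  ee := by
    intro (b : y.E)
    change (if b ∈ (φ.pushCut h p).A.E then 0 else y.ee b) + p.eps (φ.gE b) =
      (if φ.gE b ∈ p.A.E then 0 else x.ee (φ.gE b)) + p.eps (φ.gE b)
    rw [φ.ee]
    refine congrArg (· + _) (ite_eq_of_iff ?_)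
    rw [← φ.pushCut_sharp h p, φ.gE_mem_sharp]

-- The image `q` determines `A` (as a preimage) and `ε` (which vanishes on contracted edges). Only
-- `𝔫_A` is free, subject to its sums over the fibres of `fN`.
open Classical in
theorem bijOn_fiber_pushCut (q : Cut 𝔄 y) :
    Set.BijOn Cut.nA (φ.pushCut h ⁻¹' {q})
      {m | m ≤ x.nn ∧ ∀ X, (∑ v, if φ.fN v = X then m v else 0) = q.nA X} := by
  have heps : ∀ p : Cut 𝔄 x, ∀ a, a ∉ Set.range φ.gE → p.eps a = 0 :=
    fun p a ha => p.eps_eq_zero (φ.col a ha)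
  refine ⟨?_, ?_, ?_⟩
  · rintro p rfl
    exact ⟨p.nA_le, fun _ => rfl⟩
  · rintro p hp p' hp' hn
    have hpp : φ.pushCut h p = φ.pushCut h p' := Eq.trans hp (Eq.symm hp')
    refine Cut.ext_of ?_ hn (funext fun a => ?_)
    · rw [← φ.pushCut_sharp h p, hpp, φ.pushCut_sharp]
    · by_cases ha : a ∈ Set.range φ.gE
      · obtain ⟨b, rfl⟩ := ha
        exact congrArg (fun q : Cut 𝔄 y => q.eps b) hpp
      · rw [heps p a ha, heps p' a ha]
  · rintro m ⟨h1, h2⟩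
    have hmem : φ.sharp q.A ∈ 𝔄.adm x.toCForest := h.mapsTo q.mem
    let p : Cut 𝔄 x :=
      { A := φ.sharp q.A
        mem := hmem
        nA := m
        eps := fun a => if ha : a ∈ Set.range φ.gE then q.eps ha.choose else 0
        nA_supp := fun v hv => by
          -- Outside `A` the prescribed sum over the fibre is zero, so each of its summands, being a
          -- natural number, is zero; the support condition is automatic.
          have h3 := h2 (φ.fN v)
          rw [q.nA_supp _ hv, Finset.sum_eq_zero_iff] at h3
          have h4 := h3 v (Finset.mem_univ v)
          rwa [if_pos rfl] at h4
        nA_le := h1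
        eps_supp := fun a ha => by
          by_cases hr : a ∈ Set.range φ.gE
          · rw [dif_pos hr]
            refine q.eps_supp _ fun h3 => ha ?_
            have h4 := hr.choose_spec
            rw [← h4, φ.gE_mem_sharp]
            refine ⟨h3.1, ?_⟩
            change φ.fN _ ∈ q.A.N
            rw [φ.src]
            exact h3.2
          · rw [dif_neg hr] }
    refine ⟨p, ?_, rfl⟩
    refine Cut.ext_of ?_ (funext h2) (funext fun b => ?_)
    · exact h.injOn (φ.pushCut h p).mem q.mem (φ.pushCut_sharp h p)
    · change (if ha : φ.gE b ∈ Set.range φ.gE then q.eps ha.choose else 0) = q.eps b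
      have hr : φ.gE b ∈ Set.range φ.gE := ⟨b, rfl⟩
      rw [dif_pos hr, φ.inj hr.choose_spec]

theorem finite_fiber_pushCut (q : Cut 𝔄 y) : (φ.pushCut h ⁻¹' {q}).Finite := by
  classical
  refine Set.Finite.of_finite_image (f := Cut.nA) ?_ (φ.bijOn_fiber_pushCut h q).injOn
  rw [(φ.bijOn_fiber_pushCut h q).image_eq]
  exact (Set.finite_Icc 0 x.nn).subset fun m hm => ⟨zero_le, hm.1⟩

-- The factorials of `ε` are constant along the fibre; the binomials in `𝔫_A` are summed by
-- Vandermonde's identity for `fN`.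
open scoped Nat in
theorem sum_coef_fiber_pushCut (q : Cut 𝔄 y) :
    ∑ᶠ p ∈ φ.pushCut h ⁻¹' {q}, p.coef = q.coef := by
  classical
  rw [finsum_mem_eq_of_bijOn Cut.nA (φ.bijOn_fiber_pushCut h q) (g := fun m =>
    (∏ a, ∏ j, (1 / ((q.eps a j)! : ℝ))) * ∏ v, ∏ j, ((x.nn v j).choose (m v j) : ℝ))]
  · rw [← mul_finsum_mem, finsum_choose_fiber φ.fN x.nn q.nA]
    refine congrArg _ (Finset.prod_congr rfl fun X _ => Finset.prod_congr rfl fun j _ => ?_)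
    rw [φ.nn]
  · rintro p rfl
    refine congrArg (· * _) ?_
    refine (Fintype.prod_of_injective φ.gE φ.inj _ _ (fun a ha => ?_) fun b => ?_).symm
    · refine Finset.prod_eq_one fun j _ => ?_
      rw [p.eps_eq_zero (φ.col a ha)]
      simp
    · rfl

end DContr

namespace SubforestFamily

variable {𝔄 : SubforestFamily L i}

/-- Reindexing along `pushCut`: both tensor factors of a cut are contracted onto those of its image,
hence have the same classes, and the coefficients add up over the fibres. -/
theorem comulVec_eq_of_dContr (hU : 𝔄.Counital) {x y : DForest d L} (φ : DContr x y)
    (h : Set.BijOn φ.sharp (𝔄.adm y.toCForest) (𝔄.adm x.toCForest))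
    (hx : 𝔄.Good x.toCForest) (hy : 𝔄.Good y.toCForest) : 𝔄.comulVec x = 𝔄.comulVec y := by
  refine HasFSum.fiberwise (g := φ.pushCut h) (w := Cut.coef) (W := Cut.coef)
    (f := fun q => 𝔄.term q.left q.right) ((hasFSum_comulVec x).congr fun p => ?_)
    (hasFSum_comulVec y) (φ.finite_fiber_pushCut h) (finite_support_term y)
    (φ.sum_coef_fiber_pushCut h)
  rw [term, term, cls_eq (good_left hU hx p) (good_left hU hy _) (Eqv.of_dContr (φ.pushLeft h p)),
    cls_eq (good_right hU hx p) (good_right hU hy _) (Eqv.of_dContr (φ.pushRight h p))]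

theorem comulVec_contract (hU : 𝔄.Counital) (hC : 𝔄.ContractionInvariant) {x : DForest d L}
    (hx : 𝔄.Good x.toCForest) : 𝔄.comulVec x = 𝔄.comulVec x.contract := by
  refine comulVec_eq_of_dContr hU x.toContract ?_ hx (good_contract hC hx)
  rw [show x.toContract.sharp = x.toCForest.sharp from funext x.toCForest.toContract_sharp]
  exact hC x.toCForest

/-- An isomorphism is a contraction of no edge, and the required bijection of admissible subforests
is their invariance under isomorphisms. -/
theorem comulVec_dIso (hU : 𝔄.Counital) {x y : DForest d L} (φ : DIso x y)
    (hx : 𝔄.Good x.toCForest) : 𝔄.comulVec x = 𝔄.comulVec y := by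
  have e1 : ∀ B : Subforest y.toForest, φ.toDContr.sharp B = B.map φ.toCIso.symm := by
    intro B
    ext a
    · obtain ⟨v, rfl⟩ := φ.eN.symm.surjective a
      refine Iff.trans ?_ (φ.eN.symm.injective.mem_set_image).symm
      change φ.eN (φ.eN.symm v) ∈ B.N ↔ v ∈ B.N
      rw [Equiv.apply_symm_apply]
    · obtain ⟨b, rfl⟩ := φ.eE.symm.surjective a
      exact φ.toDContr.gE_mem_sharp.trans (φ.eE.symm.injective.mem_set_image).symm
  refine comulVec_eq_of_dContr hU φ.toDContr ⟨?_, ?_, ?_⟩ hx (hx.of_iso φ.toCIso)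
  · intro B hB
    rw [e1]
    exact 𝔄.iso _ _ _ B hB
  · intro B _ B' _ h
    ext a
    · obtain ⟨v, rfl⟩ := φ.eN.surjective a
      exact iff_of_eq (congrArg (fun A : Subforest x.toForest => v ∈ A.N) h)
    · rw [← φ.toDContr.gE_mem_sharp, h, φ.toDContr.gE_mem_sharp]
  · intro A hA
    refine ⟨A.map φ.toCIso, 𝔄.iso _ _ _ A hA, ?_⟩
    ext a
    · exact φ.eN.injective.mem_set_image
    · obtain ⟨b, rfl⟩ := φ.eE.symm.surjective a
      refine φ.toDContr.gE_mem_sharp.trans ?_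
      constructor
      · rintro ⟨c, hc, rfl⟩
        rwa [Equiv.symm_apply_apply]
      · exact fun hb => ⟨_, hb, φ.eE.apply_symm_apply b⟩

end SubforestFamily

end HopfForest

/-! ## The coproduct and the product -/

namespace HopfForest

theorem BiSpace.HasFSum.eq_of_bijective {V : BiSpace} {P Q : Type*} {t : P → Tot V} {s s' : Tot V}
    {t' : Q → Tot V} (h : HasFSum t s) (h' : HasFSum t' s') (e : P → Q)
    (he : Function.Bijective e) (ht : ∀ p, t p = t' (e p)) : s = s' := by
  refine Subtype.ext (funext fun a => ?_)
  rw [h.eq, h'.eq]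
  exact finsum_eq_of_bijective e he fun p => by rw [ht]

theorem ite_eq_ite {p q : Prop} {_ : Decidable p} {_ : Decidable q} {α : Type*} {a b c : α}
    (h : p ↔ q) (h' : p → a = b) : (if p then a else c) = if q then b else c := by
  by_cases hp : p
  · rw [if_pos hp, if_pos (h.1 hp), h' hp]
  · rw [if_neg hp, if_neg (mt h.2 hp)]

variable {d : ℕ} {L : Type} {i : ℕ} {𝔄 : SubforestFamily L i}

namespace Cut

variable {x y : DForest d L}

/-- The disjoint union of two cuts. -/
def sum (hM : 𝔄.MulCoassoc) (p : Cut 𝔄 x) (q : Cut 𝔄 y) : Cut 𝔄 (x.mul y) where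
  A := Subforest.sum p.A q.A
  mem := (Set.ext_iff.1 (hM.sum _ _) _).2 ⟨_, p.mem, _, q.mem, rfl⟩
  nA := Sum.elim p.nA q.nA
  eps := Sum.elim p.eps q.eps
  nA_supp := by
    rintro (v | v) h
    · exact p.nA_supp v h
    · exact q.nA_supp v h
  nA_le := by
    rintro (v | v)
    · exact p.nA_le v
    · exact q.nA_le v
  eps_supp := by
    rintro (a | a) h
    · exact p.eps_supp a h
    · exact q.eps_supp a h

variable (hM : 𝔄.MulCoassoc)

theorem sum_bijective :
    Function.Bijective fun r : Cut 𝔄 x × Cut 𝔄 y => Cut.sum hM r.1 r.2 := by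
  constructor
  · rintro ⟨p, q⟩ ⟨p', q'⟩ h
    obtain ⟨h1, h2⟩ := Subforest.sum_inj (congrArg Cut.A h)
    have h3 : (Cut.sum hM p q).nA = (Cut.sum hM p' q').nA := congrArg Cut.nA h
    have h4 : (Cut.sum hM p q).eps = (Cut.sum hM p' q').eps := congrArg Cut.eps h
    exact Prod.ext
      (Cut.ext_of h1 (funext fun v => congrFun h3 (.inl v)) (funext fun a => congrFun h4 (.inl a)))
      (Cut.ext_of h2 (funext fun v => congrFun h3 (.inr v)) (funext fun a => congrFun h4 (.inr a)))
  · intro r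
    obtain ⟨C, hC, D, hD, hA⟩ := (Set.ext_iff.1 (hM.sum _ _) _).1 r.mem
    have hn := r.nA_supp
    have he := r.eps_supp
    rw [hA] at hn he
    refine ⟨⟨⟨C, hC, fun v => r.nA (.inl v), fun a => r.eps (.inl a), fun v hv => hn (.inl v) hv,
      fun v => r.nA_le (.inl v), fun a ha => he (.inl a) ha⟩,
      ⟨D, hD, fun v => r.nA (.inr v), fun a => r.eps (.inr a), fun v hv => hn (.inr v) hv,
      fun v => r.nA_le (.inr v), fun a ha => he (.inr a) ha⟩⟩, ?_⟩
    refine Cut.ext_of hA.symm (funext ?_) (funext ?_)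
    · rintro (v | v)
      · rfl
      · rfl
    · rintro (v | v)
      · rfl
      · rfl

theorem coef_sum (p : Cut 𝔄 x) (q : Cut 𝔄 y) : (Cut.sum hM p q).coef = p.coef * q.coef := by
  refine Eq.trans (congrArg₂ (· * ·) (prod_sum_eq (α := x.E) (β := y.E) _)
    (prod_sum_eq (α := x.N) (β := y.N) _)) ?_
  exact mul_mul_mul_comm _ _ _ _

/-- The left part of a disjoint union. -/
noncomputable def leftSum (p : Cut 𝔄 x) (q : Cut 𝔄 y) :
    DIso (p.left.mul q.left) (Cut.sum hM p q).left :=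
  DIso.ofBijective (x := p.left.mul q.left) (y := (Cut.sum hM p q).left)
    (Sum.elim (fun v : {v // v ∈ p.A.N} => ⟨.inl v.1, v.2⟩)
      fun v : {v // v ∈ q.A.N} => ⟨.inr v.1, v.2⟩)
    (Sum.elim (fun v : {v // v ∈ p.A.E} => ⟨.inl v.1, v.2⟩)
      fun v : {v // v ∈ q.A.E} => ⟨.inr v.1, v.2⟩)
    (by
      constructor
      · rintro (⟨v, hv⟩ | ⟨v, hv⟩) (⟨w, hw⟩ | ⟨w, hw⟩) h
        · cases congrArg Subtype.val h; rfl
        · cases congrArg Subtype.val h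
        · cases congrArg Subtype.val h
        · cases congrArg Subtype.val h; rfl
      · rintro ⟨v | v, h⟩
        · exact ⟨.inl ⟨v, h⟩, rfl⟩
        · exact ⟨.inr ⟨v, h⟩, rfl⟩)
    (by
      constructor
      · rintro (⟨v, hv⟩ | ⟨v, hv⟩) (⟨w, hw⟩ | ⟨w, hw⟩) h
        · cases congrArg Subtype.val h; rfl
        · cases congrArg Subtype.val h
        · cases congrArg Subtype.val h
        · cases congrArg Subtype.val h; rfl
      · rintro ⟨v | v, h⟩
        · exact ⟨.inl ⟨v, h⟩, rfl⟩
        · exact ⟨.inr ⟨v, h⟩, rfl⟩)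
    (by rintro (a | a) <;> rfl) (by rintro (a | a) <;> rfl) (by rintro (a | a) <;> rfl)
    (by rintro (a | a) <;> rfl) (by rintro (a | a) <;> rfl)
    (by
      classical
      rintro (v | v)
      · refine congrArg (p.nA v.1 + ·) (Eq.symm ?_)
        refine eq_sum_inl (α := x.E) (β := y.E) (fun a => ?_) fun b => ?_
        · exact ite_eq_of_iff ⟨fun h => congrArg Sum.inl h, fun h => Sum.inl_injective h⟩
        · exact if_neg fun h => by cases h
      · refine congrArg (q.nA v.1 + ·) (Eq.symm ?_)
        refine eq_sum_inr (α := x.E) (β := y.E) (fun a => ?_) fun b => ?_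
        · exact ite_eq_of_iff ⟨fun h => congrArg Sum.inr h, fun h => Sum.inr_injective h⟩
        · exact if_neg fun h => by cases h)
    (by rintro (a | a) <;> rfl) (by rintro (a | a) <;> rfl)

/-- The right part of a disjoint union. -/
noncomputable def rightSum (p : Cut 𝔄 x) (q : Cut 𝔄 y) :
    DIso (p.right.mul q.right) (Cut.sum hM p q).right where
  eN := Equiv.refl _
  eE := Equiv.refl _
  src := by rintro (a | a) <;> rfl
  tgt := by rintro (a | a) <;> rfl
  typ := by rintro (a | a) <;> rfl
  cN := by rintro (a | a) <;> exact ite_eq_of_iff Iff.rfl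
  cE := by rintro (a | a) <;> exact ite_eq_of_iff Iff.rfl
  nn := by rintro (a | a) <;> rfl
  oo := by
    classical
    rintro (v | v)
    · refine congrArg (x.oo v + ·) (Prod.ext (funext fun j => ?_) rfl)
      refine congrArg ((p.nA v j : ℤ) + ·) (Eq.symm ?_)
      refine eq_sum_inl (α := x.E) (β := y.E) (fun a => ?_) fun b => ?_
      · exact ite_eq_ite ⟨fun h => congrArg Sum.inl h, fun h => Sum.inl_injective h⟩
          fun _ => congrArg ((p.eps a j : ℤ) - ·) (ite_eq_of_iff Iff.rfl)
      · exact if_neg fun h => by cases h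
    · refine congrArg (y.oo v + ·) (Prod.ext (funext fun j => ?_) rfl)
      refine congrArg ((q.nA v j : ℤ) + ·) (Eq.symm ?_)
      refine eq_sum_inr (α := x.E) (β := y.E) (fun a => ?_) fun b => ?_
      · exact ite_eq_ite ⟨fun h => congrArg Sum.inr h, fun h => Sum.inr_injective h⟩
          fun _ => congrArg ((q.eps a j : ℤ) - ·) (ite_eq_of_iff Iff.rfl)
      · exact if_neg fun h => by cases h
  ee := by rintro (a | a) <;> exact congrArg (· + _) (ite_eq_of_iff Iff.rfl)

end Cut

namespace SubforestFamily

/-- A cut of a disjoint union is a pair of cuts, and coefficients and both tensor factors are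
multiplicative, so the two sides agree term by term. -/
theorem comulVec_mul (hM : 𝔄.MulCoassoc) (x y : DForest d L) :
    𝔄.comulVec (x.mul y) = (Tri.tens (mulTri d hM) (mulTri d hM)).toLin
      (mid _ (tmul (𝔄.comulVec x) (𝔄.comulVec y))) := by
  have h1 := (Tri.isTri (Tri.tens (mulTri d hM) (mulTri d hM))).hasFSum
    (isTri_mid.hasFSum ((hasFSum_comulVec x).tmul (hasFSum_comulVec y)))
  refine (HasFSum.eq_of_bijective h1 (hasFSum_comulVec (x.mul y)) _ (Cut.sum_bijective hM) ?_).symm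
  rintro ⟨p, q⟩
  change (Tri.tens (mulTri d hM) (mulTri d hM)).toLin
    (mid _ (tmul (p.coef • 𝔄.term p.left p.right) (q.coef • 𝔄.term q.left q.right))) = _
  rw [tmul_smul_left, tmul_smul_right, map_smul, map_smul, map_smul, map_smul, smul_smul,
    ← Cut.coef_sum hM, term, term, mid_tmul, Tri.tens_tmul, mulTri_cls, mulTri_cls,
    cls_eq_of_dIso (Cut.leftSum hM p q), cls_eq_of_dIso (Cut.rightSum hM p q)]
  rfl

end SubforestFamily

end HopfForest

/-! ## The induced coproduct -/

namespace HopfForest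

theorem BiSpace.hasFSum_finset {V : BiSpace} {P : Type*} {t : P → Tot V} (s : Finset P)
    (hs : ∀ p, p ∉ s → t p = 0) : HasFSum t (∑ p ∈ s, t p) := by
  have hsub : ∀ a, (Function.support fun p => (t p).1 a) ⊆ s := by
    intro a p hp
    by_contra h
    exact hp (congrArg (fun v : Tot V => v.1 a) (hs p h))
  refine ⟨?_, fun a => s.finite_toSet.subset (hsub a), fun a => ?_⟩
  · choose k hk using fun p => exists_suppGE (t p)
    refine ⟨s.sup k, fun p => ?_⟩
    by_cases h : p ∈ s
    · have hle : DegGE (0, k p) (0, s.sup k) := ⟨le_rfl, Finset.le_sup (f := k) h⟩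
      exact (hk p).mono hle
    · rw [hs p h]
      exact SuppGE.zero _
  · rw [finsum_eq_sum_of_support_subset _ (hsub a), AddSubmonoidClass.coe_finsetSum,
      Finset.sum_apply]

variable {d : ℕ} {L : Type} {i : ℕ} {𝔄 : SubforestFamily L i}

namespace Cut

variable {x : DForest d L}

theorem A_eq_top (hx : x.toCForest.AllCol i) (p : Cut 𝔄 x) : p.A = ⊤ := by
  have h := (𝔄.compat _ _ p.mem).hat_le
  ext a
  · exact ⟨fun _ => trivial, fun _ => h.1 (hx.1 a)⟩
  · exact ⟨fun _ => trivial, fun _ => h.2 ⟨hx.2 a, 𝔄.pos.ne'⟩⟩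

theorem eps_eq_zero_of_top (p : Cut 𝔄 x) (h : p.A = ⊤) : p.eps = 0 :=
  funext fun a => p.eps_supp a fun h' => h'.1 (by rw [h]; trivial)

theorem allCol_left (hx : x.toCForest.AllCol i) (p : Cut 𝔄 x) : p.left.toCForest.AllCol i :=
  ⟨fun v => hx.1 v.1, fun a => hx.2 a.1⟩

theorem allCol_right_of_top (p : Cut 𝔄 x) (h : p.A = ⊤) : p.right.toCForest.AllCol i := by
  refine ⟨fun v => if_pos ?_, fun a => if_pos ?_⟩
  · rw [h]
    trivial
  · rw [h]
    trivial

theorem nTot_left_of_top (p : Cut 𝔄 x) (h : p.A = ⊤) : p.left.nTot = ∑ v, p.nA v := by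
  classical
  have h1 : ∀ v : {v // v ∈ p.A.N}, p.left.nn v = p.nA v.1 := by
    intro v
    change p.nA v.1 + (∑ a, if x.src a = v.1 then p.eps a else 0) = p.nA v.1
    rw [p.eps_eq_zero_of_top h]
    simp
  refine (Finset.sum_congr rfl fun v _ => h1 v).trans ?_
  exact sum_subtype_eq_sum (inst := instFintypeN p.left.toForest) p.nA p.nA_supp

theorem nTot_right (p : Cut 𝔄 x) : p.right.nTot = x.nTot - ∑ v, p.nA v := by
  refine eq_tsub_of_add_eq ?_
  refine Finset.sum_add_distrib.symm.trans (Finset.sum_congr rfl fun v _ => ?_)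
  exact tsub_add_cancel_of_le (p.nA_le v)

theorem sum_nA_le (p : Cut 𝔄 x) : ∑ v, p.nA v ≤ x.nTot :=
  Finset.sum_le_sum fun v _ => p.nA_le v

theorem bijOn_nA (hx : x.toCForest.AllCol i) (ht : ⊤ ∈ 𝔄.adm x.toCForest) (K : Fin d → ℕ) :
    Set.BijOn Cut.nA {p : Cut 𝔄 x | ∑ v, p.nA v = K} {m | m ≤ x.nn ∧ ∑ v, m v = K} := by
  refine ⟨fun p hp => ⟨p.nA_le, hp⟩, fun p _ q _ h => ?_, fun m hm => ?_⟩
  · have hp := p.A_eq_top hx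
    have hq := q.A_eq_top hx
    exact Cut.ext_of (hp.trans hq.symm) h
      ((p.eps_eq_zero_of_top hp).trans (q.eps_eq_zero_of_top hq).symm)
  · exact ⟨⟨⊤, ht, m, 0, fun v hv => absurd trivial hv, hm.1, fun _ _ => rfl⟩, hm.2, rfl⟩

theorem finite_nA_fiber (hx : x.toCForest.AllCol i) (ht : ⊤ ∈ 𝔄.adm x.toCForest)
    (K : Fin d → ℕ) : {p : Cut 𝔄 x | ∑ v, p.nA v = K}.Finite := by
  classical
  refine Set.Finite.of_finite_image (f := Cut.nA) ?_ (bijOn_nA hx ht K).injOn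
  rw [(bijOn_nA hx ht K).image_eq]
  exact (Set.finite_Icc 0 x.nn).subset fun m hm => ⟨zero_le, hm.1⟩

/-- Here `A = F`, which forces `ε = 0`, so `𝔫_A` is the only parameter; the sum is Vandermonde's
identity for the map to a point. -/
theorem sum_coef_nA_fiber (hx : x.toCForest.AllCol i) (ht : ⊤ ∈ 𝔄.adm x.toCForest)
    (K : Fin d → ℕ) : ∑ᶠ p ∈ {p : Cut 𝔄 x | ∑ v, p.nA v = K}, p.coef =
      ∏ j, ((x.nTot j).choose (K j) : ℝ) := by
  rw [finsum_mem_eq_of_bijOn Cut.nA (bijOn_nA hx ht K) (g := fun m =>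
    ∏ v, ∏ j, ((x.nn v j).choose (m v j) : ℝ))]
  · have h := finsum_choose_fiber (fun _ : x.N => ()) x.nn fun _ => K
    simp only [forall_const, if_true, Finset.univ_unique, Finset.prod_singleton] at h
    exact h
  · intro p _
    rw [Cut.coef, p.eps_eq_zero_of_top (p.A_eq_top hx)]
    simp

end Cut

namespace SubforestFamily

/-- Contractions alone do not relate forests with different numbers of components, so this case
needs its own argument: the coproduct reduces to the binomial coproduct of the total decoration. -/
theorem comulVec_eq_of_allCol (hU : 𝔄.Counital) {x y : DForest d L} (hx : 𝔄.Good x.toCForest)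
    (hy : 𝔄.Good y.toCForest) (hx' : x.toCForest.AllCol i) (hy' : y.toCForest.AllCol i)
    (h : x.nTot = y.nTot) : 𝔄.comulVec x = 𝔄.comulVec y := by
  classical
  -- One representative for each total decoration suffices, as the class depends on nothing else.
  -- The default `x` is never reached by a term of the coproduct.
  let D : (Fin d → ℕ) → DForest d L := fun K =>
    if h : ∃ z : DForest d L, 𝔄.Good z.toCForest ∧ z.toCForest.AllCol i ∧ z.nTot = K then h.choose
    else x
  have hD : ∀ z : DForest d L, 𝔄.Good z.toCForest → z.toCForest.AllCol i →
      𝔄.cls z = 𝔄.cls (D z.nTot) := by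
    intro z h1 h2
    have h3 : ∃ z' : DForest d L, 𝔄.Good z'.toCForest ∧ z'.toCForest.AllCol i ∧
      z'.nTot = z.nTot := ⟨z, h1, h2, rfl⟩
    have h4 : D z.nTot = h3.choose := dif_pos h3
    rw [h4]
    obtain ⟨h5, h6, h7⟩ := h3.choose_spec
    exact cls_eq h1 h5 (eqv_of_allCol h2 h6 h7.symm)
  -- Cutting off at `x.nTot` makes the sum over `K` finite; no cut has a larger total of `𝔫_A`.
  let f : (Fin d → ℕ) → Tot ((𝔄.hopfSpace d).tens (𝔄.hopfSpace d)) := fun K =>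
    if K ∈ Finset.Iic x.nTot then 𝔄.term (D K) (D (x.nTot - K)) else 0
  let W : (Fin d → ℕ) → ℝ := fun K => ∏ j, ((x.nTot j).choose (K j) : ℝ)
  have hf0 : ∀ K, K ∉ Finset.Iic x.nTot → f K = 0 := fun K hK => if_neg hK
  have key : ∀ z : DForest d L, 𝔄.Good z.toCForest → z.toCForest.AllCol i → z.nTot = x.nTot →
      𝔄.comulVec z = ∑ K ∈ Finset.Iic x.nTot, W K • f K := by
    intro z h1 h2 h3
    refine HasFSum.fiberwise (g := fun p : Cut 𝔄 z => ∑ v, p.nA v) (w := Cut.coef) (W := W)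
      (f := f) ((hasFSum_comulVec z).congr fun p => ?_)
      (hasFSum_finset _ fun K hK => by rw [hf0 K hK, smul_zero])
      (fun K => Cut.finite_nA_fiber h2 h1.2.1 K) (fun a => ?_) fun K => ?_
    · have h4 := p.A_eq_top h2
      have h5 : (∑ v, p.nA v) ∈ Finset.Iic x.nTot := Finset.mem_Iic.2 (h3 ▸ p.sum_nA_le)
      rw [show f (∑ v, p.nA v) = _ from if_pos h5, term, term,
        hD _ (good_left hU h1 p) (p.allCol_left h2),
        hD _ (good_right hU h1 p) (p.allCol_right_of_top h4), p.nTot_left_of_top h4,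
        p.nTot_right, h3]
    · refine (Finset.Iic x.nTot).finite_toSet.subset fun K hK => ?_
      by_contra h4
      exact hK (congrArg (fun v : Tot _ => v.1 a) (hf0 K h4))
    · refine (Cut.sum_coef_nA_fiber h2 h1.2.1 K).trans ?_
      rw [h3]
  rw [key x hx hx' rfl, key y hy hy' h.symm]

/-- Multiplicativity separates full part and core. Full parts with equal totals have equal
coproducts, and cores may be replaced by their contractions, which are isomorphic. -/
theorem comulVec_eq_of_eqv (hM : 𝔄.MulCoassoc) (hU : 𝔄.Counital)
    (hC : 𝔄.ContractionInvariant) : 𝔄.Inv (d := d) 𝔄.comulVec := by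
  rintro x y hx hy ⟨⟨φ⟩, h⟩
  obtain ⟨h1, h2⟩ := good_full_core hM hx
  obtain ⟨h3, h4⟩ := good_full_core hM hy
  rw [← comulVec_dIso hU (x.decompose i) ((good_mul_iff hM).2 ⟨h1, h2⟩),
    ← comulVec_dIso hU (y.decompose i) ((good_mul_iff hM).2 ⟨h3, h4⟩), comulVec_mul hM,
    comulVec_mul hM, comulVec_eq_of_allCol hU h1 h3 (x.allCol_fullForest i)
      (y.allCol_fullForest i) (by rw [x.nTot_fullForest, y.nTot_fullForest, h]),
    comulVec_contract hU hC h2, comulVec_contract hU hC h4,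
    comulVec_dIso hU φ (good_contract hC h2)]

variable (d) in
/-- The coproduct of `𝓗_i`. -/
noncomputable def comulTri (hM : 𝔄.MulCoassoc) (hU : 𝔄.Counital)
    (hC : 𝔄.ContractionInvariant) :
    Tri (𝔄.hopfSpace d) ((𝔄.hopfSpace d).tens (𝔄.hopfSpace d)) :=
  𝔄.liftTri 𝔄.comulVec (comulVec_eq_of_eqv hM hU hC) fun x _ => suppGE_comulVec x

theorem comulTri_cls (hM : 𝔄.MulCoassoc) (hU : 𝔄.Counital) (hC : 𝔄.ContractionInvariant)
    {x : DForest d L} (hx : 𝔄.Good x.toCForest) :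
    (comulTri d hM hU hC).toLin (𝔄.cls x) = 𝔄.comulVec x :=
  liftTri_cls _ _ hx

end SubforestFamily

end HopfForest

/-! ## Flags of cuts -/

namespace HopfForest

variable {d : ℕ} {L : Type} {i : ℕ}

open Classical in
/-- The sum of `e` over the edges leaving `v`. -/
noncomputable def Forest.out {M : Type*} [AddCommMonoid M] (F : Forest L) (e : F.E → M)
    (v : F.N) : M :=
  ∑ a, if F.src a = v then e a else 0

namespace Forest

variable {M : Type*} [AddCommMonoid M] {F : Forest L}

theorem out_add (e e' : F.E → M) (v : F.N) :
    F.out (fun a => e a + e' a) v = F.out e v + F.out e' v := by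
  classical
  refine Eq.trans (Finset.sum_congr rfl fun a _ => ?_) Finset.sum_add_distrib
  by_cases h : F.src a = v
  · rw [if_pos h, if_pos h, if_pos h]
  · rw [if_neg h, if_neg h, if_neg h, add_zero]

theorem out_congr {e e' : F.E → M} {v : F.N} (h : ∀ a, F.src a = v → e a = e' a) :
    F.out e v = F.out e' v :=
  Finset.sum_congr rfl fun a _ => ite_eq_ite Iff.rfl (h a)

theorem out_eq_zero {e : F.E → M} {v : F.N} (h : ∀ a, F.src a = v → e a = 0) :
    F.out e v = 0 := by
  refine Finset.sum_eq_zero fun a _ => ?_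
  split_ifs with ha
  · exact h a ha
  · rfl

theorem out_mono {e e' : F.E → Fin d → ℕ} (h : ∀ a, e a ≤ e' a) (v : F.N) :
    F.out e v ≤ F.out e' v := by
  refine Finset.sum_le_sum fun a _ => ?_
  split_ifs
  · exact h a
  · exact le_rfl

theorem out_apply (e : F.E → Fin d → ℕ) (v : F.N) (j : Fin d) :
    F.out e v j = F.out (fun a => e a j) v := by
  refine (Finset.sum_apply _ _ _).trans (Finset.sum_congr rfl fun a _ => ?_)
  split_ifs
  · rfl
  · rfl

theorem cast_out (e : F.E → ℕ) (v : F.N) : ((F.out e v : ℕ) : ℤ) = F.out (fun a => (e a : ℤ)) v := by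
  refine (Nat.cast_sum _ _).trans (Finset.sum_congr rfl fun a _ => ?_)
  split_ifs
  · rfl
  · rfl

open Classical in
theorem out_restr {B : Subforest F} (e : F.E → M) (v : (F.restr B).N) :
    (F.restr B).out (fun a => e a.1) v = F.out (fun a => if a ∈ B.E then e a else 0) v.1 := by
  let g : F.E → M := fun a => if F.src a = v.1 then (if a ∈ B.E then e a else 0) else 0
  refine Eq.trans (Finset.sum_congr rfl fun a _ => ?_)
    (sum_subtype_eq_sum (inst := instFintypeE (F.restr B)) g fun a ha => ?_)
  · refine ite_eq_ite Subtype.ext_iff fun _ => ?_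
    exact (if_pos a.2).symm
  · change (if F.src a = v.1 then (if a ∈ B.E then e a else 0) else 0) = 0
    rw [if_neg ha, ite_self]

end Forest

variable {𝔄 : SubforestFamily L i} {x : DForest d L}

namespace Cut

/-- The larger subforest of a flag of cuts. -/
def big (p : Cut 𝔄 x) (q : Cut 𝔄 p.right) : Subforest x.toForest := q.A

/-- The values `𝔫_B` of a flag of cuts. -/
def bigN (p : Cut 𝔄 x) (q : Cut 𝔄 p.right) : x.N → Fin d → ℕ := q.nA

/-- The values `ε_B` of a flag of cuts. -/
def bigEps (p : Cut 𝔄 x) (q : Cut 𝔄 p.right) : x.E → Fin d → ℕ := q.eps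

theorem bigN_eq_zero (p : Cut 𝔄 x) (q : Cut 𝔄 p.right) {v : x.N} (h : v ∉ (p.big q).N) :
    p.bigN q v = 0 :=
  q.nA_supp v h

theorem bigEps_eq_zero (p : Cut 𝔄 x) (q : Cut 𝔄 p.right) {a : x.E}
    (h : ¬ (a ∉ (p.big q).E ∧ x.src a ∈ (p.big q).N)) : p.bigEps q a = 0 :=
  q.eps_supp a h

open Classical in
/-- The part of `ε` on the edges outside the second subforest of a flag. -/
noncomputable def outEps (p : Cut 𝔄 x) (q : Cut 𝔄 p.right) : x.E → Fin d → ℕ :=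
  fun a => if a ∈ (p.big q).E then 0 else p.eps a

/-- The exchange property read from left to right: `p.right` is the forest of `x` recoloured by `A`,
so an admissible subforest of it yields an admissible `B ⊇ A` of `x` in which `A` is admissible. -/
theorem flag (hM : 𝔄.MulCoassoc) (p : Cut 𝔄 x) (q : Cut 𝔄 p.right) :
    p.big q ∈ 𝔄.adm x.toCForest ∧
    p.A ≤ p.big q ∧
    p.A.within (p.big q) ∈ 𝔄.adm (x.toCForest.restr (p.big q)) :=
  (hM.exchange x.toCForest p.A q.A).1 ⟨p.mem, q.mem⟩

theorem outEps_eq_zero (p : Cut 𝔄 x) (q : Cut 𝔄 p.right) {a : x.E} (h : x.src a ∉ p.A.N) :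
    p.outEps q a = 0 := by
  unfold outEps
  split_ifs
  · rfl
  · exact p.eps_supp a fun h' => h h'.2

/-- The larger subforest of a flag, as a cut. -/
noncomputable def outer (hM : 𝔄.MulCoassoc) (p : Cut 𝔄 x) (q : Cut 𝔄 p.right) : Cut 𝔄 x where
  A := p.big q
  mem := (p.flag hM q).1
  nA := fun (v : x.N) => p.nA v + p.bigN q v
  -- Edges that leave `A` within `B` are no boundary edges of `B`; only the part of `ε_A` outside
  -- `E_B` joins `ε_B`.
  eps := fun (a : x.E) => p.outEps q a + p.bigEps q a
  nA_supp := by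
    intro (v : x.N) hv
    rw [p.nA_supp v fun h => hv ((p.flag hM q).2.1.1 h), p.bigN_eq_zero q hv, add_zero]
  nA_le := by
    intro (v : x.N) j
    have h1 : p.bigN q v j ≤ x.nn v j - p.nA v j := q.nA_le v j
    have h2 : p.nA v j ≤ x.nn v j := p.nA_le v j
    change p.nA v j + p.bigN q v j ≤ x.nn v j
    omega
  eps_supp := by
    intro (a : x.E) h
    rw [p.bigEps_eq_zero q h, add_zero]
    by_cases h1 : a ∈ (p.big q).E
    · exact if_pos h1
    · exact p.outEps_eq_zero q fun h2 => h ⟨h1, (p.flag hM q).2.1.1 h2⟩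

/-- The smaller subforest of a flag, as a cut of the larger one. -/
noncomputable def inner (hM : 𝔄.MulCoassoc) (p : Cut 𝔄 x) (q : Cut 𝔄 p.right) :
    Cut 𝔄 (p.outer hM q).left where
  A := p.A.within (p.big q)
  mem := (p.flag hM q).2.2
  -- Within `B` the values of `ε_A` on edges leaving `B` are visible only through the `π ε` already
  -- added to the node decoration. They must be assigned to `A`, so they enter the decoration chosen
  -- by the inner cut.
  nA v := p.nA v.1 + x.out (p.outEps q) v.1
  eps a := p.eps a.1
  nA_supp v hv := by
    rw [p.nA_supp v.1 hv, zero_add]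
    refine Forest.out_eq_zero fun a ha => p.outEps_eq_zero q fun h => hv ?_
    rw [ha] at h
    exact h
  nA_le v := by
    change p.nA v.1 + x.out (p.outEps q) v.1 ≤
      p.nA v.1 + p.bigN q v.1 + x.out (fun a : x.E => p.outEps q a + p.bigEps q a) v.1
    exact add_le_add le_self_add (Forest.out_mono (fun a => le_self_add) _)
  eps_supp a h := p.eps_supp a.1 h

/-- The first factor. -/
noncomputable def flagFst (hM : 𝔄.MulCoassoc) (p : Cut 𝔄 x) (q : Cut 𝔄 p.right) :
    DIso (p.inner hM q).left p.left :=
  DIso.ofBijective (x := (p.inner hM q).left) (y := p.left) (fun v => ⟨v.1.1, v.2⟩)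
    (fun a => ⟨a.1.1, a.2⟩)
    ⟨by
      rintro ⟨⟨v, hv⟩, hv'⟩ ⟨⟨w, hw⟩, hw'⟩ h
      cases Subtype.ext_iff.1 h
      rfl,
      fun v => ⟨⟨⟨v.1, (p.flag hM q).2.1.1 v.2⟩, v.2⟩, rfl⟩⟩
    ⟨by
      rintro ⟨⟨v, hv⟩, hv'⟩ ⟨⟨w, hw⟩, hw'⟩ h
      cases Subtype.ext_iff.1 h
      rfl,
      fun v => ⟨⟨⟨v.1, (p.flag hM q).2.1.2 v.2⟩, v.2⟩, rfl⟩⟩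
    (fun _ => rfl) (fun _ => rfl) (fun _ => rfl) (fun _ => rfl) (fun _ => rfl)
    (fun (v : {v : (x.toForest.restr (p.big q)).N // v.1 ∈ p.A.N}) => by
      classical
      change p.nA v.1.1 + x.out p.eps v.1.1 = p.nA v.1.1 + x.out (p.outEps q) v.1.1 +
        (x.toForest.restr (p.big q)).out (fun a => p.eps a.1) v.1
      rw [Forest.out_restr, add_assoc, ← Forest.out_add]
      refine congrArg _ (Forest.out_congr fun a _ => ?_)
      unfold outEps
      by_cases h : a ∈ (p.big q).E
      · rw [if_pos h, if_pos h, zero_add]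
      · rw [if_neg h, if_neg h, add_zero])
    (fun _ => rfl) (fun _ => rfl)

/-- The second factor. -/
noncomputable def flagSnd (hM : 𝔄.MulCoassoc) (p : Cut 𝔄 x) (q : Cut 𝔄 p.right) :
    DIso (p.inner hM q).right q.left where
  eN := Equiv.refl _
  eE := Equiv.refl _
  src _ := rfl
  tgt _ := rfl
  typ _ := rfl
  cN _ := ite_eq_of_iff Iff.rfl
  cE _ := ite_eq_of_iff Iff.rfl
  nn := by
    intro (v : (x.toForest.restr (p.big q)).N)
    change p.bigN q v.1 + x.out (p.bigEps q) v.1 =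
      (p.nA v.1 + p.bigN q v.1 + x.out (fun a : x.E => p.outEps q a + p.bigEps q a) v.1) -
        (p.nA v.1 + x.out (p.outEps q) v.1)
    refine (tsub_eq_of_eq_add ?_).symm
    rw [Forest.out_add]
    exact (add_add_add_comm _ _ _ _).trans (add_comm _ _)
  oo := by
    intro (v : (x.toForest.restr (p.big q)).N)
    classical
    change x.oo v.1 + (fun j => (p.nA v.1 j : ℤ) + x.out (fun a => (p.eps a j : ℤ) -
        if a ∈ p.A.E then (x.ee a j : ℤ) else 0) v.1, 0) =
      x.oo v.1 + (fun j => ((p.nA v.1 + x.out (p.outEps q) v.1) j : ℤ) +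
        (x.toForest.restr (p.big q)).out (fun a => (p.eps a.1 j : ℤ) -
          if a.1 ∈ p.A.E then (x.ee a.1 j : ℤ) else 0) v, 0)
    refine congrArg (x.oo v.1 + ·) (Prod.ext (funext fun j => ?_) rfl)
    change (p.nA v.1 j : ℤ) + _ = ((p.nA v.1 j + x.out (p.outEps q) v.1 j : ℕ) : ℤ) + _
    rw [Nat.cast_add, Forest.out_apply, Forest.cast_out, add_assoc, Forest.out_restr
      (fun a => (p.eps a j : ℤ) - if a ∈ p.A.E then (x.ee a j : ℤ) else 0), ← Forest.out_add]
    refine congrArg _ (Forest.out_congr fun a _ => ?_)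
    unfold outEps
    by_cases h : a ∈ (p.big q).E
    · rw [if_pos h, if_pos h]
      simp
    · rw [if_neg h, if_neg h, if_neg fun h' => h ((p.flag hM q).2.1.2 h')]
      simp
  ee _ := congrArg (· + _) (ite_eq_of_iff Iff.rfl)

/-- The third factor. -/
noncomputable def flagThd (hM : 𝔄.MulCoassoc) (p : Cut 𝔄 x) (q : Cut 𝔄 p.right) :
    DIso (p.outer hM q).right q.right where
  eN := Equiv.refl _
  eE := Equiv.refl _
  src _ := rfl
  tgt _ := rfl
  typ _ := rfl
  cN := by
    intro (v : x.N)
    classical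
    change (if v ∈ (p.big q).N then i else if v ∈ p.A.N then i else x.cN v) =
      if v ∈ (p.big q).N then i else x.cN v
    split_ifs with h1 h2
    · rfl
    · exact absurd ((p.flag hM q).2.1.1 h2) h1
    · rfl
  cE := by
    intro (v : x.E)
    classical
    change (if v ∈ (p.big q).E then i else if v ∈ p.A.E then i else x.cE v) =
      if v ∈ (p.big q).E then i else x.cE v
    split_ifs with h1 h2
    · rfl
    · exact absurd ((p.flag hM q).2.1.2 h2) h1
    · rfl
  nn := by
    intro (v : x.N)
    exact tsub_tsub (x.nn v) (p.nA v) (p.bigN q v)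
  oo := by
    intro (v : x.N)
    classical
    change (x.oo v + (fun j => (p.nA v j : ℤ) + x.out (fun a => (p.eps a j : ℤ) -
        if a ∈ p.A.E then (x.ee a j : ℤ) else 0) v, 0)) +
        (fun j => (p.bigN q v j : ℤ) + x.out (fun a : x.E => (p.bigEps q a j : ℤ) -
          if a ∈ (p.big q).E then
            ((((if a ∈ p.A.E then 0 else x.ee a) + p.eps a) j : ℕ) : ℤ) else 0) v, 0) =
      x.oo v + (fun j => ((p.nA v j + p.bigN q v j : ℕ) : ℤ) + x.out (fun a : x.E =>
        ((p.outEps q a j + p.bigEps q a j : ℕ) : ℤ) -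
          if a ∈ (p.big q).E then (x.ee a j : ℤ) else 0) v, 0)
    rw [add_assoc]
    refine congrArg (x.oo v + ·) (Prod.ext (funext fun j => ?_) (add_zero _))
    change ((p.nA v j : ℤ) + _) + ((p.bigN q v j : ℤ) + _) = _
    rw [add_add_add_comm, ← Forest.out_add, ← Nat.cast_add]
    refine congrArg _ (Forest.out_congr fun a _ => ?_)
    unfold outEps
    by_cases h : a ∈ (p.big q).E
    · rw [if_pos h, if_pos h, if_pos h]
      by_cases h' : a ∈ p.A.E
      · rw [if_pos h', if_pos h', p.eps_supp a fun h2 => h2.1 h']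
        simp
        ring
      -- On an edge of `B` outside `A` the first cut adds `ε_A` to `𝔬` and the second removes `𝔢 +
      -- ε_A`; together only `𝔢` is removed, as in the outer cut.
      · rw [if_neg h', if_neg h', Pi.add_apply]
        push_cast
        simp
        ring
    · rw [if_neg h, if_neg h, if_neg h, if_neg fun h' => h ((p.flag hM q).2.1.2 h')]
      push_cast
      ring
  ee := by
    intro (a : x.E)
    classical
    change (if a ∈ (p.big q).E then 0 else (if a ∈ p.A.E then 0 else x.ee a) + p.eps a) +
      p.bigEps q a = (if a ∈ (p.big q).E then 0 else x.ee a) + (p.outEps q a + p.bigEps q a)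
    unfold outEps
    by_cases h : a ∈ (p.big q).E
    · rw [if_pos h, if_pos h, if_pos h, zero_add, zero_add]
    · rw [if_neg h, if_neg h, if_neg h, if_neg fun h' => h ((p.flag hM q).2.1.2 h'), add_assoc]

end Cut
end HopfForest

/-! ## Comparison of the two kinds of flags of cuts -/

namespace HopfForest

variable {d : ℕ} {L : Type} {i : ℕ}

/-- A subforest of a subforest as a subforest. -/
def Subforest.lift {F : Forest L} {B : Subforest F} (C : Subforest (F.restr B)) : Subforest F where
  N := {v | ∃ h : v ∈ B.N, (⟨v, h⟩ : {v // v ∈ B.N}) ∈ C.N}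
  E := {a | ∃ h : a ∈ B.E, (⟨a, h⟩ : {a // a ∈ B.E}) ∈ C.E}
  src_mem := fun _ ⟨_, h⟩ => ⟨_, C.src_mem _ h⟩
  tgt_mem := fun _ ⟨_, h⟩ => ⟨_, C.tgt_mem _ h⟩

theorem Subforest.lift_le {F : Forest L} {B : Subforest F} (C : Subforest (F.restr B)) :
    Subforest.lift C ≤ B :=
  ⟨fun _ h => h.1, fun _ h => h.1⟩

theorem Subforest.within_lift {F : Forest L} {B : Subforest F} (C : Subforest (F.restr B)) :
    (Subforest.lift C).within B = C := by
  ext a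
  · exact ⟨fun h => h.2, fun h => ⟨a.2, h⟩⟩
  · exact ⟨fun h => h.2, fun h => ⟨a.2, h⟩⟩

theorem Subforest.lift_within {F : Forest L} {A B : Subforest F} (h : A ≤ B) :
    Subforest.lift (A.within B) = A := by
  ext a
  · exact ⟨fun h => h.2, fun h' => ⟨h.1 h', h'⟩⟩
  · exact ⟨fun h => h.2, fun h' => ⟨h.2 h', h'⟩⟩

variable {𝔄 : SubforestFamily L i} {x : DForest d L}

namespace Cut

open Classical in
/-- The values `𝔫_A` of a cut of the left part of a cut, extended by zero. -/
noncomputable def extN (p : Cut 𝔄 x) (q : Cut 𝔄 p.left) : x.N → Fin d → ℕ :=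
  fun v => if h : v ∈ p.A.N then q.nA ⟨v, h⟩ else 0

open Classical in
/-- The values `ε_A` of a cut of the left part of a cut, extended by zero. -/
noncomputable def extEps (p : Cut 𝔄 x) (q : Cut 𝔄 p.left) : x.E → Fin d → ℕ :=
  fun a => if h : a ∈ p.A.E then q.eps ⟨a, h⟩ else 0

/-- The subforest of a cut of the left part of a cut, as a subforest. -/
def small (p : Cut 𝔄 x) (q : Cut 𝔄 p.left) : Subforest x.toForest :=
  Subforest.lift (B := p.A) q.A

theorem extN_of_mem (p : Cut 𝔄 x) (q : Cut 𝔄 p.left) (v : {v // v ∈ p.A.N}) :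
    p.extN q v.1 = q.nA v :=
  dif_pos v.2

theorem extEps_of_mem (p : Cut 𝔄 x) (q : Cut 𝔄 p.left) (a : {a // a ∈ p.A.E}) :
    p.extEps q a.1 = q.eps a :=
  dif_pos a.2

/-- The second components live over different types. Comparing their extensions to `x` avoids
transport along the equality of the first components. -/
theorem sigma_left_ext {s t : Σ p : Cut 𝔄 x, Cut 𝔄 p.left} (h : s.1 = t.1)
    (hA : s.1.small s.2 = t.1.small t.2) (hn : s.1.extN s.2 = t.1.extN t.2)
    (he : s.1.extEps s.2 = t.1.extEps t.2) : s = t := by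
  obtain ⟨p, q⟩ := s
  obtain ⟨p', q'⟩ := t
  obtain rfl : p = p' := h
  refine congrArg (Sigma.mk p) (Cut.ext_of ?_ (funext fun v => ?_) (funext fun a => ?_))
  · exact (Subforest.within_lift (B := p.A) q.A).symm.trans
      ((congrArg (Subforest.within · p.A) hA).trans (Subforest.within_lift (B := p.A) q'.A))
  · exact (p.extN_of_mem q v).symm.trans ((congrFun hn v.1).trans (p.extN_of_mem q' v))
  · exact (p.extEps_of_mem q a).symm.trans ((congrFun he a.1).trans (p.extEps_of_mem q' a))

/-- From flags with a cut of the right part to flags with a cut of the left part. -/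
noncomputable def flagMap (hM : 𝔄.MulCoassoc) (r : Σ p : Cut 𝔄 x, Cut 𝔄 p.right) :
    Σ p : Cut 𝔄 x, Cut 𝔄 p.left :=
  ⟨r.1.outer hM r.2, r.1.inner hM r.2⟩

/-- The parameters of the fibres of `flagMap`. -/
noncomputable def flagParam (r : Σ p : Cut 𝔄 x, Cut 𝔄 p.right) : x.N ⊕ x.E → Fin d → ℕ :=
  Sum.elim r.1.nA (r.1.outEps r.2)

theorem small_flagMap (hM : 𝔄.MulCoassoc) (r : Σ p : Cut 𝔄 x, Cut 𝔄 p.right) :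
    (flagMap hM r).1.small (flagMap hM r).2 = r.1.A :=
  Subforest.lift_within (r.1.flag hM r.2).2.1

theorem extN_flagMap (hM : 𝔄.MulCoassoc) (r : Σ p : Cut 𝔄 x, Cut 𝔄 p.right) (v : x.N) :
    (flagMap hM r).1.extN (flagMap hM r).2 v = r.1.nA v + x.out (r.1.outEps r.2) v := by
  by_cases h : v ∈ (r.1.big r.2).N
  · exact dif_pos h
  · have h' : v ∉ r.1.A.N := fun h' => h ((r.1.flag hM r.2).2.1.1 h')
    rw [r.1.nA_supp v h', zero_add, Forest.out_eq_zero]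
    · exact dif_neg h
    · intro a ha
      exact r.1.outEps_eq_zero r.2 (by rwa [ha])

/-- The part of `ε_A` inside `B` can be read off from the image under `flagMap`; the part outside is
a free parameter of the fibre. -/
theorem eps_eq_add (hM : 𝔄.MulCoassoc) (r : Σ p : Cut 𝔄 x, Cut 𝔄 p.right) (a : x.E) :
    r.1.eps a = r.1.outEps r.2 a + (flagMap hM r).1.extEps (flagMap hM r).2 a := by
  by_cases h : a ∈ (r.1.big r.2).E
  · rw [show r.1.outEps r.2 a = 0 from if_pos h, zero_add]
    exact ((flagMap hM r).1.extEps_of_mem (flagMap hM r).2 ⟨a, h⟩).symm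
  · rw [show r.1.outEps r.2 a = r.1.eps a from if_neg h]
    refine left_eq_add.2 (dif_neg h)

theorem outEps_or_extEps (hM : 𝔄.MulCoassoc) (r : Σ p : Cut 𝔄 x, Cut 𝔄 p.right) (a : x.E) :
    r.1.outEps r.2 a = 0 ∨ (flagMap hM r).1.extEps (flagMap hM r).2 a = 0 := by
  by_cases h : a ∈ (r.1.big r.2).E
  · exact Or.inl (if_pos h)
  · exact Or.inr (dif_neg h)

-- It identifies the constraint on a fibre of `flagMap` as a Vandermonde condition for the map from
-- nodes and edges to nodes that is the identity on nodes and `src` on edges.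
open Classical in
theorem sum_elim_out (m : x.N ⊕ x.E → Fin d → ℕ) (X : x.N) :
    (∑ v, if Sum.elim id x.src v = X then m v else 0) =
      m (.inl X) + x.out (fun a => m (.inr a)) X := by
  rw [Fintype.sum_sum_type]
  refine congrArg₂ (· + ·) ?_ rfl
  exact (Finset.sum_ite_eq' Finset.univ X _).trans (if_pos (Finset.mem_univ _))

-- Given the outer and the inner cut, the remaining freedom is which part of the outer `𝔫` and of
-- the outer `ε` came from `A`. The one constraint is that `𝔫_A` plus the outgoing `ε_A` at each
-- node is the decoration chosen by the inner cut.
open Classical in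
theorem bijOn_flagParam (hM : 𝔄.MulCoassoc) (t : Σ p : Cut 𝔄 x, Cut 𝔄 p.left) :
    Set.BijOn flagParam (flagMap hM ⁻¹' {t})
      {m | m ≤ Sum.elim t.1.nA t.1.eps ∧
        ∀ X, (∑ v, if Sum.elim id x.src v = X then m v else 0) = t.1.extN t.2 X} := by
  refine ⟨?_, ?_, ?_⟩
  · rintro r rfl
    refine ⟨?_, fun X => ?_⟩
    · rintro (v | a)
      · exact le_self_add
      · exact le_self_add
    · rw [sum_elim_out, extN_flagMap]
      rfl
  · rintro ⟨p, q⟩ hr ⟨p', q'⟩ hr' hm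
    have h : flagMap hM ⟨p, q⟩ = flagMap hM ⟨p', q'⟩ := Eq.trans hr (Eq.symm hr')
    have hN : p.nA = p'.nA := funext fun v => congrFun hm (.inl v)
    have hO : p.outEps q = p'.outEps q' := funext fun a => congrFun hm (.inr a)
    have hA : p.A = p'.A := by
      refine (small_flagMap hM ⟨p, q⟩).symm.trans (Eq.trans ?_ (small_flagMap hM ⟨p', q'⟩))
      rw [h]
    have hE : p.eps = p'.eps := funext fun a => by
      refine (eps_eq_add hM ⟨p, q⟩ a).trans (Eq.trans ?_ (eps_eq_add hM ⟨p', q'⟩ a).symm)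
      rw [h]
      exact congrArg (· + _) (congrFun hO a)
    obtain rfl := Cut.ext_of hA hN hE
    have h1 : (flagMap hM ⟨p, q⟩).1.nA = (flagMap hM ⟨p, q'⟩).1.nA := by rw [h]
    have h2 : (flagMap hM ⟨p, q⟩).1.eps = (flagMap hM ⟨p, q'⟩).1.eps := by rw [h]
    have h3 : (flagMap hM ⟨p, q⟩).1.A = (flagMap hM ⟨p, q'⟩).1.A := by rw [h]
    refine congrArg (Sigma.mk p) (Cut.ext_of h3 (funext fun v => ?_) (funext fun a => ?_))
    · exact add_left_cancel (congrFun h1 v)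
    · have h4 : p.outEps q a + p.bigEps q a = p.outEps q' a + p.bigEps q' a := congrFun h2 a
      rw [hO] at h4
      exact add_left_cancel h4
  · rintro m ⟨hm, hX⟩
    obtain ⟨t, s⟩ := t
    -- Off `A` the prescribed sum is zero, and a vanishing sum of natural numbers has vanishing
    -- summands.
    have hX' : ∀ X, X ∉ (t.small s).N → m (.inl X) = 0 ∧ ∀ a, x.src a = X → m (.inr a) = 0 := by
      intro X h
      have h1 := hX X
      have h2 : t.extN s X = 0 := by
        by_cases hB : X ∈ t.A.N
        · refine (dif_pos hB).trans (s.nA_supp _ fun h' => h ⟨hB, h'⟩)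
        · exact dif_neg hB
      rw [h2, Finset.sum_eq_zero_iff] at h1
      refine ⟨?_, fun a ha => ?_⟩
      · have h3 := h1 (.inl X) (Finset.mem_univ _)
        rwa [if_pos (show Sum.elim id x.src (.inl X) = X from rfl)] at h3
      · have h3 := h1 (.inr a) (Finset.mem_univ _)
        rwa [if_pos (show Sum.elim id x.src (.inr a) = X from ha)] at h3
    have hB : ∀ a, a ∈ t.A.E → m (.inr a) = 0 := by
      intro a ha
      have h1 : m (.inr a) ≤ t.eps a := hm (.inr a)
      rw [t.eps_supp a fun h => h.1 ha] at h1
      exact le_antisymm h1 (zero_le)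
    have hN : ∀ v, m (.inl v) ≤ t.nA v := fun v => hm (.inl v)
    have hE : ∀ a, m (.inr a) ≤ t.eps a := fun a => hm (.inr a)
    -- The exchange property read from right to left produces the cut by `A` of `x` and the cut by
    -- `B` of the recoloured forest.
    obtain ⟨hA, hcup⟩ := (hM.exchange x.toCForest (t.small s) t.A).2
      ⟨t.mem, Subforest.lift_le (B := t.A) s.A, by
        refine Set.mem_of_eq_of_mem ?_ s.mem
        exact Subforest.within_lift (B := t.A) s.A⟩
    let p : Cut 𝔄 x :=
      { A := t.small s
        mem := hA
        nA := fun v => m (.inl v)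
        eps := fun a => m (.inr a) + t.extEps s a
        nA_supp := fun v hv => (hX' v hv).1
        nA_le := fun v => (hN v).trans (t.nA_le v)
        eps_supp := fun a ha => by
          by_cases h1 : a ∈ t.A.E
          · rw [hB a h1, zero_add]
            refine (dif_pos h1).trans (s.eps_supp _ fun h => ha ⟨fun h2 => h.1 h2.2, ?_⟩)
            exact ⟨t.A.src_mem a h1, h.2⟩
          · rw [show t.extEps s a = 0 from dif_neg h1, add_zero]
            exact (hX' (x.src a) fun h => ha ⟨fun h2 => h1 h2.1, h⟩).2 a rfl }
    -- The second cut receives what `m` leaves over of the decorations of the outer cut.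
    let q : Cut 𝔄 p.right :=
      { A := t.A
        mem := hcup
        nA := fun v : x.N => t.nA v - m (.inl v)
        eps := fun a : x.E => t.eps a - m (.inr a)
        nA_supp := fun (v : x.N) hv => by rw [t.nA_supp v hv, zero_tsub]
        nA_le := fun (v : x.N) => tsub_le_tsub_right (t.nA_le v) (m (.inl v))
        eps_supp := fun (a : x.E) ha => by rw [t.eps_supp a ha, zero_tsub] }
    have hO : ∀ a, p.outEps q a = m (.inr a) := by
      intro a
      by_cases h : a ∈ t.A.E
      · rw [hB a h]
        exact if_pos h
      · refine (if_neg h).trans ?_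
        change m (.inr a) + t.extEps s a = _
        rw [show t.extEps s a = 0 from dif_neg h, add_zero]
    refine ⟨⟨p, q⟩, sigma_left_ext ?_ ?_ ?_ ?_, ?_⟩
    · refine Cut.ext_of rfl (funext fun v => add_tsub_cancel_of_le (hN v)) (funext fun a => ?_)
      change p.outEps q a + (t.eps a - m (.inr a)) = t.eps a
      rw [hO, add_tsub_cancel_of_le (hE a)]
    · exact small_flagMap hM ⟨p, q⟩
    · refine funext fun v => (extN_flagMap hM ⟨p, q⟩ v).trans ?_
      refine Eq.trans ?_ ((sum_elim_out m v).symm.trans (hX v))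
      exact congrArg (m (.inl v) + ·) (Forest.out_congr fun a _ => hO a)
    · refine funext fun a => ?_
      have h1 := eps_eq_add hM ⟨p, q⟩ a
      rw [hO] at h1
      exact (add_left_cancel h1).symm
    · refine funext ?_
      rintro (v | a)
      · rfl
      · exact hO a

end Cut
end HopfForest

/-! ## Coassociativity -/

namespace HopfForest

theorem choose_mul_choose_sub {n k l : ℕ} :
    n.choose k * (n - k).choose l = n.choose (k + l) * (k + l).choose k := by
  rw [Nat.choose_mul (Nat.le_add_right k l), Nat.add_sub_cancel_left]

open scoped Nat in
theorem inv_factorial_mul (a b : ℕ) :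
    (1 / (a ! : ℝ)) * (1 / (b ! : ℝ)) = 1 / ((a + b)! : ℝ) * ((a + b).choose a : ℝ) := by
  have h := Nat.add_choose_mul_factorial_mul_factorial a b
  rw [← Nat.choose_symm_add] at h
  have h1 : (a ! : ℝ) ≠ 0 := Nat.cast_ne_zero.2 a.factorial_ne_zero
  have h2 : (b ! : ℝ) ≠ 0 := Nat.cast_ne_zero.2 b.factorial_ne_zero
  have h3 : ((a + b)! : ℝ) ≠ 0 := Nat.cast_ne_zero.2 (a + b).factorial_ne_zero
  have h4 : ((a + b).choose a : ℝ) * a ! * b ! = (a + b)! := by exact_mod_cast h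
  field_simp
  linarith

namespace BiSpace

universe u v

variable {V : BiSpace.{u}} {W : BiSpace.{v}}

theorem hasFSum_tmul_right {P : Type*} {t : P → Tot V} {s : Tot V} (h : HasFSum t s) (w : Tot W) :
    HasFSum (fun p => tmul (t p) w) (tmul s w) := by
  obtain ⟨k, hk⟩ := h.bdd
  obtain ⟨l, hl⟩ := exists_suppGE w
  refine ⟨⟨k + l, fun p => SuppGE.tmul (hk p) hl⟩, fun a => ?_, fun a => ?_⟩
  · refine (h.fin a.1).subset fun p hp h0 => hp ?_
    change (t p).1 a.1 ⊗ₜ[ℝ] w.1 a.2 = 0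
    rw [show (t p).1 a.1 = 0 from h0, TensorProduct.zero_tmul]
  · change s.1 a.1 ⊗ₜ[ℝ] w.1 a.2 = _
    rw [h.eq]
    exact ((TensorProduct.mk ℝ (V.V a.1) (W.V a.2)).flip (w.1 a.2)).toAddMonoidHom.map_finsum
      (h.fin a.1)

theorem hasFSum_tmul_left {P : Type*} {t : P → Tot W} {s : Tot W} (h : HasFSum t s) (w : Tot V) :
    HasFSum (fun p => tmul w (t p)) (tmul w s) := by
  obtain ⟨k, hk⟩ := h.bdd
  obtain ⟨l, hl⟩ := exists_suppGE w
  refine ⟨⟨l + k, fun p => SuppGE.tmul hl (hk p)⟩, fun a => ?_, fun a => ?_⟩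
  · refine (h.fin a.2).subset fun p hp h0 => hp ?_
    change w.1 a.1 ⊗ₜ[ℝ] (t p).1 a.2 = 0
    rw [show (t p).1 a.2 = 0 from h0, TensorProduct.tmul_zero]
  · change w.1 a.1 ⊗ₜ[ℝ] s.1 a.2 = _
    rw [h.eq]
    exact (TensorProduct.mk ℝ (V.V a.1) (W.V a.2) (w.1 a.1)).toAddMonoidHom.map_finsum
      (h.fin a.2)

end BiSpace

variable {d : ℕ} {L : Type} {i : ℕ} {𝔄 : SubforestFamily L i} {x : DForest d L}

namespace Cut

open scoped Nat in
/-- The part of the coefficient of a flag which is constant on the fibres of `flagMap`. -/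
noncomputable def flagConst (t : Σ p : Cut 𝔄 x, Cut 𝔄 p.left) : ℝ :=
  t.1.coef * ∏ a, ∏ j, (1 / ((t.1.extEps t.2 a j)! : ℝ))

/-- For `𝔫` this is choosing a subset in two stages; for `ε` it is the binomial relating `1 / (a!
b!)` to `1 / (a + b)!`. The factorials of `ε_A` split because its parts inside and outside `B` have
disjoint supports. What varies in the fibre is a product of binomials in the parameter. -/
theorem coef_flag (hM : 𝔄.MulCoassoc) (r : Σ p : Cut 𝔄 x, Cut 𝔄 p.right) :
    r.1.coef * r.2.coef = flagConst (flagMap hM r) * ∏ v, ∏ j,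
      ((Sum.elim (flagMap hM r).1.nA (flagMap hM r).1.eps v j).choose (flagParam r v j) : ℝ) := by
  obtain ⟨p, q⟩ := r
  rw [prod_sum_eq]
  change ((∏ a, ∏ j, (1 / ((p.eps a j).factorial : ℝ))) *
      ∏ v, ∏ j, ((x.nn v j).choose (p.nA v j) : ℝ)) *
    ((∏ a, ∏ j, (1 / ((p.bigEps q a j).factorial : ℝ))) *
      ∏ v, ∏ j, ((x.nn v j - p.nA v j).choose (p.bigN q v j) : ℝ)) =
    ((∏ a, ∏ j, (1 / ((p.outEps q a j + p.bigEps q a j).factorial : ℝ))) *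
      ∏ v, ∏ j, ((x.nn v j).choose (p.nA v j + p.bigN q v j) : ℝ)) *
    (∏ a, ∏ j, (1 / ((((flagMap hM ⟨p, q⟩).1.extEps (flagMap hM ⟨p, q⟩).2 a j).factorial : ℕ) : ℝ))) *
    ((∏ v, ∏ j, ((p.nA v j + p.bigN q v j).choose (p.nA v j) : ℝ)) *
      ∏ a, ∏ j, ((p.outEps q a j + p.bigEps q a j).choose (p.outEps q a j) : ℝ))
  have h1 : (∏ v, ∏ j, ((x.nn v j).choose (p.nA v j) : ℝ)) *
      (∏ v, ∏ j, ((x.nn v j - p.nA v j).choose (p.bigN q v j) : ℝ)) =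
      (∏ v, ∏ j, ((x.nn v j).choose (p.nA v j + p.bigN q v j) : ℝ)) *
        ∏ v, ∏ j, ((p.nA v j + p.bigN q v j).choose (p.nA v j) : ℝ) := by
    simp only [← Finset.prod_mul_distrib]
    refine Finset.prod_congr rfl fun v _ => Finset.prod_congr rfl fun j _ => ?_
    exact_mod_cast choose_mul_choose_sub
  have h2 : (∏ a, ∏ j, (1 / ((p.outEps q a j).factorial : ℝ))) *
      (∏ a, ∏ j, (1 / ((p.bigEps q a j).factorial : ℝ))) =
      (∏ a, ∏ j, (1 / ((p.outEps q a j + p.bigEps q a j).factorial : ℝ))) *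
        ∏ a, ∏ j, ((p.outEps q a j + p.bigEps q a j).choose (p.outEps q a j) : ℝ) := by
    simp only [← Finset.prod_mul_distrib]
    exact Finset.prod_congr rfl fun v _ => Finset.prod_congr rfl fun j _ => inv_factorial_mul _ _
  have h3 : (∏ a, ∏ j, (1 / ((p.eps a j).factorial : ℝ))) =
      (∏ a, ∏ j, (1 / ((p.outEps q a j).factorial : ℝ))) *
      ∏ a, ∏ j,
        (1 / ((((flagMap hM ⟨p, q⟩).1.extEps (flagMap hM ⟨p, q⟩).2 a j).factorial : ℕ) : ℝ)) := by
    simp only [← Finset.prod_mul_distrib]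
    refine Finset.prod_congr rfl fun a _ => Finset.prod_congr rfl fun j _ => ?_
    have h4 : p.eps a j = p.outEps q a j + (flagMap hM ⟨p, q⟩).1.extEps (flagMap hM ⟨p, q⟩).2 a j :=
      congrFun (eps_eq_add hM ⟨p, q⟩ a) j
    rw [h4]
    rcases outEps_or_extEps hM ⟨p, q⟩ a with h | h
    · rw [show p.outEps q a j = 0 from congrFun h j]
      simp
    · rw [show (flagMap hM ⟨p, q⟩).1.extEps (flagMap hM ⟨p, q⟩).2 a j = 0 from congrFun h j]
      simp
  rw [h3]
  linear_combination (∏ a, ∏ j, (1 / ((((flagMap hM ⟨p, q⟩).1.extEps (flagMap hM ⟨p, q⟩).2 a j).factorial : ℕ) : ℝ))) *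
    ((∏ v, ∏ j, ((x.nn v j).choose (p.nA v j) : ℝ)) *
      (∏ v, ∏ j, ((x.nn v j - p.nA v j).choose (p.bigN q v j) : ℝ)) * h2 +
     ((∏ a, ∏ j, (1 / ((p.outEps q a j + p.bigEps q a j).factorial : ℝ))) *
        ∏ a, ∏ j, ((p.outEps q a j + p.bigEps q a j).choose (p.outEps q a j) : ℝ)) * h1)

/-- The node decoration of the left part is `𝔫 + π ε` of the outer cut, so the binomials of the
inner cut are the right-hand side of Vandermonde's identity for the fibre. Nodes and edges outside
`B` contribute factors `1`. -/
theorem coef_eq_ext (t : Σ p : Cut 𝔄 x, Cut 𝔄 p.left) :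
    t.1.coef * t.2.coef = flagConst t *
      ∏ X, ∏ j, (((t.1.nA X j + x.out t.1.eps X j).choose (t.1.extN t.2 X j) : ℕ) : ℝ) := by
  obtain ⟨p, q⟩ := t
  rw [flagConst, mul_assoc]
  refine congrArg (p.coef * ·) (congrArg₂ (· * ·) ?_ ?_)
  · refine (Finset.prod_congr rfl fun a _ => ?_).trans (prod_subtype_eq_prod
      (inst := instFintypeE p.left.toForest)
      (fun a => ∏ j, (1 / ((p.extEps q a j).factorial : ℝ))) fun a ha => ?_)
    · change _ = ∏ j, (1 / ((p.extEps q a.1 j).factorial : ℝ))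
      rw [p.extEps_of_mem q a]
    · rw [show p.extEps q a = 0 from dif_neg ha]
      simp
  · refine (Finset.prod_congr rfl fun v _ => ?_).trans (prod_subtype_eq_prod
      (inst := instFintypeN p.left.toForest)
      (fun X => ∏ j, (((p.nA X j + x.out p.eps X j).choose (p.extN q X j) : ℕ) : ℝ))
      fun v hv => ?_)
    · change _ = ∏ j, (((p.nA v.1 j + x.out p.eps v.1 j).choose (p.extN q v.1 j) : ℕ) : ℝ)
      rw [p.extN_of_mem q v]
      rfl
    · rw [show p.extN q v = 0 from dif_neg hv]
      simp

theorem finite_fiber_flagMap (hM : 𝔄.MulCoassoc) (t : Σ p : Cut 𝔄 x, Cut 𝔄 p.left) :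
    (flagMap hM ⁻¹' {t}).Finite := by
  classical
  refine Set.Finite.of_finite_image (f := flagParam) ?_ (bijOn_flagParam hM t).injOn
  rw [(bijOn_flagParam hM t).image_eq]
  exact (Set.finite_Icc 0 (Sum.elim t.1.nA t.1.eps)).subset fun m hm => ⟨zero_le, hm.1⟩

theorem sum_coef_fiber_flagMap (hM : 𝔄.MulCoassoc) (t : Σ p : Cut 𝔄 x, Cut 𝔄 p.left) :
    ∑ᶠ r ∈ flagMap hM ⁻¹' {t}, r.1.coef * r.2.coef = t.1.coef * t.2.coef := by
  classical
  rw [finsum_mem_eq_of_bijOn flagParam (bijOn_flagParam hM t) (g := fun m => flagConst t *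
    ∏ v, ∏ j, ((Sum.elim t.1.nA t.1.eps v j).choose (m v j) : ℝ))]
  · rw [← mul_finsum_mem, finsum_choose_fiber (Sum.elim id x.src) (Sum.elim t.1.nA t.1.eps)
      (t.1.extN t.2), coef_eq_ext]
    refine congrArg _ (Finset.prod_congr rfl fun X _ => Finset.prod_congr rfl fun j _ => ?_)
    rw [sum_elim_out]
    rfl
  · rintro r rfl
    exact coef_flag hM r

end Cut

namespace SubforestFamily

variable (𝔄) in
/-- A term of the iterated coproduct. -/
noncomputable def term₃ (l m r : DForest d L) :
    Tot ((𝔄.hopfSpace d).tens ((𝔄.hopfSpace d).tens (𝔄.hopfSpace d))) :=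
  tmul (𝔄.cls l) (tmul (𝔄.cls m) (𝔄.cls r))

theorem suppGE_term₃ (l m r : DForest d L) :
    SuppGE (l.deg + (m.deg + r.deg)) (𝔄.term₃ l m r) :=
  (suppGE_cls l).tmul ((suppGE_cls m).tmul (suppGE_cls r))

theorem degGE_left (r : Σ p : Cut 𝔄 x, Cut 𝔄 p.left) :
    DegGE (r.2.left.deg + (r.2.right.deg + r.1.right.deg)) (0, x.deg.2) := by
  have h1 := r.1.deg_snd
  have h2 := r.2.deg_snd
  refine ⟨Nat.zero_le _, ?_⟩
  change r.2.left.deg.2 + (r.2.right.deg.2 + r.1.right.deg.2) ≤ x.deg.2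
  omega

theorem degGE_right (r : Σ p : Cut 𝔄 x, Cut 𝔄 p.right) :
    DegGE (r.1.left.deg + (r.2.left.deg + r.2.right.deg)) (0, x.deg.2) := by
  have h1 := r.1.deg_snd
  have h2 := r.2.deg_snd
  refine ⟨Nat.zero_le _, ?_⟩
  change r.1.left.deg.2 + (r.2.left.deg.2 + r.2.right.deg.2) ≤ x.deg.2
  omega

/-- By `deg_fst` for both cuts the first degree of the triple tensor exceeds that of `x` by the sum
of the two totals of `ε`, so a bound on the degree leaves finitely many flags. -/
theorem finite_support_left (a) : (Function.support fun r : Σ p : Cut 𝔄 x, Cut 𝔄 p.left =>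
    (𝔄.term₃ r.2.left r.2.right r.1.right).1 a).Finite := by
  refine finite_support_of_suppGE (D := fun r : Σ p : Cut 𝔄 x, Cut 𝔄 p.left =>
    r.2.left.deg + (r.2.right.deg + r.1.right.deg)) (fun r => suppGE_term₃ _ _ _) (fun n => ?_) a
  refine ((Cut.finite_epsTot_le (𝔄 := 𝔄) (x := x) n).biUnion fun p _ =>
    (Cut.finite_epsTot_le (x := p.left) n).image (Sigma.mk p)).subset fun r hr => ?_
  have h1 := r.1.deg_fst
  have h2 := r.2.deg_fst
  have h3 : r.2.left.deg.1 + (r.2.right.deg.1 + r.1.right.deg.1) ≤ n := hr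
  exact Set.mem_biUnion (show r.1.epsTot ≤ n by omega)
    ⟨r.2, show r.2.epsTot ≤ n by omega, rfl⟩

theorem finite_support_right (a) : (Function.support fun r : Σ p : Cut 𝔄 x, Cut 𝔄 p.right =>
    (𝔄.term₃ r.1.left r.2.left r.2.right).1 a).Finite := by
  refine finite_support_of_suppGE (D := fun r : Σ p : Cut 𝔄 x, Cut 𝔄 p.right =>
    r.1.left.deg + (r.2.left.deg + r.2.right.deg)) (fun r => suppGE_term₃ _ _ _) (fun n => ?_) a
  refine ((Cut.finite_epsTot_le (𝔄 := 𝔄) (x := x) n).biUnion fun p _ =>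
    (Cut.finite_epsTot_le (x := p.right) n).image (Sigma.mk p)).subset fun r hr => ?_
  have h1 := r.1.deg_fst
  have h2 := r.2.deg_fst
  have h3 : r.1.left.deg.1 + (r.2.left.deg.1 + r.2.right.deg.1) ≤ n := hr
  exact Set.mem_biUnion (show r.1.epsTot ≤ n by omega)
    ⟨r.2, show r.2.epsTot ≤ n by omega, rfl⟩

variable (hM : 𝔄.MulCoassoc) (hU : 𝔄.Counital) (hC : 𝔄.ContractionInvariant)

theorem hasFSum_left (hx : 𝔄.Good x.toCForest) :
    HasFSum (fun r : Σ p : Cut 𝔄 x, Cut 𝔄 p.left =>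
      (r.1.coef * r.2.coef) • 𝔄.term₃ r.2.left r.2.right r.1.right)
      (assoc _ _ _ ((Tri.tens (comulTri d hM hU hC) (Tri.id _)).toLin (𝔄.comulVec x))) := by
  have h1 := isTri_assoc.hasFSum ((Tri.isTri
    (Tri.tens (comulTri d hM hU hC) (Tri.id (𝔄.hopfSpace d)))).hasFSum (hasFSum_comulVec x))
  refine HasFSum.sigma (t := fun p (q : Cut 𝔄 p.left) =>
    (p.coef * q.coef) • 𝔄.term₃ q.left q.right p.right) h1 (fun p => ?_)
    ⟨x.deg.2, fun r => ((suppGE_term₃ _ _ _).mono (degGE_left r)).smul _⟩ fun a => ?_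
  · rw [map_smul, map_smul, term, Tri.tens_tmul, Tri.toLin_id, comulTri_cls hM hU hC
      (good_left hU hx p)]
    refine ((isTri_assoc.hasFSum
      (hasFSum_tmul_right (hasFSum_comulVec p.left) (𝔄.cls p.right))).smul p.coef).congr fun q => ?_
    rw [tmul_smul_left, map_smul, term, assoc_tmul, smul_smul]
    rfl
  · refine (finite_support_left a).subset fun r hr h0 => hr ?_
    exact (congrArg ((r.1.coef * r.2.coef) • ·) h0).trans (smul_zero _)

theorem hasFSum_right (hx : 𝔄.Good x.toCForest) :
    HasFSum (fun r : Σ p : Cut 𝔄 x, Cut 𝔄 p.right =>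
      (r.1.coef * r.2.coef) • 𝔄.term₃ r.1.left r.2.left r.2.right)
      ((Tri.tens (Tri.id _) (comulTri d hM hU hC)).toLin (𝔄.comulVec x)) := by
  have h1 := (Tri.isTri
    (Tri.tens (Tri.id (𝔄.hopfSpace d)) (comulTri d hM hU hC))).hasFSum (hasFSum_comulVec x)
  refine HasFSum.sigma (t := fun p (q : Cut 𝔄 p.right) =>
    (p.coef * q.coef) • 𝔄.term₃ p.left q.left q.right) h1 (fun p => ?_)
    ⟨x.deg.2, fun r => ((suppGE_term₃ _ _ _).mono (degGE_right r)).smul _⟩ fun a => ?_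
  · rw [map_smul, term, Tri.tens_tmul, Tri.toLin_id, comulTri_cls hM hU hC
      (good_right hU hx p)]
    refine ((hasFSum_tmul_left (hasFSum_comulVec p.right) (𝔄.cls p.left)).smul p.coef).congr fun q => ?_
    rw [tmul_smul_right, smul_smul]
    rfl
  · refine (finite_support_right a).subset fun r hr h0 => hr ?_
    exact (congrArg ((r.1.coef * r.2.coef) • ·) h0).trans (smul_zero _)

/-- `flagMap` carries the flags of `(1 ⊗ Δ) Δ` to those of `(Δ ⊗ 1) Δ` with isomorphic tensor
factors, and the coefficients add up over its finite fibres. -/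
theorem coassoc_comulVec (hx : 𝔄.Good x.toCForest) :
    assoc _ _ _ ((Tri.tens (comulTri d hM hU hC) (Tri.id _)).toLin (𝔄.comulVec x)) =
      (Tri.tens (Tri.id _) (comulTri d hM hU hC)).toLin (𝔄.comulVec x) := by
  refine (HasFSum.fiberwise (g := Cut.flagMap hM) (w := fun r => r.1.coef * r.2.coef)
    (W := fun t => t.1.coef * t.2.coef)
    (f := fun t => 𝔄.term₃ t.2.left t.2.right t.1.right)
    ((hasFSum_right hM hU hC hx).congr fun r => ?_) (hasFSum_left hM hU hC hx)
    (Cut.finite_fiber_flagMap hM) finite_support_left (Cut.sum_coef_fiber_flagMap hM)).symm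
  rw [term₃, term₃, ← cls_eq_of_dIso (r.1.flagFst hM r.2), ← cls_eq_of_dIso (r.1.flagSnd hM r.2),
    ← cls_eq_of_dIso (r.1.flagThd hM r.2)]
  rfl

theorem coassoc_comulTri :
    assoc _ _ _ ∘ₗ (Tri.tens (comulTri d hM hU hC) (Tri.id _)).toLin ∘ₗ
      (comulTri d hM hU hC).toLin =
    (Tri.tens (Tri.id _) (comulTri d hM hU hC)).toLin ∘ₗ (comulTri d hM hU hC).toLin := by
  refine IsTri.ext gen_cls (isTri_assoc.comp ((Tri.isTri _).comp (Tri.isTri _)))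
    ((Tri.isTri _).comp (Tri.isTri _)) ?_
  rintro _ ⟨x, hx, rfl⟩
  rw [LinearMap.comp_apply, LinearMap.comp_apply, LinearMap.comp_apply, comulTri_cls hM hU hC hx]
  exact coassoc_comulVec hM hU hC hx

end SubforestFamily
end HopfForest

/-! ## The bialgebra axioms -/

namespace HopfForest

theorem BiSpace.HasFSum.eq_of_forall_ne {V : BiSpace} {P : Type*} {t : P → Tot V} {s : Tot V}
    (h : HasFSum t s) (p₀ : P) (h0 : ∀ p, p ≠ p₀ → t p = 0) : s = t p₀ := by
  have h1 := hasFSum_finset (t := t) {p₀} fun p hp => h0 p (Finset.notMem_singleton.1 hp)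
  rw [Finset.sum_singleton] at h1
  exact h.unique h1

variable {d : ℕ} {L : Type} {i : ℕ} {𝔄 : SubforestFamily L i} {x : DForest d L}

theorem DForest.isUnit_mul (x y : DForest d L) :
    (x.mul y).IsUnit i ↔ x.IsUnit i ∧ y.IsUnit i := by
  constructor
  · intro h
    exact ⟨⟨fun v => h.1 (.inl v), fun a => h.2 (.inl a)⟩,
      ⟨fun v => h.1 (.inr v), fun a => h.2 (.inr a)⟩⟩
  · rintro ⟨h, h'⟩
    refine ⟨?_, ?_⟩
    · rintro (v | v)
      · exact h.1 v
      · exact h'.1 v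
    · rintro (v | v)
      · exact h.2 v
      · exact h'.2 v

namespace Cut

theorem ext_top {p q : Cut 𝔄 x} (hp : p.IsTop) (hq : q.IsTop) : p = q :=
  Cut.ext_of (hp.1.trans hq.1.symm) (hp.2.trans hq.2.symm)
    ((p.eps_eq_zero_of_top hp.1).trans (q.eps_eq_zero_of_top hq.1).symm)

/-- On the right, colour `i` occurs exactly on `A`, because `F̂_i ⊆ A`; and the remaining `𝔫 - 𝔫_A`
vanishes only for `𝔫_A = 𝔫`. -/
theorem right_isUnit_iff (p : Cut 𝔄 x) : p.right.IsUnit i ↔ p.IsTop := by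
  classical
  have hc := (𝔄.compat _ _ p.mem).hat_le
  constructor
  · rintro ⟨h1, h2⟩
    refine ⟨?_, ?_⟩
    · ext v
      · refine ⟨fun _ => trivial, fun _ => ?_⟩
        by_contra hv
        have h3 : (if v ∈ p.A.N then i else x.cN v) = i := (h1 v).1
        rw [if_neg hv] at h3
        exact hv (hc.1 h3)
      · refine ⟨fun _ => trivial, fun _ => ?_⟩
        by_contra hv
        have h3 : (if v ∈ p.A.E then i else x.cE v) = i := (h2 v).1
        rw [if_neg hv] at h3
        exact hv (hc.2 ⟨h3, 𝔄.pos.ne'⟩)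
    · exact funext fun v => le_antisymm (p.nA_le v) (tsub_eq_zero_iff_le.1 (h1 v).2)
  · intro h
    obtain ⟨h1, h2⟩ := p.allCol_right_of_top h.1
    refine ⟨fun v => ⟨h1 v, ?_⟩, fun a => ⟨h2 a, ?_⟩⟩
    · refine tsub_eq_zero_of_le ?_
      rw [h.2]
    · change (if a ∈ p.A.E then 0 else x.ee a) + p.eps a = 0
      rw [p.eps_eq_zero_of_top h.1, if_pos (by rw [h.1]; trivial)]
      rfl

variable (𝔄 x) in
/-- The cut `A = F`, `𝔫_A = 𝔫`. -/
def top (h : ⊤ ∈ 𝔄.adm x.toCForest) : Cut 𝔄 x where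
  A := ⊤
  mem := h
  nA := x.nn
  eps _ := 0
  nA_supp _ hv := absurd trivial hv
  nA_le := le_rfl
  eps_supp _ _ := rfl

theorem isTop_top (h : ⊤ ∈ 𝔄.adm x.toCForest) : (Cut.top 𝔄 x h).IsTop := ⟨rfl, rfl⟩

theorem coef_of_isTop {p : Cut 𝔄 x} (h : p.IsTop) : p.coef = 1 := by
  rw [Cut.coef, p.eps_eq_zero_of_top h.1, h.2]
  simp

/-- The left part of the cut `A = F`, `𝔫_A = 𝔫`. -/
noncomputable def leftTop (h : ⊤ ∈ 𝔄.adm x.toCForest) : DIso (Cut.top 𝔄 x h).left x where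
  eN := Equiv.subtypeUnivEquiv fun _ => trivial
  eE := Equiv.subtypeUnivEquiv fun _ => trivial
  src _ := rfl
  tgt _ := rfl
  typ _ := rfl
  cN _ := rfl
  cE _ := rfl
  nn v := by
    refine left_eq_add.2 (Finset.sum_eq_zero fun a _ => ?_)
    exact ite_self 0
  oo _ := rfl
  ee _ := rfl

variable (𝔄 x) in
/-- The cut `A = F̂_i`, `𝔫_A = 0`, `ε_A = 0`. -/
def bot (h : x.hat i ∈ 𝔄.adm x.toCForest) : Cut 𝔄 x where
  A := x.hat i
  mem := h
  nA _ := 0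
  eps _ := 0
  nA_supp _ _ := rfl
  nA_le := fun _ => zero_le
  eps_supp _ _ := rfl

/-- A unit on the left forces `A ⊆ F̂_i`, and the other inclusion always holds. The decoration `𝔫_A
+ π ε` is zero only if both parts are, and `π ε` sees every boundary edge through its source. -/
theorem eq_bot (h : x.hat i ∈ 𝔄.adm x.toCForest) {p : Cut 𝔄 x} (hp : p.left.IsUnit i) :
    p = Cut.bot 𝔄 x h := by
  obtain ⟨h1, h2⟩ := hp
  have hc := (𝔄.compat _ _ p.mem).hat_le
  have h3 : ∀ v (hv : v ∈ p.A.N), p.nA v = 0 ∧ x.out p.eps v = 0 := fun v hv =>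
    add_eq_zero.1 (h1 ⟨v, hv⟩).2
  refine Cut.ext_of ?_ (funext fun v => ?_) (funext fun a => ?_)
  · ext a
    · exact ⟨fun ha => (h1 ⟨a, ha⟩).1, fun ha => hc.1 ha⟩
    · exact ⟨fun ha => ⟨(h2 ⟨a, ha⟩).1, 𝔄.pos.ne'⟩, fun ha => hc.2 ha⟩
  · by_cases hv : v ∈ p.A.N
    · exact (h3 v hv).1
    · exact p.nA_supp v hv
  · by_cases ha : x.src a ∈ p.A.N
    · have h4 := (h3 _ ha).2
      rw [Forest.out, Finset.sum_eq_zero_iff] at h4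
      have h5 := h4 a (Finset.mem_univ a)
      rwa [if_pos rfl] at h5
    · exact p.eps_supp a fun h => ha h.2

theorem left_bot_isUnit (h : x.hat i ∈ 𝔄.adm x.toCForest) :
    (Cut.bot 𝔄 x h).left.IsUnit i := by
  refine ⟨fun v => ⟨v.2, ?_⟩, fun a => ⟨a.2.1, ?_⟩⟩
  · refine (zero_add _).trans (Finset.sum_eq_zero fun a _ => ?_)
    exact ite_self 0
  · refine x.ee_supp a.1 ?_
    rw [a.2.1]
    exact 𝔄.pos.ne'

theorem coef_bot (h : x.hat i ∈ 𝔄.adm x.toCForest) : (Cut.bot 𝔄 x h).coef = 1 := by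
  rw [Cut.coef]
  simp [Cut.bot]

/-- The right part of the cut `A = F̂_i`, `𝔫_A = 0`, `ε_A = 0`. -/
noncomputable def rightBot (h : x.hat i ∈ 𝔄.adm x.toCForest) :
    DIso (Cut.bot 𝔄 x h).right x where
  eN := Equiv.refl _
  eE := Equiv.refl _
  src _ := rfl
  tgt _ := rfl
  typ _ := rfl
  cN := by
    intro (v : x.N)
    classical
    change x.cN v = if v ∈ (x.hat i).N then i else x.cN v
    split_ifs with hv
    · exact hv
    · rfl
  cE := by
    intro (a : x.E)
    classical
    change x.cE a = if a ∈ (x.hat i).E then i else x.cE a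
    split_ifs with hv
    · exact hv.1
    · rfl
  nn v := rfl
  oo := by
    intro (v : x.N)
    classical
    refine left_eq_add.2 (Prod.ext (funext fun j => ?_) rfl)
    change ((0 : ℕ) : ℤ) + _ = 0
    rw [Nat.cast_zero, zero_add]
    refine Finset.sum_eq_zero fun a _ => ?_
    change (if x.src a = v then ((0 : ℕ) : ℤ) - (if a ∈ (x.hat i).E then (x.ee a j : ℤ) else 0)
      else 0) = 0
    by_cases ha : a ∈ (x.hat i).E
    · rw [if_pos ha, x.ee_supp a fun h0 => ha.2 (ha.1.symm.trans h0)]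
      simp
    · rw [if_neg ha]
      simp
  ee := by
    intro (a : x.E)
    classical
    change x.ee a = (if a ∈ (x.hat i).E then 0 else x.ee a) + 0
    rw [add_zero]
    split_ifs with ha
    · exact x.ee_supp a fun h0 => ha.2 (ha.1.symm.trans h0)
    · rfl

end Cut

namespace SubforestFamily

variable (hM : 𝔄.MulCoassoc) (hU : 𝔄.Counital) (hC : 𝔄.ContractionInvariant)

theorem counit_left_comulVec (hx : 𝔄.Good x.toCForest) (hU : 𝔄.Counital) :
    lunit _ ((Tri.tens (𝔄.counitTri d) (Tri.id _)).toLin (𝔄.comulVec x)) = 𝔄.cls x := by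
  have h1 := (isTri_lunit.hasFSum ((Tri.isTri
    (Tri.tens (𝔄.counitTri d) (Tri.id (𝔄.hopfSpace d)))).hasFSum (hasFSum_comulVec x)))
  refine (h1.eq_of_forall_ne (Cut.bot 𝔄 x hx.2.2) fun p hp => ?_).trans ?_
  · rw [map_smul, map_smul, term, Tri.tens_tmul, counitTri_cls (good_left hU hx p),
      if_neg fun h => hp (Cut.eq_bot _ h), tmul_zero_left, map_zero, smul_zero]
  · rw [Cut.coef_bot, one_smul, term, Tri.tens_tmul, counitTri_cls (good_left hU hx _),
      if_pos (Cut.left_bot_isUnit hx.2.2), lunit_tmul, Tri.toLin_id]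
    exact cls_eq_of_dIso (Cut.rightBot hx.2.2)

theorem counit_right_comulVec (hx : 𝔄.Good x.toCForest) (hU : 𝔄.Counital) :
    runit _ ((Tri.tens (Tri.id _) (𝔄.counitTri d)).toLin (𝔄.comulVec x)) = 𝔄.cls x := by
  have h1 := (isTri_runit.hasFSum ((Tri.isTri
    (Tri.tens (Tri.id (𝔄.hopfSpace d)) (𝔄.counitTri d))).hasFSum (hasFSum_comulVec x)))
  refine (h1.eq_of_forall_ne (Cut.top 𝔄 x hx.2.1) fun p hp => ?_).trans ?_
  · rw [map_smul, map_smul, term, Tri.tens_tmul, counitTri_cls (good_right hU hx p),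
      if_neg fun h => hp (Cut.ext_top (p.right_isUnit_iff.1 h) (Cut.isTop_top _)),
      tmul_zero_right, map_zero, smul_zero]
  · rw [Cut.coef_of_isTop (Cut.isTop_top _), one_smul, term, Tri.tens_tmul,
      counitTri_cls (good_right hU hx _), if_pos ((Cut.right_isUnit_iff _).2 (Cut.isTop_top _)),
      runit_tmul, Tri.toLin_id]
    exact cls_eq_of_dIso (Cut.leftTop hx.2.1)

theorem comulVec_empty (hU : 𝔄.Counital) (he : 𝔄.Good (CForest.empty L)) :
    𝔄.comulVec (DForest.empty d L) =
      tmul (𝔄.cls (DForest.empty d L)) (𝔄.cls (DForest.empty d L)) := by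
  have hx : 𝔄.Good (DForest.empty d L).toCForest := he
  refine ((hasFSum_comulVec _).eq_of_forall_ne (Cut.top 𝔄 _ hx.2.1) fun p hp => ?_).trans ?_
  · refine absurd (Cut.ext_top ⟨p.A_eq_top (DForest.empty_allCol d L i), ?_⟩ (Cut.isTop_top _)) hp
    exact funext fun v => Empty.elim v
  · rw [Cut.coef_of_isTop (Cut.isTop_top _), one_smul, term,
      cls_of_isUnit he (good_right hU hx _) ((Cut.right_isUnit_iff _).2 (Cut.isTop_top _)),
      cls_eq_of_dIso (Cut.leftTop hx.2.1)]

theorem mul_assoc_mulTri : (mulTri d hM).toLin ∘ₗ (Tri.tens (mulTri d hM) (Tri.id _)).toLin =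
    (mulTri d hM).toLin ∘ₗ (Tri.tens (Tri.id _) (mulTri d hM)).toLin ∘ₗ assoc _ _ _ := by
  refine IsTri.ext ((gen_cls.tmul gen_cls).tmul gen_cls)
    ((Tri.isTri _).comp (Tri.isTri _)) ((Tri.isTri _).comp ((Tri.isTri _).comp isTri_assoc)) ?_
  rintro _ ⟨_, ⟨_, ⟨x, hx, rfl⟩, _, ⟨y, hy, rfl⟩, rfl⟩, _, ⟨z, hz, rfl⟩, rfl⟩
  rw [LinearMap.comp_apply, LinearMap.comp_apply, LinearMap.comp_apply, assoc_tmul, Tri.tens_tmul,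
    Tri.tens_tmul, Tri.toLin_id, mulTri_cls, mulTri_cls]
  simp only [LinearMap.id_apply]
  rw [mulTri_cls, mulTri_cls, cls_eq_of_dIso (DForest.mulAssoc x y z)]

theorem one_mul_mulTri :
    (mulTri d hM).toLin ∘ₗ (Tri.tens (𝔄.unitTri d) (Tri.id _)).toLin = lunit _ := by
  refine IsTri.ext (gen_one.tmul gen_cls) ((Tri.isTri _).comp (Tri.isTri _)) isTri_lunit ?_
  rintro _ ⟨_, rfl, _, ⟨x, hx, rfl⟩, rfl⟩
  rw [LinearMap.comp_apply, Tri.tens_tmul, Tri.toLin_id, unitTri_one, lunit_tmul,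
    LinearMap.id_apply, mulTri_cls, cls_eq_of_dIso x.emptyMul]

theorem mul_one_mulTri :
    (mulTri d hM).toLin ∘ₗ (Tri.tens (Tri.id _) (𝔄.unitTri d)).toLin = runit _ := by
  refine IsTri.ext (gen_cls.tmul gen_one) ((Tri.isTri _).comp (Tri.isTri _)) isTri_runit ?_
  rintro _ ⟨_, ⟨x, hx, rfl⟩, _, rfl, rfl⟩
  rw [LinearMap.comp_apply, Tri.tens_tmul, Tri.toLin_id, unitTri_one, runit_tmul,
    LinearMap.id_apply, mulTri_cls, cls_eq_of_dIso x.mulEmpty]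

theorem counit_left_comulTri : lunit _ ∘ₗ (Tri.tens (𝔄.counitTri d) (Tri.id _)).toLin ∘ₗ
    (comulTri d hM hU hC).toLin = LinearMap.id := by
  refine IsTri.ext gen_cls (isTri_lunit.comp ((Tri.isTri _).comp (Tri.isTri _))) IsTri.id ?_
  rintro _ ⟨x, hx, rfl⟩
  rw [LinearMap.comp_apply, LinearMap.comp_apply, comulTri_cls hM hU hC hx]
  exact counit_left_comulVec hx hU

theorem counit_right_comulTri : runit _ ∘ₗ (Tri.tens (Tri.id _) (𝔄.counitTri d)).toLin ∘ₗ
    (comulTri d hM hU hC).toLin = LinearMap.id := by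
  refine IsTri.ext gen_cls (isTri_runit.comp ((Tri.isTri _).comp (Tri.isTri _))) IsTri.id ?_
  rintro _ ⟨x, hx, rfl⟩
  rw [LinearMap.comp_apply, LinearMap.comp_apply, comulTri_cls hM hU hC hx]
  exact counit_right_comulVec hx hU

theorem comul_mul_comulTri : (comulTri d hM hU hC).toLin ∘ₗ (mulTri d hM).toLin =
    (Tri.tens (mulTri d hM) (mulTri d hM)).toLin ∘ₗ mid _ ∘ₗ
      (Tri.tens (comulTri d hM hU hC) (comulTri d hM hU hC)).toLin := by
  refine IsTri.ext (gen_cls.tmul gen_cls) ((Tri.isTri _).comp (Tri.isTri _))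
    ((Tri.isTri _).comp (isTri_mid.comp (Tri.isTri _))) ?_
  rintro _ ⟨_, ⟨x, hx, rfl⟩, _, ⟨y, hy, rfl⟩, rfl⟩
  rw [LinearMap.comp_apply, LinearMap.comp_apply, LinearMap.comp_apply, Tri.tens_tmul,
    comulTri_cls hM hU hC hx, comulTri_cls hM hU hC hy, mulTri_cls,
    comulTri_cls hM hU hC (x := x.mul y) ((good_mul_iff hM).2 ⟨hx, hy⟩), comulVec_mul hM]

theorem counit_mul_counitTri : (𝔄.counitTri d).toLin ∘ₗ (mulTri d hM).toLin =
    lunit one ∘ₗ (Tri.tens (𝔄.counitTri d) (𝔄.counitTri d)).toLin := by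
  classical
  refine IsTri.ext (gen_cls.tmul gen_cls) ((Tri.isTri _).comp (Tri.isTri _))
    (isTri_lunit.comp (Tri.isTri _)) ?_
  rintro _ ⟨_, ⟨x, hx, rfl⟩, _, ⟨y, hy, rfl⟩, rfl⟩
  rw [LinearMap.comp_apply, LinearMap.comp_apply, Tri.tens_tmul, mulTri_cls, counitTri_cls hx,
    counitTri_cls hy, counitTri_cls (x := x.mul y) ((good_mul_iff hM).2 ⟨hx, hy⟩)]
  by_cases h : x.IsUnit i
  · rw [if_pos h, lunit_tmul]
    exact ite_eq_of_iff ((DForest.isUnit_mul x y).trans (and_iff_right h))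
  · rw [if_neg h, tmul_zero_left, map_zero, if_neg fun h' => h ((DForest.isUnit_mul x y).1 h').1]

theorem counitTri_empty (he : 𝔄.Good (CForest.empty L)) :
    (𝔄.counitTri d).toLin (𝔄.cls (DForest.empty d L)) = oneElt := by
  classical
  rw [counitTri_cls (x := DForest.empty d L) he]
  exact if_pos ⟨fun v => Empty.elim v, fun a => Empty.elim a⟩

end SubforestFamily
end HopfForest

/-! ## The recursion parameter of the antipode -/

namespace HopfForest

variable {d : ℕ} {L : Type} {i : ℕ} {𝔄 : SubforestFamily L i} {x : DForest d L}

theorem card_subtype_lt {α : Type*} [Finite α] {S : Set α} {P : α → Prop} {b : α} (hb : b ∉ S)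
    (hP : P b) : Nat.card {v : {v // v ∈ S} // P v.1} < Nat.card {v // P v} := by
  have := Fintype.ofFinite {v // P v}
  have := Fintype.ofFinite {v : {v // v ∈ S} // P v.1}
  rw [Nat.card_eq_fintype_card, Nat.card_eq_fintype_card]
  refine Fintype.card_lt_of_injective_of_notMem
    (fun v : {v : {v // v ∈ S} // P v.1} => (⟨v.1.1, v.2⟩ : {v // P v})) (fun v w h => ?_)
    (b := ⟨b, hP⟩) ?_
  · have h' : v.1.1 = w.1.1 := congrArg (fun z : {v // P v} => z.1) h
    exact Subtype.ext (Subtype.ext h')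
  · rintro ⟨v, hv⟩
    have h' : v.1.1 = b := Subtype.ext_iff.1 hv
    exact hb (h' ▸ v.1.2)

theorem card_subtype_le {α : Type*} [Finite α] {S : Set α} {P : α → Prop} :
    Nat.card {v : {v // v ∈ S} // P v.1} ≤ Nat.card {v // P v} :=
  Nat.card_le_card_of_injective (fun v => (⟨v.1.1, v.2⟩ : {v // P v})) fun v w h => by
    have h' : v.1.1 = w.1.1 := congrArg (fun z : {v // P v} => z.1) h
    exact Subtype.ext (Subtype.ext h')

theorem DForest.nSum_eq (x : DForest d L) : x.nSum = ∑ j, x.nTot j := by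
  refine Finset.sum_comm.trans (Finset.sum_congr rfl fun j _ => ?_)
  exact (Finset.sum_apply j _ _).symm

theorem DForest.size_eq_zero_iff {x : DForest d L} :
    x.size i = 0 ↔ x.toCForest.AllCol i := by
  rw [DForest.size, Nat.add_eq_zero_iff, Finite.card_eq_zero_iff, Finite.card_eq_zero_iff,
    isEmpty_subtype, isEmpty_subtype]
  exact and_congr (forall_congr' fun v => not_not) (forall_congr' fun a => not_not)

namespace Cut

theorem size_left_le (p : Cut 𝔄 x) : p.left.size i ≤ x.size i :=
  add_le_add (card_subtype_le (S := p.A.N) (P := fun v => x.cN v ≠ i))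
    (card_subtype_le (S := p.A.E) (P := fun a => x.cE a ≠ i))

/-- A node or an edge missing from `A` does not have colour `i`, because `F̂_i ⊆ A`; so it is
counted in `x` and lost on the left. -/
theorem size_left_lt (p : Cut 𝔄 x) (h : p.A ≠ ⊤) : p.left.size i < x.size i := by
  have hc := (𝔄.compat _ _ p.mem).hat_le
  by_cases hN : ∀ v, v ∈ p.A.N
  · by_cases hE : ∀ a, a ∈ p.A.E
    · refine absurd ?_ h
      ext a
      · exact ⟨fun _ => trivial, fun _ => hN a⟩
      · exact ⟨fun _ => trivial, fun _ => hE a⟩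
    · obtain ⟨a, ha⟩ := not_forall.1 hE
      refine add_lt_add_of_le_of_lt (card_subtype_le (S := p.A.N) (P := fun v => x.cN v ≠ i)) ?_
      exact card_subtype_lt (S := p.A.E) (P := fun a => x.cE a ≠ i) ha
        fun h => ha (hc.2 ⟨h, 𝔄.pos.ne'⟩)
  · obtain ⟨v, hv⟩ := not_forall.1 hN
    refine add_lt_add_of_lt_of_le ?_
      (card_subtype_le (S := p.A.E) (P := fun a => x.cE a ≠ i))
    exact card_subtype_lt (S := p.A.N) (P := fun v => x.cN v ≠ i) hv fun h => hv (hc.1 h)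

theorem size_or_nSum_lt (p : Cut 𝔄 x) (h : ¬ p.IsTop) : p.left.size i < x.size i ∨
    (p.left.size i = x.size i ∧ p.left.nSum < x.nSum) := by
  rcases p.size_left_le.lt_or_eq with h1 | h1
  · exact Or.inl h1
  · refine Or.inr ⟨h1, ?_⟩
    have hA : p.A = ⊤ := by
      by_contra hA
      exact (p.size_left_lt hA).ne h1
    have hn : p.nA < x.nn := lt_of_le_of_ne p.nA_le fun hn => h ⟨hA, hn⟩
    obtain ⟨hle, v, hv⟩ := Pi.lt_def.1 hn
    obtain ⟨hle', j, hj⟩ := Pi.lt_def.1 hv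
    rw [DForest.nSum_eq, p.nTot_left_of_top hA, DForest.nSum_eq]
    have hs : ∀ k, (∑ w, p.nA w) k ≤ x.nTot k := fun k => p.sum_nA_le k
    refine Finset.sum_lt_sum (fun k _ => hs k) ⟨j, Finset.mem_univ j, ?_⟩
    rw [Finset.sum_apply, DForest.nTot, Finset.sum_apply]
    exact Finset.sum_lt_sum (fun w _ => hle w j) ⟨v, Finset.mem_univ v, hj⟩

/-- With `A = F` and `ε = 0` the sum factors over nodes and coordinates into alternating sums of
binomials, each of which vanishes unless its upper entry is zero. It expresses that the signed
identity is a convolution inverse. -/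
theorem sum_coef_neg_one_pow (hx : x.toCForest.AllCol i) (ht : ⊤ ∈ 𝔄.adm x.toCForest) :
    ∑ᶠ p : Cut 𝔄 x, p.coef * (-1 : ℝ) ^ p.left.nSum = if x.nSum = 0 then 1 else 0 := by
  classical
  let T : Finset (x.N → Fin d → ℕ) :=
    Fintype.piFinset fun v => Fintype.piFinset fun j => Finset.range (x.nn v j + 1)
  have hT : ∀ m, m ∈ T ↔ m ≤ x.nn := by
    intro m
    simp only [T, Fintype.mem_piFinset, Finset.mem_range, Nat.lt_succ_iff]
    exact Iff.rfl
  have hbij : Set.BijOn Cut.nA (Set.univ : Set (Cut 𝔄 x)) (T : Set (x.N → Fin d → ℕ)) := by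
    refine ⟨fun p _ => (hT _).2 p.nA_le, fun p _ q _ h => ?_, fun m hm => ?_⟩
    · exact (bijOn_nA hx ht (∑ v, p.nA v)).injOn rfl
        (show ∑ v, q.nA v = ∑ v, p.nA v by rw [show q.nA = p.nA from h.symm]) h
    · obtain ⟨p, -, hp⟩ := (bijOn_nA hx ht (∑ v, m v)).surjOn ⟨(hT m).1 hm, rfl⟩
      exact ⟨p, trivial, hp⟩
  rw [← finsum_mem_univ, finsum_mem_eq_of_bijOn Cut.nA hbij (g := fun m =>
    ∏ v, ∏ j, ((-1 : ℝ) ^ m v j * ((x.nn v j).choose (m v j) : ℝ))), finsum_mem_coe_finset]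
  · have h1 : ∀ v j, ∑ k ∈ Finset.range (x.nn v j + 1),
        ((-1 : ℝ) ^ k * ((x.nn v j).choose k : ℝ)) = if x.nn v j = 0 then 1 else 0 := by
      intro v j
      have h := @Int.alternating_sum_range_choose (x.nn v j)
      exact_mod_cast congrArg (Int.cast : ℤ → ℝ) h
    have h2 : ∑ m ∈ T, ∏ v, ∏ j, ((-1 : ℝ) ^ m v j * ((x.nn v j).choose (m v j) : ℝ)) =
        ∏ v, ∏ j, ∑ k ∈ Finset.range (x.nn v j + 1),
          ((-1 : ℝ) ^ k * ((x.nn v j).choose k : ℝ)) := by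
      rw [← Finset.prod_univ_sum (fun v => Fintype.piFinset fun j => Finset.range (x.nn v j + 1))
        fun v (m : Fin d → ℕ) => ∏ j, ((-1 : ℝ) ^ m j * ((x.nn v j).choose (m j) : ℝ))]
      exact Finset.prod_congr rfl fun v _ => (Finset.prod_univ_sum
        (fun j => Finset.range (x.nn v j + 1))
        fun j k => ((-1 : ℝ) ^ k * ((x.nn v j).choose k : ℝ))).symm
    rw [h2]
    simp only [h1]
    by_cases h0 : x.nSum = 0
    · rw [if_pos h0]
      refine Finset.prod_eq_one fun v _ => Finset.prod_eq_one fun j _ => if_pos ?_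
      exact Finset.sum_eq_zero_iff.1 (Finset.sum_eq_zero_iff.1 h0 v (Finset.mem_univ v)) j
        (Finset.mem_univ j)
    · rw [if_neg h0]
      obtain ⟨v, -, hv⟩ := Finset.exists_ne_zero_of_sum_ne_zero h0
      obtain ⟨j, -, hj⟩ := Finset.exists_ne_zero_of_sum_ne_zero hv
      exact Finset.prod_eq_zero (Finset.mem_univ v)
        (Finset.prod_eq_zero (Finset.mem_univ j) (if_neg hj))
  · intro p _
    have hA := p.A_eq_top hx
    rw [Cut.coef, p.eps_eq_zero_of_top hA, DForest.nSum_eq, p.nTot_left_of_top hA]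
    simp only [Finset.prod_mul_distrib, Finset.prod_pow_eq_pow_sum, Finset.sum_apply]
    rw [Finset.sum_comm]
    simp [mul_comm]

end Cut

/-! ### A rank that depends only on the class -/

namespace SubforestFamily

variable (𝔄) in
/-- The pairs `(|y|_i, |𝔫_y|)` of the elements `y` of `𝔉_i` equivalent to `x`. -/
def rankSet (x : DForest d L) : Set (ℕ ×ₗ ℕ) :=
  -- Goodness of `y` is asked for only if `x` is good, so that `x` itself is always admitted and the
  -- set is never empty.
  {r | ∃ y : DForest d L, (𝔄.Good x.toCForest → 𝔄.Good y.toCForest) ∧ Eqv i x y ∧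
    r = toLex (y.size i, y.nSum)}

theorem rankSet_nonempty (x : DForest d L) : (𝔄.rankSet x).Nonempty :=
  ⟨_, x, id, Eqv.refl x, rfl⟩

variable (𝔄) in
/-- The least of the pairs `(|y|_i, |𝔫_y|)`, `y` equivalent to `x`, in the lexicographic order. -/
noncomputable def rank (x : DForest d L) : ℕ ×ₗ ℕ :=
  (wellFounded_lt (α := ℕ ×ₗ ℕ)).min (𝔄.rankSet x) (rankSet_nonempty x)

theorem rank_le (x : DForest d L) : 𝔄.rank x ≤ toLex (x.size i, x.nSum) :=
  not_lt.1 ((wellFounded_lt (α := ℕ ×ₗ ℕ)).not_lt_min (𝔄.rankSet x) ⟨x, id, Eqv.refl x, rfl⟩)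

theorem exists_rank_eq (hx : 𝔄.Good x.toCForest) : ∃ y : DForest d L, 𝔄.Good y.toCForest ∧
    Eqv i x y ∧ 𝔄.rank x = toLex (y.size i, y.nSum) := by
  obtain ⟨y, h1, h2, h3⟩ :=
    (wellFounded_lt (α := ℕ ×ₗ ℕ)).min_mem (𝔄.rankSet x) (rankSet_nonempty x)
  exact ⟨y, h1 hx, h2, h3⟩

/-- Contracting edges of a colour other than `i` lowers `|·|_i`, so `|·|_i` itself is not defined on
classes; a minimum over the class is, and can drive a recursion on the quotient. -/
theorem rank_inv : 𝔄.Inv (d := d) 𝔄.rank := by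
  intro x y hx hy h
  have h1 : 𝔄.rankSet x = 𝔄.rankSet y := by
    ext r
    constructor
    · rintro ⟨z, hz, h2, h3⟩
      exact ⟨z, fun _ => hz hx, h.symm.trans h2, h3⟩
    · rintro ⟨z, hz, h2, h3⟩
      exact ⟨z, fun _ => hz hy, h.trans h2, h3⟩
  unfold rank
  congr 1

theorem toLex_left_lt (p : Cut 𝔄 x) (h : ¬ p.IsTop) :
    toLex (p.left.size i, p.left.nSum) < toLex (x.size i, x.nSum) :=
  Prod.Lex.toLex_lt_toLex.2 (p.size_or_nSum_lt h)

end SubforestFamily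
end HopfForest

/-! ## The antipode -/

namespace HopfForest

variable {d : ℕ} {L : Type} {i : ℕ} {𝔄 : SubforestFamily L i} {x : DForest d L}

namespace SubforestFamily

universe u

variable (𝔄) in
/-- A triangular linear map as a triangular family. -/
noncomputable def ofIsTri {W : BiSpace.{u}} (T : Tot (𝔄.hopfSpace d) →ₗ[ℝ] Tot W) (hT : IsTri T) :
    Tri (𝔄.hopfSpace d) W :=
  𝔄.liftTri (fun x => T (𝔄.cls x)) (fun _ _ hx hy h => congrArg T (cls_eq hx hy h))
    fun x _ => hT _ _ (suppGE_cls x)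

theorem toLin_ofIsTri {W : BiSpace.{u}} (T : Tot (𝔄.hopfSpace d) →ₗ[ℝ] Tot W) (hT : IsTri T) :
    (𝔄.ofIsTri T hT).toLin = T := by
  refine IsTri.ext gen_cls (Tri.isTri _) hT ?_
  rintro _ ⟨x, hx, rfl⟩
  exact liftTri_cls _ _ hx

/-! ### Convolution with the identity -/

variable (hM : 𝔄.MulCoassoc)

/-- `m ∘ (f ⊗ 1)`. -/
noncomputable def mulLeft (f : Tri (𝔄.hopfSpace d) (𝔄.hopfSpace d)) :
    Tot ((𝔄.hopfSpace d).tens (𝔄.hopfSpace d)) →ₗ[ℝ] Tot (𝔄.hopfSpace d) :=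
  (mulTri d hM).toLin ∘ₗ (Tri.tens f (Tri.id _)).toLin

theorem isTri_mulLeft (f : Tri (𝔄.hopfSpace d) (𝔄.hopfSpace d)) : IsTri (mulLeft hM f) :=
  (Tri.isTri _).comp (Tri.isTri _)

theorem mulLeft_term (f : Tri (𝔄.hopfSpace d) (𝔄.hopfSpace d)) (l r : DForest d L) :
    mulLeft hM f (𝔄.term l r) = (mulTri d hM).toLin (tmul (f.toLin (𝔄.cls l)) (𝔄.cls r)) := by
  rw [mulLeft, LinearMap.comp_apply, term, Tri.tens_tmul, Tri.toLin_id, LinearMap.id_apply]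

theorem mul_empty (v : Tot (𝔄.hopfSpace d)) :
    (mulTri d hM).toLin (tmul v (𝔄.cls (DForest.empty d L))) = v := by
  have h := LinearMap.congr_fun (mul_one_mulTri (d := d) hM) (tmul v oneElt)
  rwa [LinearMap.comp_apply, Tri.tens_tmul, Tri.toLin_id, LinearMap.id_apply, unitTri_one,
    runit_tmul] at h

/-- The leading term of `m (f ⊗ 1) Δ` is `f` itself, since the right factor of this cut is a unit.
-/
theorem mulLeft_top (hU : 𝔄.Counital) (he : 𝔄.Good (CForest.empty L)) (hx : 𝔄.Good x.toCForest)
    (f : Tri (𝔄.hopfSpace d) (𝔄.hopfSpace d)) {p : Cut 𝔄 x} (hp : p.IsTop) :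
    mulLeft hM f (p.coef • 𝔄.term p.left p.right) = f.toLin (𝔄.cls x) := by
  obtain rfl : p = Cut.top 𝔄 x hx.2.1 := Cut.ext_top hp (Cut.isTop_top _)
  rw [Cut.coef_of_isTop hp, one_smul, mulLeft_term,
    cls_of_isUnit he (good_right hU hx _) ((Cut.right_isUnit_iff _).2 hp), mul_empty,
    cls_eq_of_dIso (Cut.leftTop hx.2.1)]

/-- Convolution with the identity is unitriangular: when `f` and `g` agree on all other left
factors, only the leading term distinguishes the convolutions. Existence and uniqueness of the
antipode both rest on this. -/
theorem mulLeft_sub (hU : 𝔄.Counital) (he : 𝔄.Good (CForest.empty L)) (hx : 𝔄.Good x.toCForest)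
    (f g : Tri (𝔄.hopfSpace d) (𝔄.hopfSpace d))
    (h : ∀ p : Cut 𝔄 x, ¬ p.IsTop → f.toLin (𝔄.cls p.left) = g.toLin (𝔄.cls p.left)) :
    mulLeft hM f (𝔄.comulVec x) - mulLeft hM g (𝔄.comulVec x) =
      f.toLin (𝔄.cls x) - g.toLin (𝔄.cls x) := by
  have h1 := ((isTri_mulLeft hM f).sub (isTri_mulLeft hM g)).hasFSum (hasFSum_comulVec x)
  refine (h1.eq_of_forall_ne (Cut.top 𝔄 x hx.2.1) fun p hp => ?_).trans ?_
  · have hp' : ¬ p.IsTop := fun hp' => hp (Cut.ext_top hp' (Cut.isTop_top _))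
    rw [LinearMap.sub_apply, map_smul, map_smul, mulLeft_term, mulLeft_term, h p hp', sub_self]
  · rw [LinearMap.sub_apply, mulLeft_top hM hU he hx f (Cut.isTop_top _),
      mulLeft_top hM hU he hx g (Cut.isTop_top _)]

variable (𝔄 d) in
/-- The unit of the convolution algebra. -/
noncomputable def convUnit : Tot (𝔄.hopfSpace d) →ₗ[ℝ] Tot (𝔄.hopfSpace d) :=
  (𝔄.unitTri d).toLin ∘ₗ (𝔄.counitTri d).toLin

variable (hU : 𝔄.Counital) (hC : 𝔄.ContractionInvariant)

/-- `1^⋆ 1 - m ∘ (f ⊗ 1) ∘ Δ`. -/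
noncomputable def antipodeStep (f : Tri (𝔄.hopfSpace d) (𝔄.hopfSpace d)) :
    Tot (𝔄.hopfSpace d) →ₗ[ℝ] Tot (𝔄.hopfSpace d) :=
  -- If `f` vanishes at a class and is the antipode on the smaller left factors, its convolution
  -- lacks just the leading term, so this difference is the value that the left antipode axiom
  -- requires there.
  𝔄.convUnit d - mulLeft hM f ∘ₗ (comulTri d hM hU hC).toLin

theorem isTri_antipodeStep (f : Tri (𝔄.hopfSpace d) (𝔄.hopfSpace d)) :
    IsTri (antipodeStep hM hU hC f) :=
  ((Tri.isTri _).comp (Tri.isTri _)).sub ((isTri_mulLeft hM f).comp (Tri.isTri _))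

open Classical in
/-- The values of the antipode in rank less than `ρ`, from those in smaller ranks. -/
noncomputable def antipodeRec (ρ : ℕ ×ₗ ℕ)
    (F : ∀ ρ' : ℕ ×ₗ ℕ, ρ' < ρ → Tri (𝔄.hopfSpace d) (𝔄.hopfSpace d)) :
    Tri (𝔄.hopfSpace d) (𝔄.hopfSpace d) :=
  𝔄.liftTri (fun x => (if h : 𝔄.rank x < ρ then antipodeStep hM hU hC (F _ h) else 0) (𝔄.cls x))
    (fun x y hx hy h => by
      beta_reduce
      rw [cls_eq hx hy h]
      have hr : 𝔄.rank x = 𝔄.rank y := rank_inv x y hx hy h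
      -- The rank occurs both in the condition and in the argument of `F`, together with a proof;
      -- replacing it by a variable lets the equality of ranks be substituted everywhere at once.
      generalize 𝔄.rank x = r at hr
      subst hr
      rfl)
    fun x _ => by
      by_cases h : 𝔄.rank x < ρ
      · rw [dif_pos h]
        exact isTri_antipodeStep hM hU hC _ _ _ (suppGE_cls x)
      · rw [dif_neg h]
        exact SuppGE.zero _

/-- The antipode in rank less than `ρ`, extended by zero. -/
noncomputable def antipodeBelow : (ℕ ×ₗ ℕ) → Tri (𝔄.hopfSpace d) (𝔄.hopfSpace d) :=
  (wellFounded_lt (α := ℕ ×ₗ ℕ)).fix (antipodeRec hM hU hC)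

/-- The antipode of `𝓗_i`. -/
noncomputable def antipodeTri : Tri (𝔄.hopfSpace d) (𝔄.hopfSpace d) :=
  𝔄.liftTri (fun x => antipodeStep hM hU hC (antipodeBelow hM hU hC (𝔄.rank x)) (𝔄.cls x))
    (fun x y hx hy h => by
      beta_reduce
      rw [cls_eq hx hy h, rank_inv x y hx hy h])
    fun x _ => isTri_antipodeStep hM hU hC _ _ _ (suppGE_cls x)

theorem antipodeTri_cls (hx : 𝔄.Good x.toCForest) :
    (antipodeTri hM hU hC).toLin (𝔄.cls x) =
      antipodeStep hM hU hC (antipodeBelow hM hU hC (𝔄.rank x)) (𝔄.cls x) :=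
  liftTri_cls _ _ hx

theorem antipodeRec_cls (hx : 𝔄.Good x.toCForest) (ρ : ℕ ×ₗ ℕ)
    (F : ∀ ρ' : ℕ ×ₗ ℕ, ρ' < ρ → Tri (𝔄.hopfSpace d) (𝔄.hopfSpace d)) :
    (antipodeRec hM hU hC ρ F).toLin (𝔄.cls x) =
      (if h : 𝔄.rank x < ρ then antipodeStep hM hU hC (F _ h) else 0) (𝔄.cls x) :=
  (liftTri_cls _ _ hx).trans (by congr)

open Classical in
theorem antipodeBelow_cls (hx : 𝔄.Good x.toCForest) (ρ : ℕ ×ₗ ℕ) :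
    (antipodeBelow hM hU hC ρ).toLin (𝔄.cls x) =
      if 𝔄.rank x < ρ then (antipodeTri hM hU hC).toLin (𝔄.cls x) else 0 := by
  rw [antipodeBelow, WellFounded.fix_eq, antipodeRec_cls hM hU hC hx]
  by_cases h : 𝔄.rank x < ρ
  · rw [dif_pos h, if_pos h, antipodeTri_cls hM hU hC hx]
    rfl
  · rw [dif_neg h, if_neg h]
    rfl

/-- The argument is run for a representative `y` that attains the rank. Every left factor of `y`
other than the leading one then has strictly smaller rank, so the truncation agrees with the
antipode there and vanishes at `y`; `mulLeft_sub` gives the axiom. -/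
theorem antipode_left_comulVec (he : 𝔄.Good (CForest.empty L)) (hx : 𝔄.Good x.toCForest) :
    mulLeft hM (antipodeTri hM hU hC) (𝔄.comulVec x) = 𝔄.convUnit d (𝔄.cls x) := by
  obtain ⟨y, hy, hxy, hr⟩ := exists_rank_eq hx
  rw [comulVec_eq_of_eqv hM hU hC x y hx hy hxy, cls_eq hx hy hxy]
  have hr' : 𝔄.rank y = toLex (y.size i, y.nSum) := (rank_inv x y hx hy hxy).symm.trans hr
  have h1 := mulLeft_sub hM hU he hy (antipodeTri hM hU hC)
    (antipodeBelow hM hU hC (𝔄.rank y)) fun p hp => by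
      rw [antipodeBelow_cls hM hU hC (good_left hU hy p), if_pos]
      rw [hr']
      exact (rank_le p.left).trans_lt (toLex_left_lt p hp)
  rw [antipodeBelow_cls hM hU hC hy, if_neg (lt_irrefl _), sub_zero, antipodeTri_cls hM hU hC hy,
    antipodeStep, LinearMap.sub_apply, LinearMap.comp_apply, comulTri_cls hM hU hC hy] at h1
  exact sub_left_injective h1

theorem antipode_left (he : 𝔄.Good (CForest.empty L)) :
    (mulTri d hM).toLin ∘ₗ (Tri.tens (antipodeTri hM hU hC) (Tri.id _)).toLin ∘ₗ
      (comulTri d hM hU hC).toLin = (𝔄.unitTri d).toLin ∘ₗ (𝔄.counitTri d).toLin := by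
  refine IsTri.ext gen_cls ((Tri.isTri _).comp ((Tri.isTri _).comp (Tri.isTri _)))
    ((Tri.isTri _).comp (Tri.isTri _)) ?_
  rintro _ ⟨x, hx, rfl⟩
  rw [LinearMap.comp_apply, LinearMap.comp_apply, comulTri_cls hM hU hC hx]
  exact antipode_left_comulVec hM hU hC he hx

/-- Induction on `(|x|_i, |𝔫|)` with `mulLeft_sub`. The predicate `P`, inherited by left factors,
permits a comparison on part of the forests only; it is used with `True` and with `AllCol`. -/
theorem eq_of_mulLeft_eq (hU : 𝔄.Counital) (he : 𝔄.Good (CForest.empty L))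
    {f g : Tri (𝔄.hopfSpace d) (𝔄.hopfSpace d)} (P : DForest d L → Prop)
    (hP : ∀ x : DForest d L, 𝔄.Good x.toCForest → P x → ∀ p : Cut 𝔄 x, P p.left)
    (h : ∀ x : DForest d L, 𝔄.Good x.toCForest → P x →
      mulLeft hM f (𝔄.comulVec x) = mulLeft hM g (𝔄.comulVec x))
    (hx : 𝔄.Good x.toCForest) (hx' : P x) : f.toLin (𝔄.cls x) = g.toLin (𝔄.cls x) := by
  induction hr : toLex (x.size i, x.nSum) using
    (wellFounded_lt (α := ℕ ×ₗ ℕ)).induction generalizing x with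
  | _ r ih =>
    subst hr
    have h1 := mulLeft_sub hM hU he hx f g fun p hp =>
      ih _ (toLex_left_lt p hp) (good_left hU hx p) (hP x hx hx' p) rfl
    rw [h x hx hx', sub_self] at h1
    exact (sub_eq_zero.1 h1.symm)

/-- `m ∘ (1 ⊗ S) ∘ Δ`. -/
noncomputable def convRight : Tot (𝔄.hopfSpace d) →ₗ[ℝ] Tot (𝔄.hopfSpace d) :=
  (mulTri d hM).toLin ∘ₗ (Tri.tens (Tri.id _) (antipodeTri hM hU hC)).toLin ∘ₗ
    (comulTri d hM hU hC).toLin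

theorem isTri_convRight : IsTri (convRight (d := d) hM hU hC) :=
  (Tri.isTri _).comp ((Tri.isTri _).comp (Tri.isTri _))

theorem isTri_convUnit : IsTri (𝔄.convUnit d) := (Tri.isTri _).comp (Tri.isTri _)

theorem mulLeft_convUnit (hU : 𝔄.Counital) (hx : 𝔄.Good x.toCForest) :
    mulLeft hM (𝔄.ofIsTri (𝔄.convUnit d) isTri_convUnit) (𝔄.comulVec x) = 𝔄.cls x := by
  have h1 : mulLeft hM (𝔄.ofIsTri (𝔄.convUnit d) isTri_convUnit) =
      lunit _ ∘ₗ (Tri.tens (𝔄.counitTri d) (Tri.id _)).toLin := by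
    refine IsTri.ext (gen_cls.tmul gen_cls) (isTri_mulLeft _ _) (isTri_lunit.comp (Tri.isTri _)) ?_
    rintro _ ⟨_, ⟨x, hx, rfl⟩, _, ⟨y, hy, rfl⟩, rfl⟩
    rw [← one_mul_mulTri (d := d) hM, mulLeft, LinearMap.comp_apply, LinearMap.comp_apply,
      LinearMap.comp_apply, Tri.tens_tmul, Tri.tens_tmul, Tri.tens_tmul, toLin_ofIsTri,
      Tri.toLin_id]
    rfl
  rw [h1]
  exact counit_left_comulVec hx hU

/-- In convolution notation `(1 ⋆ S) ⋆ 1 = 1 ⋆ (S ⋆ 1) = 1`, by associativity, coassociativity, the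
left antipode axiom and the right counit. -/
theorem mulLeft_convRight (he : 𝔄.Good (CForest.empty L)) (hx : 𝔄.Good x.toCForest) :
    mulLeft hM (𝔄.ofIsTri (convRight hM hU hC) (isTri_convRight hM hU hC)) (𝔄.comulVec x) =
      𝔄.cls x := by
  have h1 : mulLeft hM (𝔄.ofIsTri (convRight (d := d) hM hU hC) (isTri_convRight hM hU hC)) =
      (mulTri d hM).toLin ∘ₗ (Tri.tens (mulTri d hM) (Tri.id _)).toLin ∘ₗ
        (Tri.tens (Tri.tens (Tri.id _) (antipodeTri hM hU hC)) (Tri.id _)).toLin ∘ₗ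
          (Tri.tens (comulTri d hM hU hC) (Tri.id _)).toLin := by
    refine IsTri.ext (gen_cls.tmul gen_cls) (isTri_mulLeft _ _)
      ((Tri.isTri _).comp ((Tri.isTri _).comp ((Tri.isTri _).comp (Tri.isTri _)))) ?_
    rintro _ ⟨_, ⟨x, hx, rfl⟩, _, ⟨y, hy, rfl⟩, rfl⟩
    rw [mulLeft, LinearMap.comp_apply, LinearMap.comp_apply, LinearMap.comp_apply,
      LinearMap.comp_apply, Tri.tens_tmul, Tri.tens_tmul, Tri.tens_tmul, Tri.tens_tmul,
      toLin_ofIsTri, Tri.toLin_id]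
    rfl
  have h2 : assoc (𝔄.hopfSpace d) (𝔄.hopfSpace d) (𝔄.hopfSpace d) ∘ₗ
      (Tri.tens (Tri.tens (Tri.id (𝔄.hopfSpace d)) (antipodeTri hM hU hC))
      (Tri.id (𝔄.hopfSpace d))).toLin = (Tri.tens (Tri.id _)
        (Tri.tens (antipodeTri hM hU hC) (Tri.id _))).toLin ∘ₗ
          assoc (𝔄.hopfSpace d) (𝔄.hopfSpace d) (𝔄.hopfSpace d) := by
    refine IsTri.ext ((gen_cls.tmul gen_cls).tmul gen_cls) (isTri_assoc.comp (Tri.isTri _))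
      ((Tri.isTri _).comp isTri_assoc) ?_
    rintro _ ⟨_, ⟨_, ⟨x, hx, rfl⟩, _, ⟨y, hy, rfl⟩, rfl⟩, _, ⟨z, hz, rfl⟩, rfl⟩
    rw [LinearMap.comp_apply, LinearMap.comp_apply, assoc_tmul, Tri.tens_tmul, Tri.tens_tmul,
      Tri.tens_tmul, Tri.tens_tmul, assoc_tmul]
  have h3 : (Tri.tens (Tri.id (𝔄.hopfSpace d)) (mulTri d hM)).toLin ∘ₗ (Tri.tens (Tri.id _)
      (Tri.tens (antipodeTri hM hU hC) (Tri.id _))).toLin ∘ₗ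
        (Tri.tens (Tri.id _) (comulTri d hM hU hC)).toLin =
      (Tri.tens (Tri.id _) (𝔄.unitTri d)).toLin ∘ₗ (Tri.tens (Tri.id _) (𝔄.counitTri d)).toLin := by
    refine IsTri.ext (gen_cls.tmul gen_cls) ((Tri.isTri _).comp ((Tri.isTri _).comp (Tri.isTri _)))
      ((Tri.isTri _).comp (Tri.isTri _)) ?_
    rintro _ ⟨_, ⟨x, hx, rfl⟩, _, ⟨y, hy, rfl⟩, rfl⟩
    rw [LinearMap.comp_apply, LinearMap.comp_apply, LinearMap.comp_apply, Tri.tens_tmul,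
      Tri.tens_tmul, Tri.tens_tmul, Tri.tens_tmul, Tri.tens_tmul, Tri.toLin_id]
    exact congrArg (tmul _) (LinearMap.congr_fun (antipode_left hM hU hC he) (𝔄.cls y))
  have h4 : ∀ z, (mulTri d hM).toLin ((Tri.tens (mulTri d hM) (Tri.id _)).toLin z) =
      (mulTri d hM).toLin ((Tri.tens (Tri.id _) (mulTri d hM)).toLin (assoc _ _ _ z)) :=
    LinearMap.congr_fun (mul_assoc_mulTri (d := d) hM)
  rw [h1]
  simp only [LinearMap.comp_apply]
  rw [h4, show ∀ z, assoc _ _ _ ((Tri.tens (Tri.tens (Tri.id (𝔄.hopfSpace d))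
    (antipodeTri hM hU hC)) (Tri.id (𝔄.hopfSpace d))).toLin z) = _ from LinearMap.congr_fun h2,
    LinearMap.comp_apply, coassoc_comulVec hM hU hC hx]
  have h5 := LinearMap.congr_fun h3 (𝔄.comulVec x)
  simp only [LinearMap.comp_apply] at h5
  rw [h5]
  refine Eq.trans ?_ (counit_right_comulVec hx hU)
  exact LinearMap.congr_fun (mul_one_mulTri (d := d) hM) _

/-- Both `1 ⋆ S` and the convolution unit give the identity when convolved with `1` on the right,
and that operation is injective. -/
theorem antipode_right (he : 𝔄.Good (CForest.empty L)) :
    (mulTri d hM).toLin ∘ₗ (Tri.tens (Tri.id _) (antipodeTri hM hU hC)).toLin ∘ₗ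
      (comulTri d hM hU hC).toLin = (𝔄.unitTri d).toLin ∘ₗ (𝔄.counitTri d).toLin := by
  refine IsTri.ext gen_cls (isTri_convRight hM hU hC) isTri_convUnit ?_
  rintro _ ⟨x, hx, rfl⟩
  have h := eq_of_mulLeft_eq hM hU he (fun _ => True) (fun _ _ _ _ => trivial)
    (f := 𝔄.ofIsTri (convRight hM hU hC) (isTri_convRight hM hU hC))
    (g := 𝔄.ofIsTri (𝔄.convUnit d) isTri_convUnit)
    (fun y hy _ => by rw [mulLeft_convRight hM hU hC he hy, mulLeft_convUnit hM hU hy]) hx trivial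
  rwa [toLin_ofIsTri, toLin_ofIsTri] at h

end SubforestFamily
end HopfForest

/-! ## The values of the antipode -/

namespace HopfForest

variable {d : ℕ} {L : Type} {i : ℕ} {𝔄 : SubforestFamily L i} {x : DForest d L}

theorem DForest.nTot_mul (x y : DForest d L) : (x.mul y).nTot = x.nTot + y.nTot := by
  classical
  exact sum_sum_eq (α := x.N) (β := y.N) _

theorem CForest.AllCol.mul {F G : CForest L} (hF : F.AllCol i) (hG : G.AllCol i) :
    (F.mul G).AllCol i :=
  ⟨fun v => v.rec hF.1 hG.1, fun a => a.rec hF.2 hG.2⟩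

theorem DForest.isUnit_iff_nSum (hi : 0 < i) (hx : x.toCForest.AllCol i) :
    x.IsUnit i ↔ x.nSum = 0 := by
  rw [DForest.isUnit_iff hi, DForest.nSum_eq, and_iff_right hx, funext_iff,
    Finset.sum_eq_zero_iff]
  exact ⟨fun h j _ => h j, fun h j => h j (Finset.mem_univ j)⟩

theorem finsum_eq_add_finsum_subtype {P M : Type*} [AddCommMonoid M] {t : P → M}
    (ht : (Function.support t).Finite) {q : P → Prop} (p₀ : P) (hq : ∀ p, q p ↔ p = p₀) :
    ∑ᶠ p, t p = t p₀ + ∑ᶠ p : {p // ¬ q p}, t p.1 := by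
  rw [finsum_subtype_eq_finsum_cond fun p => ¬ q p, ← finsum_mem_univ t, ← Set.insert_sdiff_singleton.trans
    (Set.insert_eq_of_mem (Set.mem_univ p₀)), finsum_mem_insert' _ (fun h => h.2 rfl)
      (ht.subset Set.inter_subset_right)]
  congr 1
  refine finsum_congr fun p => finsum_congr_Prop ?_ fun _ => rfl
  exact propext ⟨fun h h' => h.2 ((hq p).1 h'), fun h => ⟨trivial, fun h' => h ((hq p).2 h')⟩⟩

namespace SubforestFamily

open Classical in
variable (𝔄 d) in
/-- `τ ↦ (-1)^{|𝔫|} τ` on the forests entirely coloured with `i`. -/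
noncomputable def signTri : Tri (𝔄.hopfSpace d) (𝔄.hopfSpace d) :=
  𝔄.liftTri (fun x => if x.toCForest.AllCol i then (-1 : ℝ) ^ x.nSum • 𝔄.cls x else 0)
    (fun x y hx hy h => ite_eq_ite ⟨h.allCol, h.symm.allCol⟩ fun h1 => by
      rw [cls_eq hx hy h, DForest.nSum_eq, DForest.nSum_eq, ← DForest.fullSum_of_allCol h1, h.2,
        DForest.fullSum_of_allCol (h.allCol h1)])
    fun x _ => by
      split_ifs
      · exact (suppGE_cls x).smul _
      · exact SuppGE.zero _

open Classical in
theorem signTri_cls (hx : 𝔄.Good x.toCForest) :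
    (𝔄.signTri d).toLin (𝔄.cls x) =
      if x.toCForest.AllCol i then (-1 : ℝ) ^ x.nSum • 𝔄.cls x else 0 :=
  liftTri_cls _ _ hx

open Classical in
theorem convUnit_cls (hx : 𝔄.Good x.toCForest) :
    𝔄.convUnit d (𝔄.cls x) = if x.IsUnit i then 𝔄.cls (DForest.empty d L) else 0 := by
  rw [convUnit, LinearMap.comp_apply, counitTri_cls hx]
  split_ifs
  · exact unitTri_one
  · exact map_zero _

variable (hM : 𝔄.MulCoassoc) (hU : 𝔄.Counital) (hC : 𝔄.ContractionInvariant)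

/-- For every cut the product of the two factors has colour `i` throughout and total decoration
`x.nTot`, hence is `x` in the quotient. Only the alternating sum of the coefficients remains. -/
theorem mulLeft_signTri (hU : 𝔄.Counital) (he : 𝔄.Good (CForest.empty L))
    (hx : 𝔄.Good x.toCForest) (hx' : x.toCForest.AllCol i) :
    mulLeft hM (𝔄.signTri d) (𝔄.comulVec x) = 𝔄.convUnit d (𝔄.cls x) := by
  classical
  have h1 := (isTri_mulLeft hM (𝔄.signTri d)).hasFSum (hasFSum_comulVec x)
  have h2 : ∀ p : Cut 𝔄 x, mulLeft hM (𝔄.signTri d) (p.coef • 𝔄.term p.left p.right) =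
      (p.coef * (-1 : ℝ) ^ p.left.nSum) • 𝔄.cls x := by
    intro p
    have hA := p.A_eq_top hx'
    have hl := p.allCol_left hx'
    have h3 : 𝔄.cls (p.left.mul p.right) = 𝔄.cls x := by
      refine cls_eq ((good_mul_iff hM).2 ⟨good_left hU hx p, good_right hU hx p⟩) hx
        (eqv_of_allCol (hl.mul (p.allCol_right_of_top hA)) hx' ?_)
      rw [DForest.nTot_mul, p.nTot_left_of_top hA, p.nTot_right]
      exact add_tsub_cancel_of_le p.sum_nA_le
    rw [map_smul, mulLeft_term, signTri_cls (good_left hU hx p), if_pos hl, tmul_smul_left,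
      map_smul, mulTri_cls, h3, smul_smul]
  have h4 : mulLeft hM (𝔄.signTri d) (𝔄.comulVec x) =
      (∑ᶠ p : Cut 𝔄 x, p.coef * (-1 : ℝ) ^ p.left.nSum) • 𝔄.cls x := by
    refine Subtype.ext (funext fun m => ?_)
    rw [h1.eq]
    exact (finsum_congr fun p => congrArg (fun v : Tot (𝔄.hopfSpace d) => v.1 m) (h2 p)).trans
      (finsum_smul (fun p : Cut 𝔄 x => p.coef * (-1 : ℝ) ^ p.left.nSum) ((𝔄.cls x).1 m)).symm
  rw [h4, Cut.sum_coef_neg_one_pow hx' hx.2.1, convUnit_cls hx]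
  by_cases h0 : x.nSum = 0
  · have hu := (DForest.isUnit_iff_nSum 𝔄.pos hx').2 h0
    rw [if_pos h0, if_pos hu, one_smul, cls_of_isUnit he hx hu]
  · rw [if_neg h0, if_neg fun h => h0 ((DForest.isUnit_iff_nSum 𝔄.pos hx').1 h), zero_smul]

/-- On forests of colour `i` the antipode and the signed identity are both left convolution inverses
of `1`, and left factors stay in this class of forests, so they coincide there. -/
theorem antipodeTri_of_size_eq_zero (he : 𝔄.Good (CForest.empty L)) (hx : 𝔄.Good x.toCForest)
    (h : x.size i = 0) :
    (antipodeTri hM hU hC).toLin (𝔄.cls x) = (-1 : ℝ) ^ x.nSum • 𝔄.cls x := by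
  have hx' := DForest.size_eq_zero_iff.1 h
  rw [eq_of_mulLeft_eq hM hU he (fun x => x.toCForest.AllCol i)
    (fun _ _ h p => p.allCol_left h) (g := 𝔄.signTri d) (fun y hy hy' => ?_) hx hx',
    signTri_cls hx, if_pos hx']
  rw [antipode_left_comulVec hM hU hC he hy, mulLeft_signTri hM hU he hy hy']

/-- A forest with `|x|_i > 0` is not a unit, so the left antipode axiom reads `0` there; the
recursion isolates its leading term. -/
theorem antipodeTri_eq_neg_finsum (he : 𝔄.Good (CForest.empty L)) (hx : 𝔄.Good x.toCForest)
    (h : 0 < x.size i) (m : ℕ × ℕ) :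
    ((antipodeTri hM hU hC).toLin (𝔄.cls x)).1 m =
      -∑ᶠ p : {p : Cut 𝔄 x // ¬ p.IsTop}, p.1.coef • ((mulTri d hM).toLin
        (tmul ((antipodeTri hM hU hC).toLin (𝔄.cls p.1.left)) (𝔄.cls p.1.right))).1 m := by
  classical
  have h1 := (isTri_mulLeft hM (antipodeTri hM hU hC)).hasFSum (hasFSum_comulVec x)
  have h2 := h1.eq m
  rw [antipode_left_comulVec hM hU hC he hx, convUnit_cls hx, if_neg fun hu =>
    h.ne' (DForest.size_eq_zero_iff.2 ((DForest.isUnit_iff 𝔄.pos).1 hu).1),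
    finsum_eq_add_finsum_subtype (h1.fin m) (Cut.top 𝔄 x hx.2.1) (q := Cut.IsTop) fun p =>
      ⟨fun hp => Cut.ext_top hp (Cut.isTop_top _), fun hp => hp ▸ Cut.isTop_top _⟩,
    mulLeft_top hM hU he hx _ (Cut.isTop_top _)] at h2
  refine (eq_neg_of_add_eq_zero_left h2.symm).trans (congrArg _ (finsum_congr fun p => ?_))
  rw [map_smul, mulLeft_term]
  rfl

end SubforestFamily
end HopfForest

open HopfForest.SubforestFamily in
open Classical in
theorem proposition3 (d : ℕ) (L : Type) [Finite L] (i : ℕ) (𝔄 : SubforestFamily L i)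
    (h_mul : 𝔄.MulCoassoc) (h_unit : 𝔄.Counital) (h_contr : 𝔄.ContractionInvariant)
    (h_empty : 𝔄.Good (CForest.empty L)) :
    -- `𝔉_i` is closed under the forest product, and `Δ_i` maps `⟨𝔉_i⟩` to `⟨𝔉_i⟩ ⊗̂ ⟨𝔉_i⟩`
    (∀ x y : DForest d L, 𝔄.Good x.toCForest → 𝔄.Good y.toCForest →
      𝔄.Good (x.mul y).toCForest) ∧
    (∀ x : DForest d L, 𝔄.Good x.toCForest → ∀ p : Cut 𝔄 x,
      𝔄.Good p.left.toCForest ∧ 𝔄.Good p.right.toCForest) ∧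
    -- `𝓗_i`, with the structure maps induced from `⟨𝔉_i⟩`, is a Hopf algebra
    ∃ H : HopfData (𝔄.hopfSpace d), H.IsHopf ∧
      (∀ x y : DForest d L, 𝔄.Good x.toCForest → 𝔄.Good y.toCForest →
        H.mul.toLin (tmul (𝔄.cls x) (𝔄.cls y)) = 𝔄.cls (x.mul y)) ∧
      (H.unit.toLin oneElt = 𝔄.cls (DForest.empty d L)) ∧
      (∀ x : DForest d L, 𝔄.Good x.toCForest → ∀ m l : ℕ × ℕ,
        (H.comul.toLin (𝔄.cls x)).1 (m, l) =
          ∑ᶠ p : Cut 𝔄 x, p.coef • ((𝔄.cls p.left).1 m ⊗ₜ[ℝ] (𝔄.cls p.right).1 l)) ∧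
      (∀ x : DForest d L, 𝔄.Good x.toCForest →
        H.counit.toLin (𝔄.cls x) = if x.IsUnit i then oneElt else 0) ∧
      -- the antipode on forests entirely coloured with `i` (`|x|_i = 0`)
      (∀ x : DForest d L, 𝔄.Good x.toCForest → x.size i = 0 →
        H.antipode.toLin (𝔄.cls x) = (-1 : ℝ) ^ x.nSum • 𝔄.cls x) ∧
      -- the recursion which determines the antipode on the other forests
      (∀ x : DForest d L, 𝔄.Good x.toCForest → 0 < x.size i → ∀ m : ℕ × ℕ,
        (H.antipode.toLin (𝔄.cls x)).1 m =
          -∑ᶠ p : {p : Cut 𝔄 x // ¬ p.IsTop}, p.1.coef •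
            (H.mul.toLin (tmul (H.antipode.toLin (𝔄.cls p.1.left)) (𝔄.cls p.1.right))).1 m) ∧
      (∀ x : DForest d L, 𝔄.Good x.toCForest → ∀ p : Cut 𝔄 x, ¬ p.IsTop →
        p.left.size i < x.size i ∨
          (p.left.size i = x.size i ∧ p.left.nSum < x.nSum)) := by
  refine ⟨fun x y hx hy => (good_mul_iff h_mul).2 ⟨hx, hy⟩,
    fun x hx p => ⟨good_left h_unit hx p, good_right h_unit hx p⟩,
    ⟨mulTri d h_mul, 𝔄.unitTri d, comulTri d h_mul h_unit h_contr, 𝔄.counitTri d,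
      antipodeTri h_mul h_unit h_contr⟩, ?_, fun x y _ _ => mulTri_cls h_mul x y, unitTri_one,
    fun x hx m l => ?_, fun x hx => counitTri_cls hx,
    fun x hx h => antipodeTri_of_size_eq_zero h_mul h_unit h_contr h_empty hx h,
    fun x hx h m => antipodeTri_eq_neg_finsum h_mul h_unit h_contr h_empty hx h m,
    fun x _ p hp => p.size_or_nSum_lt hp⟩
  · constructor
    · exact mul_assoc_mulTri h_mul
    · exact one_mul_mulTri h_mul
    · exact mul_one_mulTri h_mul
    · exact coassoc_comulTri h_mul h_unit h_contr
    · exact counit_left_comulTri h_mul h_unit h_contr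
    · exact counit_right_comulTri h_mul h_unit h_contr
    · exact comul_mul_comulTri h_mul h_unit h_contr
    · rw [unitTri_one]
      exact (comulTri_cls h_mul h_unit h_contr (x := DForest.empty d L) h_empty).trans
        (comulVec_empty h_unit h_empty)
    · exact counit_mul_counitTri h_mul
    · rw [unitTri_one]
      exact counitTri_empty h_empty
    · exact antipode_left h_mul h_unit h_contr h_empty
    · exact antipode_right h_mul h_unit h_contr h_empty
  · exact (congrArg (fun v : Tot _ => v.1 (m, l)) (comulTri_cls h_mul h_unit h_contr hx)).trans
      ((hasFSum_comulVec x).eq (m, l))
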